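/- Let $\nu\in\mathbb R$ and let $P_\nu$ be the Legendre function of the first kind on $(0,\infty)$, i.e. the analytic continuation to $(0,\infty)$ of $P_\nu(z)={}_2F_1(-\nu,\nu+1;1;\tfrac{1-z}{2})$. The zero-order Buschman–Erdélyi operators are $$ {}_1S_{0+}^{\nu}f(x)=\frac{d}{dx}\int_0^x P_\nu\!\left(\frac xt\right)f(t)\,dt,\qquad {}_1P_{0+}^{\nu}f(x)=\int_0^x P_\nu\!\left(\frac tx\right)f'(t)\,dt, $$ $$ {}_1P_{-}^{\nu}f(x)=\int_x^\infty P_\nu\!\left(\frac tx\right)(-f'(t))\,dt,\qquad {}_1S_{-}^{\nu}f(x)=-\frac{d}{dx}\int_x^\infty P_\nu\!\left(\frac xt\right)f(t)\,dt . $$ Each of them is considered in the complex space $L_2=L_2(0,\infty)$ on its natural domain: all $f\in L_2$ (locally absolutely continuous on $(0,\infty)$ for the two operators ${}_1P$, in which $f'$ occurs) for which the integral converges absolutely for every $x>0$ and the result belongs to $L_2$. The norm $\|A\|\in[0,\infty]$ of such an operator is the least $C$ with $\|Af\|_{L_2}\le C\|f\|_{L_2}$ on its domain (with $1/0=\infty$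 below), and $A$ is called bounded in $L_2$ if it extends to a bounded linear operator on $L_2$, unbounded otherwise. All these operators are densely defined in $L_2$, and for every $\nu\in\mathbb R$ $$ \|{}_1S_{0+}^{\nu}\|=\|{}_1P_{-}^{\nu}\|=\frac{1}{\min(1,\sqrt{1-\sin\pi\nu})},\qquad \|{}_1P_{0+}^{\nu}\|=\|{}_1S_{-}^{\nu}\|=\max(1,\sqrt{1-\sin\pi\nu}). $$ Moreover: 1. Each of the four norms is periodic in $\nu$ with period $2$. 2. The norms of ${}_1S_{0+}^{\nu}$ and of ${}_1P_{-}^{\nu}$ are not uniformly bounded in $\nu$ (even over those $\nu$ for which they are finite); each of them is at least $1$; if $\sin\pi\nu\le 0$, they are equal to $1$. Either of these operators is unbounded in $L_2$ if and only if $\sin\pi\nu=1$, i.e. $\nu=2k+\tfrac12$ with $k\in\mathbb Z$. 3. The operators ${}_1P_{0+}^{\nu}$ and ${}_1S_{-}^{\nu}$ are bounded in $L_2$ for all $\nu$, and their norms are at most $\sqrt2$. If $\sin\pi\nu\ge 0$, their norms are equal to $1$. The maximal value $\sqrt2$ of either norm is attained if and only if $\sin\pi\nu=-1$, i.e. $\nu=-\tfrac12+2k$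 with $k\in\mathbb Z$. -/

import Mathlib

open MeasureTheory Set
open scoped ENNReal NNReal

noncomputable section

/-- The Legendre function of the first kind `P_ν(z)` for `z > 0` (for `μ = 0` the function on the cut
`(-1, 1)` and the function on `(1, ∞)` are one analytic function). The standard
`P_ν(z) = ₂F₁(-ν, ν + 1; 1; (1 - z) / 2)` is given by a convergent power series only for
`|1 - z| < 2`; its Pfaff transform, used here, converges for every `z > 0`, as then
`|(z - 1) / (z + 1)| < 1`. -/
def legendreP (ν z : ℝ) : ℝ :=
  ((1 + z) / 2) ^ ν * ordinaryHypergeometric (-ν) (-ν) (1 : ℝ) ((z - 1) / (z + 1))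

/-- Lebesgue measure on the half-line `(0, ∞)`. -/
abbrev halfLine : Measure ℝ := volume.restrict (Ioi 0)

/-- The complex Hilbert space `L₂(0, ∞)`. -/
abbrev HalfLineL2 : Type := Lp ℂ 2 halfLine

/-- `F` is locally absolutely continuous on `(0, ∞)`, with derivative `F' = g` almost everywhere. -/
def IsACDeriv (F g : ℝ → ℂ) : Prop :=
  ∀ a b : ℝ, 0 < a → 0 < b →
    IntervalIntegrable g volume a b ∧ ∫ x in a..b, g x = F b - F a

/-! Each operator is given on its natural domain in `L₂(0, ∞)` by its graph: `T f g` says that the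
formula that defines the operator makes sense for `f` and that its value is `g ∈ L₂(0, ∞)`. -/

/-- `g = ₁S₀₊^ν f`, that is, `g(x) = d/dx ∫₀ˣ P_ν(x/t) f(t) dt`. -/
def S0plus (ν : ℝ) (f g : HalfLineL2) : Prop :=
  (∀ x : ℝ, 0 < x → IntegrableOn (fun t => (legendreP ν (x / t) : ℂ) * f t) (Ioo 0 x)) ∧
    IsACDeriv (fun x => ∫ t in Ioo 0 x, (legendreP ν (x / t) : ℂ) * f t) g

/-- `g = ₁P₀₊^ν f`, that is, `g(x) = ∫₀ˣ P_ν(t/x) f'(t) dt`. -/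
def P0plus (ν : ℝ) (f g : HalfLineL2) : Prop :=
  ∃ f₀ f₁ : ℝ → ℂ, f₀ =ᵐ[halfLine] f ∧ IsACDeriv f₀ f₁ ∧
    (∀ x : ℝ, 0 < x → IntegrableOn (fun t => (legendreP ν (t / x) : ℂ) * f₁ t) (Ioo 0 x)) ∧
    g =ᵐ[halfLine] fun x => ∫ t in Ioo 0 x, (legendreP ν (t / x) : ℂ) * f₁ t

/-- `g = ₁P₋^ν f`, that is, `g(x) = ∫ₓ^∞ P_ν(t/x) (-f'(t)) dt`. -/
def Pminus (ν : ℝ) (f g : HalfLineL2) : Prop :=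
  ∃ f₀ f₁ : ℝ → ℂ, f₀ =ᵐ[halfLine] f ∧ IsACDeriv f₀ f₁ ∧
    (∀ x : ℝ, 0 < x → IntegrableOn (fun t => (legendreP ν (t / x) : ℂ) * -f₁ t) (Ioi x)) ∧
    g =ᵐ[halfLine] fun x => ∫ t in Ioi x, (legendreP ν (t / x) : ℂ) * -f₁ t

/-- `g = ₁S₋^ν f`, that is, `g(x) = -d/dx ∫ₓ^∞ P_ν(x/t) f(t) dt`. -/
def Sminus (ν : ℝ) (f g : HalfLineL2) : Prop :=
  (∀ x : ℝ, 0 < x → IntegrableOn (fun t => (legendreP ν (x / t) : ℂ) * f t) (Ioi x)) ∧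
    IsACDeriv (fun x => -∫ t in Ioi x, (legendreP ν (x / t) : ℂ) * f t) g

/-- The graph `T` is that of a single-valued operator with dense domain in `L₂(0, ∞)`. -/
def IsDenselyDefined (T : HalfLineL2 → HalfLineL2 → Prop) : Prop :=
  (∀ f g g' : HalfLineL2, T f g → T f g' → g = g') ∧ Dense {f : HalfLineL2 | ∃ g, T f g}

/-- The norm of an operator in `L₂(0, ∞)` with graph `T`: the least `C ∈ [0, ∞]` such that
`‖T f‖ ≤ C ‖f‖` on the domain; it is `∞` if there is no finite `C`. -/
def l2Norm (T : HalfLineL2 → HalfLineL2 → Prop) : ℝ≥0∞ :=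
  sInf {C : ℝ≥0∞ | ∀ f g : HalfLineL2, T f g → ‖g‖ₑ ≤ C * ‖f‖ₑ}

/-- The operator with graph `T` extends to a bounded linear operator on all of `L₂(0, ∞)`. -/
def IsBoundedInL2 (T : HalfLineL2 → HalfLineL2 → Prop) : Prop :=
  ∃ A : HalfLineL2 →L[ℂ] HalfLineL2, ∀ f g : HalfLineL2, T f g → A f = g

end

noncomputable section

open Filter Topology

/-! Let K be the integral operator on L₂(0,∞) with kernel P'(t/x)/x on 0 < t < x, and L the one with
kernel P'(x/t)/t on 0 < t < x. As P(1) = 1, integration by parts turns ₁P₀₊ into 1 - K and ₁P₋ into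
1 + L*, and differentiation of the integrals turns ₁S₋ into 1 - K* and ₁S₀₊ into 1 + L. The operator
K is bounded, because its kernel is O(1/(x+t)); L need not be. But KL = LK = L - K, so that 1 + L
inverts 1 - K. The four operators are thus restrictions of 1 - K, of 1 - K* and of the inverses of
these two (`exists_isCarlemanFactor`).

The computation behind this is one Lagrange identity. By the Legendre equation, (α+β) P'(αv) P'(βv)
has an explicit antiderivative in v, the `concomitant`. Its values where αv = 1 or βv = 1 are again
kernels of K and L, which gives KL = LK = L - K. Its value at v = 0 is P(0)P'(0) = sin(πν)/π
(`legendreStd_zero_mul`), which gives KK* = K*K = K + K* - (sin πν/π) C, where C is the Carleman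
operator with kernel 1/(x+y). Hence (1-K)(1-K*) = (1-K*)(1-K) = 1 - (sin πν/π) C
(`norm_sq_sub_kernelOp`).

The form of C is nonnegative, as C is the square of the Laplace transform; it is at most π‖f‖² by
Schur's test. Both bounds are approached by suitable f, while π is not attained for f ≠ 0
(`eq_zero_of_carlemanForm_eq`). So ‖(1-K)f‖² lies between ‖f‖² and (1 - sin πν)‖f‖², both
approached, and the norms of 1 - K and of its inverse can be read off. As π is not attained, 1 - K
and 1 - K* are injective with dense range even when sin πν = 1.

What remains is the matter of natural domains. For every f in a domain the formula must be
justified: boundary terms at 0 and ∞ vanish by square integrability, and Fubini rests on the assumed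
absolute convergence together with the constant sign of P' on (1,∞). Conversely, C² functions
supported in a compact part of (0,∞) show that each graph is large enough. -/

/-! ### Real power series in the unit disc. -/

/-- The sequence `c` is the coefficient sequence of a real power series that converges absolutely in
the unit disc. -/
def DiscSummable (c : ℕ → ℝ) : Prop :=
  ∀ r : ℝ, 0 ≤ r → r < 1 → Summable fun n => |c n| * r ^ n

/-- The coefficients of the derivative of a power series. -/
def derivCoeff (c : ℕ → ℝ) (n : ℕ) : ℝ := (n + 1) * c (n + 1)

/-- The sum of a power series. -/
def seriesSum (c : ℕ → ℝ) (y : ℝ) : ℝ := ∑' n, c n * y ^ n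

lemma DiscSummable.summable {c : ℕ → ℝ} (hc : DiscSummable c) {y : ℝ} (hy : |y| < 1) :
    Summable fun n => c n * y ^ n := by
  refine Summable.of_norm ?_
  simpa [abs_mul, abs_pow] using hc |y| (abs_nonneg y) hy

lemma DiscSummable.hasSum {c : ℕ → ℝ} (hc : DiscSummable c) {y : ℝ} (hy : |y| < 1) :
    HasSum (fun n => c n * y ^ n) (seriesSum c y) :=
  (hc.summable hy).hasSum

/-- The factor n + 1 is absorbed by a slightly larger radius ρ < 1, since (n + 1)(r/ρ)ⁿ is bounded.
-/
lemma DiscSummable.derivCoeff {c : ℕ → ℝ} (hc : DiscSummable c) :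
    DiscSummable (derivCoeff c) := by
  intro r hr0 hr1
  obtain ⟨ρ, hρ1, hρ2⟩ := exists_between hr1
  have hρ0 : 0 < ρ := hr0.trans_lt hρ1
  have hq : r / ρ < 1 := (div_lt_one hρ0).2 hρ1
  have hs := (summable_nat_add_iff 1).2 (hc ρ hρ0.le hρ2)
  have hlim : Tendsto (fun n : ℕ => (n : ℝ) * (r / ρ) ^ n + (r / ρ) ^ n) atTop (𝓝 (0 + 0)) :=
    (tendsto_self_mul_const_pow_of_lt_one (by positivity) hq).add
      (tendsto_pow_atTop_nhds_zero_of_lt_one (by positivity) hq)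
  obtain ⟨B, hB⟩ := hlim.bddAbove_range
  refine Summable.of_nonneg_of_le (fun n => by positivity) (fun n => ?_) (hs.mul_left (B / ρ))
  have h1 : (n : ℝ) * (r / ρ) ^ n + (r / ρ) ^ n ≤ B := hB ⟨n, rfl⟩
  have h2 : r ^ n = (r / ρ) ^ n * ρ ^ n := by rw [← mul_pow, div_mul_cancel₀ _ hρ0.ne']
  have h3 : |_root_.derivCoeff c n| = (n + 1) * |c (n + 1)| := by
    rw [_root_.derivCoeff, abs_mul, abs_of_nonneg (by positivity)]
  rw [h3, h2, pow_succ]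
  calc (n + 1) * |c (n + 1)| * ((r / ρ) ^ n * ρ ^ n)
      = ((n : ℝ) * (r / ρ) ^ n + (r / ρ) ^ n) * (|c (n + 1)| * ρ ^ n) := by ring
    _ ≤ B * (|c (n + 1)| * ρ ^ n) := by gcongr
    _ = B / ρ * (|c (n + 1)| * (ρ ^ n * ρ)) := by field_simp

lemma hasSum_of_hasSum_succ {g : ℕ → ℝ} {s : ℝ} (h0 : g 0 = 0)
    (h : HasSum (fun n => g (n + 1)) s) : HasSum g s := by
  have := (hasSum_nat_add_iff (f := g) 1).1 h
  simpa [h0] using this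

lemma DiscSummable.hasDerivAt {c : ℕ → ℝ} (hc : DiscSummable c) {y : ℝ} (hy : |y| < 1) :
    HasDerivAt (seriesSum c) (seriesSum (_root_.derivCoeff c) y) y := by
  obtain ⟨ρ, hρ1, hρ2⟩ := exists_between hy
  have hρ0 : 0 < ρ := (abs_nonneg y).trans_lt hρ1
  have hs := hc.derivCoeff ρ hρ0.le hρ2
  have hs' : Summable fun n : ℕ => |(n : ℝ) * c n| * ρ ^ (n - 1) := by
    refine (summable_nat_add_iff 1).1 ?_
    simpa [_root_.derivCoeff] using hs
  have key := hasDerivAt_tsum_of_isPreconnected (u := fun n : ℕ => |(n : ℝ) * c n| * ρ ^ (n - 1))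
    (g := fun n y => c n * y ^ n) (g' := fun n y => c n * (n * y ^ (n - 1)))
    (t := Ioo (-ρ) ρ) (y₀ := 0) (y := y) hs' isOpen_Ioo isPreconnected_Ioo
    (fun n x _ => (hasDerivAt_pow n x).const_mul _)
    (fun n x hx => by
      have : |x| ≤ ρ := (abs_lt.2 hx).le
      rw [Real.norm_eq_abs, ← mul_assoc, mul_comm (c n), abs_mul, abs_pow]
      gcongr)
    ⟨by linarith, hρ0⟩ (hc.summable (by simp)) (abs_lt.1 hρ1)
  have h2 : ∑' n : ℕ, c n * (n * y ^ (n - 1)) = seriesSum (_root_.derivCoeff c) y := by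
    refine HasSum.tsum_eq (hasSum_of_hasSum_succ (by simp) ?_)
    convert! hc.derivCoeff.hasSum hy using 2 with n
    simp only [_root_.derivCoeff, Nat.add_sub_cancel]
    push_cast
    ring
  rw [h2] at key
  exact key

/-- Serves the identity theorem in `legendreStd_eq_legendreP`. -/
lemma DiscSummable.analyticAt {c : ℕ → ℝ} (hc : DiscSummable c) {y : ℝ} (hy : |y| < 1) :
    AnalyticAt ℝ (seriesSum c) y := by
  have hr : 1 ≤ (FormalMultilinearSeries.ofScalars ℝ c).radius := by
    refine ENNReal.le_of_forall_nnreal_lt fun r hr => ?_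
    refine FormalMultilinearSeries.le_radius_of_summable_norm _ ?_
    have := hc r r.2 (by exact_mod_cast hr)
    simpa [FormalMultilinearSeries.ofScalars_norm] using this
  have hb := (FormalMultilinearSeries.ofScalars ℝ c).hasFPowerSeriesOnBall
    (lt_of_lt_of_le one_pos hr)
  have heq : (FormalMultilinearSeries.ofScalars ℝ c).sum = seriesSum c := by
    funext x
    simp [FormalMultilinearSeries.sum, seriesSum, mul_comm]
  rw [heq] at hb
  refine hb.analyticAt_of_mem ?_
  refine Metric.eball_subset_eball hr ?_
  simp only [Metric.mem_eball, edist_dist, dist_zero_right, Real.norm_eq_abs]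
  rw [← ENNReal.ofReal_one]
  exact (ENNReal.ofReal_lt_ofReal_iff one_pos).2 hy

/-! ### Hypergeometric series and their differential equation. -/

/-- The hypergeometric coefficients with third parameter `1`. -/
def hyperCoeff (a b : ℝ) : ℕ → ℝ := ordinaryHypergeometricCoefficient a b (1 : ℝ)

lemma hyperCoeff_zero (a b : ℝ) : hyperCoeff a b 0 = 1 := by
  simp [hyperCoeff, ordinaryHypergeometricCoefficient]

lemma hyperCoeff_succ (a b : ℝ) (n : ℕ) :
    hyperCoeff a b (n + 1) = hyperCoeff a b n * ((a + n) * (b + n) / (n + 1) ^ 2) := by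
  have h1 : (n.factorial : ℝ) ≠ 0 := by exact_mod_cast n.factorial_ne_zero
  have h2 : (n : ℝ) + 1 ≠ 0 := by positivity
  simp only [hyperCoeff, ordinaryHypergeometricCoefficient, ascPochhammer_succ_eval,
    ascPochhammer_eval_one, Nat.factorial_succ, Nat.cast_mul, Nat.cast_add, Nat.cast_one]
  field_simp
  ring

/-- Ratio test: the ratio of consecutive coefficients tends to 1, so with the factor r it is
eventually below any ρ > r. -/
lemma discSummable_hyperCoeff (a b : ℝ) : DiscSummable (hyperCoeff a b) := by
  intro r hr0 hr1
  obtain ⟨ρ, hρ1, hρ2⟩ := exists_between hr1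
  have hlim : Tendsto (fun n : ℕ => |(a + n) / (1 + n)| * |(b + n) / (1 + n)| * r) atTop
      (𝓝 (|(1 : ℝ)| * |(1 : ℝ)| * r)) := by
    have h (x : ℝ) : Tendsto (fun n : ℕ => (x + n) / (1 + n)) atTop (𝓝 (1 : ℝ)) := by
      simpa using tendsto_add_mul_div_add_mul_atTop_nhds x (1 : ℝ) (1 : ℝ) one_ne_zero
    exact ((h a).abs.mul (h b).abs).mul_const r
  have hev : ∀ᶠ n : ℕ in atTop, |(a + n) / (1 + n)| * |(b + n) / (1 + n)| * r < ρ :=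
    hlim.eventually_lt_const (by simpa using hρ1)
  refine summable_of_ratio_norm_eventually_le hρ2 ?_
  filter_upwards [hev] with n hn
  have h : |hyperCoeff a b (n + 1)| * r ^ (n + 1) =
      |(a + n) / (1 + n)| * |(b + n) / (1 + n)| * r * (|hyperCoeff a b n| * r ^ n) := by
    rw [hyperCoeff_succ, show (a + n) * (b + n) / ((n : ℝ) + 1) ^ 2 =
      (a + n) / (1 + n) * ((b + n) / (1 + n)) by field_simp; ring, abs_mul, abs_mul, pow_succ]
    ring
  rw [Real.norm_of_nonneg (by positivity), Real.norm_of_nonneg (by positivity), h]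
  gcongr

lemma ordinaryHypergeometric_one_eq (a b y : ℝ) :
    ordinaryHypergeometric a b (1 : ℝ) y = seriesSum (hyperCoeff a b) y := by
  simp [ordinaryHypergeometric_eq_tsum, seriesSum, hyperCoeff, ordinaryHypergeometricCoefficient]

lemma seriesSum_zero (c : ℕ → ℝ) : seriesSum c 0 = c 0 := by
  rw [seriesSum, tsum_eq_single 0] <;> simp +contextual

/-- The hypergeometric differential equation. -/
lemma hypergeometric_ode (a b : ℝ) {y : ℝ} (hy : |y| < 1) :
    y * (1 - y) * seriesSum (derivCoeff (derivCoeff (hyperCoeff a b))) y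
      + (1 - (a + b + 1) * y) * seriesSum (derivCoeff (hyperCoeff a b)) y
      - a * b * seriesSum (hyperCoeff a b) y = 0 := by
  set c := hyperCoeff a b
  have hc : DiscSummable c := discSummable_hyperCoeff a b
  have h0 := hc.hasSum hy
  have h1 := hc.derivCoeff.hasSum hy
  have h2 := hc.derivCoeff.derivCoeff.hasSum hy
  -- Multiplication by y restores the exponent lost by differentiation. Once all series run over the
  -- same power, the equation is the coefficient recurrence `hrec`, term by term.
  have h1' : HasSum (fun n : ℕ => n * c n * y ^ n) (y * seriesSum (derivCoeff c) y) := by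
    refine hasSum_of_hasSum_succ (by simp) ?_
    convert! h1.mul_left y using 2 with n
    simp only [derivCoeff]; push_cast; ring
  have h2' : HasSum (fun n : ℕ => n * derivCoeff c n * y ^ n)
      (y * seriesSum (derivCoeff (derivCoeff c)) y) := by
    refine hasSum_of_hasSum_succ (by simp) ?_
    convert! h2.mul_left y using 2 with n
    simp only [derivCoeff]; push_cast; ring
  have h2'' : HasSum (fun n : ℕ => n * (n - 1) * c n * y ^ n)
      (y * (y * seriesSum (derivCoeff (derivCoeff c)) y)) := by
    refine hasSum_of_hasSum_succ (by simp) ?_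
    convert! h2'.mul_left y using 2 with n
    simp only [derivCoeff]; push_cast; ring
  have key := (((h2'.sub h2'').add h1).sub (h1'.mul_left (a + b + 1))).sub (h0.mul_left (a * b))
  have hz : ∀ n : ℕ, n * derivCoeff c n * y ^ n - n * (n - 1) * c n * y ^ n
      + derivCoeff c n * y ^ n - (a + b + 1) * (n * c n * y ^ n) - a * b * (c n * y ^ n) = 0 := by
    intro n
    have hrec : derivCoeff c n * (n + 1) = c n * ((a + n) * (b + n)) := by
      simp only [derivCoeff, c, hyperCoeff_succ]
      field_simp
    linear_combination y ^ n * hrec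
  simp only [hz] at key
  have := key.unique hasSum_zero
  linear_combination this

/-- The terms of the sequence `b` tend to `l`; then so do the Abel means. -/
lemma tendsto_one_sub_mul_seriesSum {b : ℕ → ℝ} (hb : DiscSummable b) {l : ℝ}
    (hl : Tendsto b atTop (𝓝 l)) :
    Tendsto (fun y => (1 - y) * seriesSum b y) (𝓝[<] 1) (𝓝 l) := by
  -- The differences of b have b as partial sums, and (1 - y) ∑ bₙ yⁿ = ∑ fₙ yⁿ; this is then Abel's
  -- limit theorem.
  let f : ℕ → ℝ := fun n => b n - if n = 0 then 0 else b (n - 1)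
  have hsum : ∀ n, ∑ i ∈ Finset.range (n + 1), f i = b n := by
    intro n
    induction n with
    | zero => simp [f]
    | succ k ih => rw [Finset.sum_range_succ, ih]; simp [f]
  have hf : Tendsto (fun n => ∑ i ∈ Finset.range n, f i) atTop (𝓝 l) := by
    rw [← tendsto_add_atTop_iff_nat 1]
    simpa only [hsum] using hl
  refine (Real.tendsto_tsum_powerSeries_nhdsWithin_lt hf).congr' ?_
  have hmem : Ioo (0 : ℝ) 1 ∈ 𝓝[<] (1 : ℝ) := Ioo_mem_nhdsLT one_pos
  filter_upwards [hmem] with y hy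
  have hy' : |y| < 1 := abs_lt.2 ⟨by linarith [hy.1], hy.2⟩
  have h0 := hb.hasSum hy'
  have h1 : HasSum (fun n : ℕ => (if n = 0 then 0 else b (n - 1)) * y ^ n)
      (y * seriesSum b y) := by
    refine hasSum_of_hasSum_succ (by simp) ?_
    convert! h0.mul_left y using 2 with n
    simp; ring
  have := (h0.sub h1).tsum_eq
  rw [show (1 - y) * seriesSum b y = seriesSum b y - y * seriesSum b y by ring, ← this]
  refine tsum_congr fun n => ?_
  simp only [f]; ring

/-! ### The Legendre equation and uniqueness at its singular point 1. -/

/-- `P` is the solution on `(-1, ∞)` of the Legendre differential equation that continues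
`legendreP ν`, and `P1`, `P2` are its first two derivatives. -/
structure IsLegendre (ν : ℝ) (P P1 P2 : ℝ → ℝ) : Prop where
  hasDerivAt : ∀ z, -1 < z → HasDerivAt P (P1 z) z
  hasDerivAt' : ∀ z, -1 < z → HasDerivAt P1 (P2 z) z
  ode : ∀ z, -1 < z → (1 - z ^ 2) * P2 z - 2 * z * P1 z + ν * (ν + 1) * P z = 0
  map_one : P 1 = 1
  pos : ∀ z, 1 < z → 0 < P z
  legendreP_eq : ∀ z, 0 < z → legendreP ν z = P z
  map_zero_mul : P 0 * P1 0 = Real.sin (Real.pi * ν) / Real.pi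

/-- A solution of the Legendre equation to the right of `1` that vanishes at `1` is zero. -/
lemma legendre_ode_unique {l : ℝ} {d d1 d2 : ℝ → ℝ} {b : ℝ}
    (h1 : ∀ z ∈ Ico 1 b, HasDerivAt d (d1 z) z) (h2 : ∀ z ∈ Ico 1 b, HasDerivAt d1 (d2 z) z)
    (hode : ∀ z ∈ Ico 1 b, (1 - z ^ 2) * d2 z - 2 * z * d1 z + l * d z = 0) (h0 : d 1 = 0)
    {z : ℝ} (hz : z ∈ Ico 1 b) : d z = 0 := by
  -- An energy estimate. The weight z² - 1 vanishes at the singular point, so d(1) = 0 alone makes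
  -- E(1) = 0. By the equation, the derivative of the second factor of E is 2(1+l) d d1 - 2z d1²,
  -- which for z ≥ 1 is at most (1+l)²/2 · d²; this is the choice of C.
  let C := (1 + l) ^ 2 / 2
  let E : ℝ → ℝ := fun z => Real.exp (-C * z) * (d z ^ 2 + (z ^ 2 - 1) * d1 z ^ 2)
  have hE : ∀ z ∈ Ico 1 b, HasDerivAt E (Real.exp (-C * z) * (-C)
      * (d z ^ 2 + (z ^ 2 - 1) * d1 z ^ 2)
      + Real.exp (-C * z) * (2 * d z * d1 z + (2 * z * d1 z ^ 2
        + (z ^ 2 - 1) * (2 * d1 z * d2 z)))) z := by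
    intro z hz
    have e1 : HasDerivAt (fun z => Real.exp (-C * z)) (Real.exp (-C * z) * (-C)) z := by
      simpa using ((hasDerivAt_id z).const_mul (-C)).exp
    have e2 := (h1 z hz).pow 2
    have e3 := (h2 z hz).pow 2
    have e4 : HasDerivAt (fun z : ℝ => z ^ 2 - 1) (2 * z) z := by
      simpa using (hasDerivAt_pow 2 z).sub_const 1
    refine (e1.mul (e2.add (e4.mul e3))).congr_deriv ?_
    simp
  have hanti : AntitoneOn E (Ico 1 b) := by
    refine antitoneOn_of_hasDerivWithinAt_nonpos (convex_Ico 1 b)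
      (fun z hz => (hE z hz).continuousAt.continuousWithinAt)
      (fun z hz => (hE z (interior_subset hz)).hasDerivWithinAt) (fun z hz => ?_)
    have hz' := interior_subset hz
    have ho := hode z hz'
    have hz1 : 1 ≤ z := hz'.1
    rw [mul_assoc, ← mul_add]
    refine mul_nonpos_of_nonneg_of_nonpos (Real.exp_pos _).le ?_
    have e : (z ^ 2 - 1) * (2 * d1 z * d2 z) = 2 * d1 z * (l * d z - 2 * z * d1 z) := by
      linear_combination (-2 * d1 z) * ho
    rw [e]
    have hC : 0 ≤ C := by positivity
    have h3 : 0 ≤ C * ((z ^ 2 - 1) * d1 z ^ 2) := by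
      have : 0 ≤ z ^ 2 - 1 := by nlinarith
      positivity
    have h4 : 0 ≤ (z - 1) * d1 z ^ 2 := mul_nonneg (by linarith) (sq_nonneg _)
    have h5 : 0 ≤ ((1 + l) * d z - 2 * d1 z) ^ 2 := sq_nonneg _
    simp only [C] at *
    nlinarith
  have hle : E z ≤ 0 := by
    have := hanti ⟨le_rfl, hz.1.trans_lt hz.2⟩ hz hz.1
    simpa [E, h0] using this
  have h6 : d z ^ 2 + (z ^ 2 - 1) * d1 z ^ 2 ≤ 0 :=
    nonpos_of_mul_nonpos_right hle (Real.exp_pos _)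
  have h7 : 0 ≤ (z ^ 2 - 1) * d1 z ^ 2 := by
    have : 0 ≤ z ^ 2 - 1 := by nlinarith [hz.1]
    positivity
  exact pow_eq_zero_iff (two_ne_zero) |>.1 (le_antisymm (by linarith) (sq_nonneg _))

/-! ### Two series for the Legendre function, on (-1, 3) and on (0, ∞). -/

/-- The Legendre function as the hypergeometric series in `(1 - z) / 2`. -/
def legendreStd (ν z : ℝ) : ℝ := seriesSum (hyperCoeff (-ν) (ν + 1)) ((1 - z) / 2)

def legendreStd' (ν z : ℝ) : ℝ :=
  -(1 / 2) * seriesSum (derivCoeff (hyperCoeff (-ν) (ν + 1))) ((1 - z) / 2)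

def legendreStd'' (ν z : ℝ) : ℝ :=
  1 / 4 * seriesSum (derivCoeff (derivCoeff (hyperCoeff (-ν) (ν + 1)))) ((1 - z) / 2)

lemma abs_one_sub_half_lt {z : ℝ} (h1 : -1 < z) (h2 : z < 3) : |(1 - z) / 2| < 1 :=
  abs_lt.2 ⟨by linarith, by linarith⟩

lemma hasDerivAt_comp_half {c : ℕ → ℝ} (hc : DiscSummable c) {z : ℝ} (h1 : -1 < z) (h2 : z < 3) :
    HasDerivAt (fun z => seriesSum c ((1 - z) / 2))
      (-(1 / 2) * seriesSum (derivCoeff c) ((1 - z) / 2)) z := by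
  have e : HasDerivAt (fun z : ℝ => (1 - z) / 2) (-1 / 2) z :=
    ((hasDerivAt_id z).const_sub 1).div_const 2
  refine (HasDerivAt.comp z (hc.hasDerivAt (abs_one_sub_half_lt h1 h2)) e).congr_deriv ?_
  ring

lemma hasDerivAt_legendreStd (ν : ℝ) {z : ℝ} (h1 : -1 < z) (h2 : z < 3) :
    HasDerivAt (legendreStd ν) (legendreStd' ν z) z :=
  hasDerivAt_comp_half (discSummable_hyperCoeff _ _) h1 h2

lemma hasDerivAt_legendreStd' (ν : ℝ) {z : ℝ} (h1 : -1 < z) (h2 : z < 3) :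
    HasDerivAt (legendreStd' ν) (legendreStd'' ν z) z := by
  refine ((hasDerivAt_comp_half (discSummable_hyperCoeff _ _).derivCoeff h1 h2).const_mul
    (-(1 / 2))).congr_deriv ?_
  rw [legendreStd'']; ring

lemma legendreStd_ode (ν : ℝ) {z : ℝ} (h1 : -1 < z) (h2 : z < 3) :
    (1 - z ^ 2) * legendreStd'' ν z - 2 * z * legendreStd' ν z
      + ν * (ν + 1) * legendreStd ν z = 0 := by
  have := hypergeometric_ode (-ν) (ν + 1) (abs_one_sub_half_lt h1 h2)
  rw [legendreStd, legendreStd', legendreStd'']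
  linear_combination this

/-- Explicit derivatives of `legendreP`. -/
def legendrePfaff (ν : ℝ) (z : ℝ) : ℝ × ℝ × ℝ :=
  let q := ((1 + z) / 2) ^ ν
  let w := (z - 1) / (z + 1)
  let H := seriesSum (hyperCoeff (-ν) (-ν)) w
  let H1 := seriesSum (derivCoeff (hyperCoeff (-ν) (-ν))) w
  let H2 := seriesSum (derivCoeff (derivCoeff (hyperCoeff (-ν) (-ν)))) w
  (q * H, q * (ν / (1 + z) * H + 2 / (1 + z) ^ 2 * H1),
    q * ((ν ^ 2 - ν) / (1 + z) ^ 2 * H + (4 * ν - 4) / (1 + z) ^ 3 * H1 + 4 / (1 + z) ^ 4 * H2))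

lemma legendreP_eq_pfaff (ν z : ℝ) : legendreP ν z = (legendrePfaff ν z).1 := by
  rw [legendreP, ordinaryHypergeometric_one_eq]; rfl

lemma abs_pfaff_lt {z : ℝ} (hz : 0 < z) : |(z - 1) / (z + 1)| < 1 := by
  rw [abs_lt, lt_div_iff₀ (by linarith), div_lt_iff₀ (by linarith)]
  constructor <;> linarith

lemma hasDerivAt_pfaff_aux {c : ℕ → ℝ} (hc : DiscSummable c) {z : ℝ} (hz : 0 < z) :
    HasDerivAt (fun z => seriesSum c ((z - 1) / (z + 1)))
      (2 / (1 + z) ^ 2 * seriesSum (derivCoeff c) ((z - 1) / (z + 1))) z := by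
  have e : HasDerivAt (fun z : ℝ => (z - 1) / (z + 1)) (2 / (1 + z) ^ 2) z := by
    refine (((hasDerivAt_id z).sub_const 1).div ((hasDerivAt_id z).add_const 1)
      (by simp; linarith)).congr_deriv ?_
    simp only [id]; field_simp; ring
  refine (HasDerivAt.comp z (hc.hasDerivAt (abs_pfaff_lt hz)) e).congr_deriv ?_
  ring

lemma hasDerivAt_rpow_aux (ν : ℝ) {z : ℝ} (hz : 0 < z) :
    HasDerivAt (fun z : ℝ => ((1 + z) / 2) ^ ν) (((1 + z) / 2) ^ ν * (ν / (1 + z))) z := by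
  have e : HasDerivAt (fun z : ℝ => (1 + z) / 2) (1 / 2) z :=
    ((hasDerivAt_id z).const_add 1).div_const 2
  refine (e.rpow_const (p := ν) (Or.inl (by positivity))).congr_deriv ?_
  rw [Real.rpow_sub_one (by positivity)]
  field_simp

lemma hasDerivAt_legendreP (ν : ℝ) {z : ℝ} (hz : 0 < z) :
    HasDerivAt (legendreP ν) (legendrePfaff ν z).2.1 z := by
  have hc := discSummable_hyperCoeff (-ν) (-ν)
  rw [show legendreP ν = fun z => (legendrePfaff ν z).1 from funext (legendreP_eq_pfaff ν)]
  refine ((hasDerivAt_rpow_aux ν hz).mul (hasDerivAt_pfaff_aux hc hz)).congr_deriv ?_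
  simp only [legendrePfaff]; ring

lemma hasDerivAt_legendrePfaff (ν : ℝ) {z : ℝ} (hz : 0 < z) :
    HasDerivAt (fun z => (legendrePfaff ν z).2.1) (legendrePfaff ν z).2.2 z := by
  have hc := discSummable_hyperCoeff (-ν) (-ν)
  have e0 : HasDerivAt (fun z : ℝ => 1 + z) 1 z := (hasDerivAt_id z).const_add 1
  have hz1 : 1 + z ≠ 0 := by linarith
  have e1 := (e0.fun_inv hz1).const_mul ν
  have e2 := ((e0.fun_pow 2).fun_inv (pow_ne_zero 2 hz1)).const_mul 2
  refine ((hasDerivAt_rpow_aux ν hz).mul ((e1.mul (hasDerivAt_pfaff_aux hc hz)).add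
    (e2.mul (hasDerivAt_pfaff_aux hc.derivCoeff hz)))).congr_deriv ?_ |>.congr_of_eventuallyEq ?_
  · simp only [legendrePfaff, Pi.mul_apply, Pi.add_apply]; field_simp; ring
  · exact Eventually.of_forall fun z => by simp [legendrePfaff, div_eq_mul_inv]

lemma legendreP_ode (ν : ℝ) {z : ℝ} (hz : 0 < z) :
    (1 - z ^ 2) * (legendrePfaff ν z).2.2 - 2 * z * (legendrePfaff ν z).2.1
      + ν * (ν + 1) * legendreP ν z = 0 := by
  have h := hypergeometric_ode (-ν) (-ν) (abs_pfaff_lt hz)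
  rw [legendreP_eq_pfaff]
  simp only [legendrePfaff]
  set H := seriesSum (hyperCoeff (-ν) (-ν)) ((z - 1) / (z + 1))
  set H1 := seriesSum (derivCoeff (hyperCoeff (-ν) (-ν))) ((z - 1) / (z + 1))
  set H2 := seriesSum (derivCoeff (derivCoeff (hyperCoeff (-ν) (-ν)))) ((z - 1) / (z + 1))
  have hz1 : 1 + z ≠ 0 := by linarith
  have hz2 : z + 1 ≠ 0 := by linarith
  -- The hypergeometric equation at w = (z-1)/(z+1), multiplied by (z+1)²; here 1 - w = 2/(z+1).
  have h' : 2 * (z - 1) * H2 + (z + 1) * ((z + 1) - (1 - 2 * ν) * (z - 1)) * H1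
      - ν ^ 2 * (z + 1) ^ 2 * H = 0 := by
    field_simp at h
    linear_combination h
  field_simp
  linear_combination (-2 * (1 + z) * ((1 + z) / 2) ^ ν) * h'

lemma analyticAt_legendreStd (ν : ℝ) {z : ℝ} (h1 : -1 < z) (h2 : z < 3) :
    AnalyticAt ℝ (legendreStd ν) z :=
  AnalyticAt.fun_comp (f := fun z : ℝ => (1 - z) / 2)
    ((discSummable_hyperCoeff (-ν) (ν + 1)).analyticAt (abs_one_sub_half_lt h1 h2))
    ((analyticAt_const.sub analyticAt_id).div analyticAt_const two_ne_zero)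

lemma analyticAt_legendreP (ν : ℝ) {z : ℝ} (hz : 0 < z) : AnalyticAt ℝ (legendreP ν) z := by
  rw [show legendreP ν = fun z => (legendrePfaff ν z).1 from funext (legendreP_eq_pfaff ν)]
  refine AnalyticAt.mul ?_ ?_
  · have h : AnalyticAt ℝ (fun z : ℝ => (1 + z) / 2) z :=
      (analyticAt_const.add analyticAt_id).div analyticAt_const two_ne_zero
    refine ((h.log (by linarith)).mul (analyticAt_const (v := ν))).rexp'.congr ?_
    filter_upwards [Ioi_mem_nhds hz] with x hx
    have : 0 < (1 + x) / 2 := by linarith [mem_Ioi.1 hx]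
    simp [Real.rpow_def_of_pos this]
  · refine AnalyticAt.fun_comp ((discSummable_hyperCoeff _ _).analyticAt (abs_pfaff_lt hz)) ?_
    exact (analyticAt_id.sub analyticAt_const).div (analyticAt_id.add analyticAt_const)
      (by simp; linarith)

lemma legendreP_one (ν : ℝ) : legendreP ν 1 = 1 := by simp [legendreP]

lemma legendreStd_one (ν : ℝ) : legendreStd ν 1 = 1 := by
  simp [legendreStd, seriesSum_zero, hyperCoeff_zero]

/-- Both sides solve the Legendre equation and equal 1 at z = 1, so they agree on [1, 3) by
uniqueness at the singular point; the identity theorem for analytic functions carries this to (0,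
3). -/
lemma legendreStd_eq_legendreP (ν : ℝ) {z : ℝ} (h1 : 0 < z) (h2 : z < 3) :
    legendreStd ν z = legendreP ν z := by
  have hright : ∀ z ∈ Ico (1 : ℝ) 3, legendreStd ν z = legendreP ν z := by
    intro z hz
    have := legendre_ode_unique (l := ν * (ν + 1)) (b := 3)
      (d := fun z => legendreStd ν z - legendreP ν z)
      (d1 := fun z => legendreStd' ν z - (legendrePfaff ν z).2.1)
      (d2 := fun z => legendreStd'' ν z - (legendrePfaff ν z).2.2)
      (fun z hz => (hasDerivAt_legendreStd ν (by linarith [hz.1]) hz.2).sub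
        (hasDerivAt_legendreP ν (by linarith [hz.1])))
      (fun z hz => (hasDerivAt_legendreStd' ν (by linarith [hz.1]) hz.2).sub
        (hasDerivAt_legendrePfaff ν (by linarith [hz.1])))
      (fun z hz => by
        have a1 := legendreStd_ode ν (z := z) (by linarith [hz.1]) hz.2
        have a2 := legendreP_ode ν (z := z) (by linarith [hz.1])
        linear_combination a1 - a2) (by simp [legendreStd_one, legendreP_one]) hz
    linarith
  have hA : AnalyticOnNhd ℝ (legendreStd ν) (Ioo 0 3) := fun z hz =>
    analyticAt_legendreStd ν (by linarith [hz.1]) hz.2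
  have hB : AnalyticOnNhd ℝ (legendreP ν) (Ioo 0 3) := fun z hz => analyticAt_legendreP ν hz.1
  refine hA.eqOn_of_preconnected_of_eventuallyEq hB isPreconnected_Ioo (z₀ := 2) (by norm_num) ?_
    ⟨h1, h2⟩
  filter_upwards [Ioo_mem_nhds (show (1 : ℝ) < 2 by norm_num) (show (2 : ℝ) < 3 by norm_num)]
    with z hz using hright z ⟨hz.1.le, hz.2⟩

/-- For z > 1 the Pfaff series has argument in (0, 1), nonnegative coefficients (as both numerator
parameters equal -ν), and first term 1. -/
lemma legendreP_pos (ν : ℝ) {z : ℝ} (hz : 1 < z) : 0 < legendreP ν z := by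
  rw [legendreP_eq_pfaff]
  simp only [legendrePfaff]
  have hw0 : 0 ≤ (z - 1) / (z + 1) := div_nonneg (by linarith) (by linarith)
  have hn : ∀ n, 0 ≤ hyperCoeff (-ν) (-ν) n := by
    intro n
    induction n with
    | zero => simp [hyperCoeff_zero]
    | succ n ih =>
      rw [hyperCoeff_succ]
      exact mul_nonneg ih (div_nonneg (mul_self_nonneg _) (by positivity))
  have hs := (discSummable_hyperCoeff (-ν) (-ν)).summable (abs_pfaff_lt (z := z) (by linarith))
  have h1 : (1 : ℝ) ≤ seriesSum (hyperCoeff (-ν) (-ν)) ((z - 1) / (z + 1)) := by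
    have := hs.le_tsum 0 (fun n _ => mul_nonneg (hn n) (pow_nonneg hw0 n))
    rw [hyperCoeff_zero, pow_zero, mul_one] at this
    exact this
  exact mul_pos (Real.rpow_pos_of_pos (by linarith) _) (by linarith)

/-! ### The constant P(0)P'(0) = sin(πν)/π. -/

/-- The product is a partial product of Euler's formula for sin(πν), and the last factor tends to 1.
Thus the behaviour of P' at -1 is governed by the sine. -/
lemma derivCoeff_hyperCoeff_eq (ν : ℝ) (n : ℕ) :
    derivCoeff (hyperCoeff (-ν) (ν + 1)) n =
      -ν * (∏ j ∈ Finset.range n, (1 - ν ^ 2 / ((j : ℝ) + 1) ^ 2)) * ((ν + 1 + n) / (1 + n)) := by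
  induction n with
  | zero => simp [derivCoeff, hyperCoeff_succ, hyperCoeff_zero]
  | succ n ih =>
    have hrec : derivCoeff (hyperCoeff (-ν) (ν + 1)) (n + 1) =
        derivCoeff (hyperCoeff (-ν) (ν + 1)) n *
          ((n + 1 - ν) * (ν + 2 + n) / ((n + 1) * (n + 2))) := by
      simp only [derivCoeff]
      rw [hyperCoeff_succ _ _ (n + 1)]
      push_cast
      field_simp
      ring
    rw [hrec, ih, Finset.prod_range_succ]
    push_cast
    field_simp
    ring

lemma tendsto_derivCoeff_hyperCoeff (ν : ℝ) :
    Tendsto (derivCoeff (hyperCoeff (-ν) (ν + 1))) atTop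
      (𝓝 (-(Real.sin (Real.pi * ν) / Real.pi))) := by
  have h1 := (Real.tendsto_euler_sin_prod ν).div_const (-Real.pi)
  have h2 : Tendsto (fun n : ℕ => (ν + 1 + n) / (1 + n)) atTop (𝓝 (1 : ℝ)) := by
    simpa using tendsto_add_mul_div_add_mul_atTop_nhds (ν + 1) (1 : ℝ) (1 : ℝ) one_ne_zero
  have h3 := h1.mul h2
  rw [mul_one, div_neg] at h3
  refine h3.congr fun n => ?_
  rw [derivCoeff_hyperCoeff_eq]
  field_simp

lemma tendsto_hyperCoeff (ν : ℝ) :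
    Tendsto (hyperCoeff (-ν) (ν + 1)) atTop (𝓝 0) := by
  rw [← tendsto_add_atTop_iff_nat 1]
  have := (tendsto_derivCoeff_hyperCoeff ν).mul (tendsto_one_div_add_atTop_nhds_zero_nat (𝕜 := ℝ))
  rw [mul_zero] at this
  refine this.congr fun n => ?_
  simp only [derivCoeff]
  field_simp

/-- P(z) and P(-z) solve the same equation, so (1 - z²) times their Wronskian is constant on (-1,
1). At 0 it is 2P(0)P'(0). As z → 1 it tends to 2 sin(πν)/π, by the asymptotics of the coefficients
of the series near -1. -/
lemma legendreStd_zero_mul (ν : ℝ) :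
    legendreStd ν 0 * legendreStd' ν 0 = Real.sin (Real.pi * ν) / Real.pi := by
  let W : ℝ → ℝ := fun z => (1 - z ^ 2) *
    (legendreStd ν z * legendreStd' ν (-z) + legendreStd' ν z * legendreStd ν (-z))
  have hW : ∀ z ∈ Ioo (-1 : ℝ) 1, HasDerivAt W 0 z := by
    intro z hz
    have a1 := hasDerivAt_legendreStd ν (z := z) hz.1 (by linarith [hz.2])
    have a2 := hasDerivAt_legendreStd' ν (z := z) hz.1 (by linarith [hz.2])
    have b1 := HasDerivAt.scomp z (hasDerivAt_legendreStd ν (z := -z) (by linarith [hz.2])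
      (by linarith [hz.1])) (hasDerivAt_neg z)
    have b2 := HasDerivAt.scomp z (hasDerivAt_legendreStd' ν (z := -z) (by linarith [hz.2])
      (by linarith [hz.1])) (hasDerivAt_neg z)
    have c1 : HasDerivAt (fun z : ℝ => 1 - z ^ 2) (-(2 * z)) z := by
      simpa using (hasDerivAt_pow 2 z).const_sub 1
    have o1 := legendreStd_ode ν (z := z) hz.1 (by linarith [hz.2])
    have o2 := legendreStd_ode ν (z := -z) (by linarith [hz.2]) (by linarith [hz.1])
    refine (c1.mul ((a1.mul b2).add (a2.mul b1))).congr_deriv ?_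
    simp only [Pi.mul_apply, Pi.add_apply, Function.comp_apply, smul_eq_mul]
    linear_combination legendreStd ν (-z) * o1 - legendreStd ν z * o2
  have hconst : ∀ z ∈ Ioo (-1 : ℝ) 1, W z = W 0 := by
    intro z hz
    refine isOpen_Ioo.is_const_of_deriv_eq_zero isPreconnected_Ioo
      (fun x hx => (hW x hx).differentiableAt.differentiableWithinAt)
      (fun x hx => (hW x hx).deriv) hz (by norm_num)
  have hy : Tendsto (fun z : ℝ => (1 + z) / 2) (𝓝[<] 1) (𝓝[<] 1) := by
    refine tendsto_nhdsWithin_iff.2 ⟨?_, ?_⟩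
    · have : ContinuousAt (fun z : ℝ => (1 + z) / 2) 1 := by fun_prop
      have h := this.tendsto
      norm_num at h
      exact h.mono_left nhdsWithin_le_nhds
    · filter_upwards [self_mem_nhdsWithin] with z hz
      simp only [mem_Iio] at hz ⊢; linarith
  have hc := discSummable_hyperCoeff (-ν) (ν + 1)
  -- At -z the series are taken at y = (1+z)/2 → 1, where 1 - z² = 2(1+z)(1-y). Abel means show that
  -- (1-y)P(-z) vanishes in the limit, while the limit of (1-y)P'(-z) contains the sine.
  have l1 := (tendsto_one_sub_mul_seriesSum hc (tendsto_hyperCoeff ν)).comp hy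
  have l2 := (tendsto_one_sub_mul_seriesSum hc.derivCoeff
    (tendsto_derivCoeff_hyperCoeff ν)).comp hy
  have l3 : Tendsto (legendreStd ν) (𝓝[<] 1) (𝓝 1) := by
    have := (hasDerivAt_legendreStd ν (z := 1) (by norm_num) (by norm_num)).continuousAt.tendsto
    rw [legendreStd_one] at this
    exact this.mono_left nhdsWithin_le_nhds
  have l4 : Tendsto (legendreStd' ν) (𝓝[<] 1) (𝓝 (legendreStd' ν 1)) :=
    (hasDerivAt_legendreStd' ν (z := 1) (by norm_num) (by norm_num)).continuousAt.tendsto.mono_left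
      nhdsWithin_le_nhds
  have l5 : Tendsto (fun z : ℝ => 1 + z) (𝓝[<] 1) (𝓝 2) := by
    have : ContinuousAt (fun z : ℝ => 1 + z) 1 := by fun_prop
    have h := this.tendsto
    norm_num at h
    exact h.mono_left nhdsWithin_le_nhds
  have l6 := ((l3.mul l5).mul (l2.const_mul (-1))).add ((l5.mul l4).mul (l1.const_mul 2))
  have l7 : Tendsto W (𝓝[<] 1) (𝓝 (W 0)) := by
    refine tendsto_const_nhds.congr' ?_
    filter_upwards [Ioo_mem_nhdsLT (show (-1 : ℝ) < 1 by norm_num)] with z hz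
    exact (hconst z hz).symm
  have l8 : Tendsto W (𝓝[<] 1) (𝓝 (1 * 2 * (-1 * -(Real.sin (Real.pi * ν) / Real.pi))
      + 2 * legendreStd' ν 1 * (2 * 0))) := by
    refine l6.congr fun z => ?_
    simp only [W, Function.comp_apply, legendreStd', legendreStd, sub_neg_eq_add]
    ring
  have := tendsto_nhds_unique l7 l8
  simp only [W, neg_zero] at this
  linarith

/-- The hypergeometric series is used for z ≤ 0 and the Pfaff form for z > 0. They agree on (0, 3),
so near every point the glued function and its derivatives coincide with one of the two. The left
branch makes v = 0 an interior point for the concomitant. -/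
lemma exists_isLegendre (ν : ℝ) : ∃ P P1 P2 : ℝ → ℝ, IsLegendre ν P P1 P2 := by
  classical
  have h1 : ∀ z : ℝ, 0 < z → z < 3 → legendreStd' ν z = (legendrePfaff ν z).2.1 := by
    intro z hz hz3
    refine (hasDerivAt_legendreStd ν (by linarith) hz3).unique
      ((hasDerivAt_legendreP ν hz).congr_of_eventuallyEq ?_)
    filter_upwards [Ioo_mem_nhds hz hz3] with x hx using legendreStd_eq_legendreP ν hx.1 hx.2
  have h2 : ∀ z : ℝ, 0 < z → z < 3 → legendreStd'' ν z = (legendrePfaff ν z).2.2 := by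
    intro z hz hz3
    refine (hasDerivAt_legendreStd' ν (by linarith) hz3).unique
      ((hasDerivAt_legendrePfaff ν hz).congr_of_eventuallyEq ?_)
    filter_upwards [Ioo_mem_nhds hz hz3] with x hx using h1 x hx.1 hx.2
  let P : ℝ → ℝ := fun z => if z ≤ 0 then legendreStd ν z else legendreP ν z
  let P1 : ℝ → ℝ := fun z => if z ≤ 0 then legendreStd' ν z else (legendrePfaff ν z).2.1
  let P2 : ℝ → ℝ := fun z => if z ≤ 0 then legendreStd'' ν z else (legendrePfaff ν z).2.2
  have e0 : ∀ z < 3, P z = legendreStd ν z := fun z hz => by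
    simp only [P]; split_ifs with h
    · rfl
    · exact (legendreStd_eq_legendreP ν (not_le.1 h) hz).symm
  have e1 : ∀ z < 3, P1 z = legendreStd' ν z := fun z hz => by
    simp only [P1]; split_ifs with h
    · rfl
    · exact (h1 z (not_le.1 h) hz).symm
  have e2 : ∀ z < 3, P2 z = legendreStd'' ν z := fun z hz => by
    simp only [P2]; split_ifs with h
    · rfl
    · exact (h2 z (not_le.1 h) hz).symm
  have f0 : ∀ z > 0, P z = legendreP ν z := fun z hz => if_neg (not_le.2 hz)
  have f1 : ∀ z > 0, P1 z = (legendrePfaff ν z).2.1 := fun z hz => if_neg (not_le.2 hz)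
  have f2 : ∀ z > 0, P2 z = (legendrePfaff ν z).2.2 := fun z hz => if_neg (not_le.2 hz)
  refine ⟨P, P1, P2, ?_, ?_, ?_, ?_, ?_, ?_, ?_⟩
  · intro z hz
    rcases lt_or_ge z 3 with h | h
    · rw [e1 z h]
      refine (hasDerivAt_legendreStd ν hz h).congr_of_eventuallyEq ?_
      filter_upwards [Iio_mem_nhds h] with x hx using e0 x hx
    · have hz0 : 0 < z := by linarith
      rw [f1 z hz0]
      refine (hasDerivAt_legendreP ν hz0).congr_of_eventuallyEq ?_
      filter_upwards [Ioi_mem_nhds hz0] with x hx using f0 x hx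
  · intro z hz
    rcases lt_or_ge z 3 with h | h
    · rw [e2 z h]
      refine (hasDerivAt_legendreStd' ν hz h).congr_of_eventuallyEq ?_
      filter_upwards [Iio_mem_nhds h] with x hx using e1 x hx
    · have hz0 : 0 < z := by linarith
      rw [f2 z hz0]
      refine (hasDerivAt_legendrePfaff ν hz0).congr_of_eventuallyEq ?_
      filter_upwards [Ioi_mem_nhds hz0] with x hx using f1 x hx
  · intro z hz
    rcases lt_or_ge z 3 with h | h
    · rw [e0 z h, e1 z h, e2 z h]
      exact legendreStd_ode ν hz h
    · have hz0 : 0 < z := by linarith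
      rw [f0 z hz0, f1 z hz0, f2 z hz0]
      exact legendreP_ode ν hz0
  · rw [f0 1 one_pos, legendreP_one]
  · intro z hz
    rw [f0 z (by linarith)]
    exact legendreP_pos ν hz
  · exact fun z hz => (f0 z hz).symm
  · rw [e0 0 (by norm_num), e1 0 (by norm_num)]
    exact legendreStd_zero_mul ν

/-! ### The Lagrange identity and the composition of Legendre kernels. -/

namespace IsLegendre

variable {ν : ℝ} {P P1 P2 : ℝ → ℝ}

lemma continuousOn (h : IsLegendre ν P P1 P2) : ContinuousOn P (Ioi (-1)) := fun z hz =>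
  (h.hasDerivAt z hz).continuousAt.continuousWithinAt

lemma continuousOn_deriv (h : IsLegendre ν P P1 P2) : ContinuousOn P1 (Ioi (-1)) := fun z hz =>
  (h.hasDerivAt' z hz).continuousAt.continuousWithinAt

lemma exists_bound (h : IsLegendre ν P P1 P2) (b : ℝ) :
    ∃ M : ℝ, 0 ≤ M ∧ (∀ z ∈ Icc 0 b, |P z| ≤ M) ∧ ∀ z ∈ Icc 0 b, |P1 z| ≤ M := by
  have hsub : Icc 0 b ⊆ Ioi (-1) := fun z hz => by simp only [mem_Ioi]; linarith [hz.1]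
  obtain ⟨M, hM⟩ := isCompact_Icc.exists_bound_of_continuousOn (h.continuousOn.mono hsub)
  obtain ⟨N, hN⟩ := isCompact_Icc.exists_bound_of_continuousOn (h.continuousOn_deriv.mono hsub)
  exact ⟨max (max M N) 0, le_max_right _ _,
    fun z hz => (hM z hz).trans ((le_max_left _ _).trans (le_max_left _ _)),
    fun z hz => (hN z hz).trans ((le_max_right _ _).trans (le_max_left _ _))⟩

/-- The bilinear concomitant of `P (α v)` and `P (β v)`. -/
def concomitant (P P1 : ℝ → ℝ) (α β v : ℝ) : ℝ :=
  (β * (1 - (α * v) ^ 2) * P1 (α * v) * P (β * v)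
    - α * (1 - (β * v) ^ 2) * P (α * v) * P1 (β * v)) / (β - α)

/-- The derivative of (1 - γ²v²) P'(γv) is -ν(ν+1) γ P(γv). With the weights β and α the terms in
P(αv)P(βv) cancel, and the coefficient β²(1-α²v²) - α²(1-β²v²) = β² - α² is left, divided by β - α.
-/
lemma hasDerivAt_concomitant (h : IsLegendre ν P P1 P2) {α β v : ℝ} (hαβ : α ≠ β)
    (hα : -1 < α * v) (hβ : -1 < β * v) :
    HasDerivAt (concomitant P P1 α β) ((α + β) * (P1 (α * v) * P1 (β * v))) v := by
  have e (γ : ℝ) : HasDerivAt (fun v : ℝ => γ * v) γ v := by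
    simpa using (hasDerivAt_id v).const_mul γ
  have p (γ : ℝ) (hγ : -1 < γ * v) : HasDerivAt (fun v => P (γ * v)) (P1 (γ * v) * γ) v :=
    HasDerivAt.comp (h₂ := P) v (h.hasDerivAt _ hγ) (e γ)
  have p1 (γ : ℝ) (hγ : -1 < γ * v) : HasDerivAt (fun v => P1 (γ * v)) (P2 (γ * v) * γ) v :=
    HasDerivAt.comp (h₂ := P1) v (h.hasDerivAt' _ hγ) (e γ)
  have q (γ : ℝ) : HasDerivAt (fun v : ℝ => 1 - (γ * v) ^ 2) (-(2 * (γ * v) * γ)) v := by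
    simpa using ((e γ).fun_pow 2).const_sub 1
  have o1 := h.ode _ hα
  have o2 := h.ode _ hβ
  have hne : β - α ≠ 0 := sub_ne_zero.2 hαβ.symm
  refine (((((q α).const_mul β).mul (p1 α hα)).mul (p β hβ)).sub
    ((((q β).const_mul α).mul (p α hα)).mul (p1 β hβ))).div_const (β - α) |>.congr_deriv ?_
  simp only [Pi.mul_apply]
  rw [div_eq_iff hne]
  linear_combination (β * α * P (β * v)) * o1 - (α * β * P (α * v)) * o2

/-- This is how the sine, and with it the Carleman operator, enters the products KK* and K*K. -/
lemma concomitant_zero (h : IsLegendre ν P P1 P2) {α β : ℝ} (hαβ : α ≠ β) :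
    concomitant P P1 α β 0 = Real.sin (Real.pi * ν) / Real.pi := by
  have hne : β - α ≠ 0 := sub_ne_zero.2 hαβ.symm
  rw [← h.map_zero_mul, concomitant, div_eq_iff hne]
  simp; ring

/-- The value of the concomitant when the second argument is `1`. -/
lemma concomitant_right (h : IsLegendre ν P P1 P2) {α β v : ℝ} (hαβ : α ≠ β)
    (hβ : β * v = 1) : concomitant P P1 α β v = (α + β) * (v * P1 (α * v)) := by
  have hne : β - α ≠ 0 := sub_ne_zero.2 hαβ.symm
  rw [concomitant, div_eq_iff hne, hβ, h.map_one]
  linear_combination (-(β + α ^ 2 * v) * P1 (α * v)) * hβ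

lemma concomitant_left (h : IsLegendre ν P P1 P2) {α β v : ℝ} (hαβ : α ≠ β)
    (hα : α * v = 1) : concomitant P P1 α β v = (α + β) * (v * P1 (β * v)) := by
  have hne : β - α ≠ 0 := sub_ne_zero.2 hαβ.symm
  rw [concomitant, div_eq_iff hne, hα, h.map_one]
  linear_combination ((α + β ^ 2 * v) * P1 (β * v)) * hα

lemma intervalIntegral_mul (h : IsLegendre ν P P1 P2) {α β p q : ℝ} (hαβ : α ≠ β)
    (hα : 0 ≤ α) (hβ : 0 ≤ β) (hp : 0 ≤ p) (hpq : p ≤ q) :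
    (α + β) * ∫ x in p..q, P1 (α * x) * P1 (β * x)
      = concomitant P P1 α β q - concomitant P P1 α β p := by
  rw [← intervalIntegral.integral_const_mul]
  refine intervalIntegral.integral_eq_sub_of_hasDerivAt (fun x hx => ?_) ?_
  · rw [uIcc_of_le hpq] at hx
    have hx0 : 0 ≤ x := hp.trans hx.1
    exact h.hasDerivAt_concomitant hαβ (by nlinarith) (by nlinarith)
  · refine ContinuousOn.intervalIntegrable ?_
    rw [uIcc_of_le hpq]
    have hc (γ : ℝ) (hγ : 0 ≤ γ) : ContinuousOn (fun x => P1 (γ * x)) (Icc p q) :=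
      h.continuousOn_deriv.comp (by fun_prop) fun x hx => by
        have : 0 ≤ γ * x := mul_nonneg hγ (hp.trans hx.1)
        simp only [mem_Ioi]; linarith
    exact continuousOn_const.mul ((hc α hα).mul (hc β hβ))

/-- The same identity after the substitution v = 1/x. -/
lemma intervalIntegral_mul_inv (h : IsLegendre ν P P1 P2) {α β p q : ℝ} (hαβ : α ≠ β)
    (hα : 0 ≤ α) (hβ : 0 ≤ β) (hp : 0 < p) (hpq : p ≤ q) :
    (α + β) * ∫ x in p..q, P1 (α / x) * P1 (β / x) / x ^ 2
      = concomitant P P1 α β (1 / p) - concomitant P P1 α β (1 / q) := by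
  rw [← intervalIntegral.integral_const_mul]
  have hmain : ∫ x in p..q, (α + β) * (P1 (α / x) * P1 (β / x) / x ^ 2)
      = -concomitant P P1 α β (1 / q) - -concomitant P P1 α β (1 / p) := by
    refine intervalIntegral.integral_eq_sub_of_hasDerivAt
      (f := fun x => -concomitant P P1 α β (1 / x)) (fun x hx => ?_) ?_
    · rw [uIcc_of_le hpq] at hx
      have hx0 : 0 < x := hp.trans_le hx.1
      have e : HasDerivAt (fun x : ℝ => 1 / x) (-(1 / x ^ 2)) x := by
        simpa using hasDerivAt_inv hx0.ne'
      have h1 : 0 ≤ α * (1 / x) := by positivity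
      have h2 : 0 ≤ β * (1 / x) := by positivity
      refine ((h.hasDerivAt_concomitant hαβ (by linarith) (by linarith)).comp x e).neg.congr_deriv
        ?_
      rw [mul_one_div, mul_one_div]
      ring
    · refine ContinuousOn.intervalIntegrable ?_
      rw [uIcc_of_le hpq]
      have hx0 : ∀ x ∈ Icc p q, x ≠ 0 := fun x hx => (hp.trans_le hx.1).ne'
      have hc (γ : ℝ) (hγ : 0 ≤ γ) : ContinuousOn (fun x => P1 (γ / x)) (Icc p q) :=
        h.continuousOn_deriv.comp (continuousOn_const.div continuousOn_id hx0) fun x hx => by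
          have : 0 ≤ γ / x := div_nonneg hγ (hp.trans_le hx.1).le
          simp only [mem_Ioi]; linarith
      exact continuousOn_const.mul (((hc α hα).mul (hc β hβ)).div (by fun_prop)
        fun x hx => pow_ne_zero 2 (hx0 x hx))
  rw [hmain]; ring

/-- Composition of the kernels `P1 (t / x) / x` and `P1 (x / t) / t`. -/
lemma integral_kernel_comp (h : IsLegendre ν P P1 P2) {t x : ℝ} (ht : 0 < t) (htx : t < x) :
    ∫ y in t..x, P1 (y / x) / x * (P1 (y / t) / t) = P1 (x / t) / t - P1 (t / x) / x := by
  have hx : 0 < x := ht.trans htx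
  have hne : x⁻¹ ≠ t⁻¹ := fun e => htx.ne' (inv_injective e)
  have hm := h.intervalIntegral_mul hne (by positivity) (by positivity) ht.le htx.le
  rw [h.concomitant_left hne (inv_mul_cancel₀ hx.ne'),
    h.concomitant_right hne (inv_mul_cancel₀ ht.ne'), ← mul_sub] at hm
  have hs : x⁻¹ + t⁻¹ ≠ 0 := by positivity
  have hm' := mul_left_cancel₀ hs hm
  have e : ∀ y, P1 (y / x) / x * (P1 (y / t) / t) =
      1 / (x * t) * (P1 (x⁻¹ * y) * P1 (t⁻¹ * y)) := fun y => by
    rw [div_eq_inv_mul y, div_eq_inv_mul y]; field_simp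
  simp_rw [e]
  rw [intervalIntegral.integral_const_mul, hm', inv_mul_eq_div, inv_mul_eq_div]
  field_simp

/-- The product in the other order: the two Legendre kernels commute. -/
lemma integral_kernel_comp' (h : IsLegendre ν P P1 P2) {t x : ℝ} (ht : 0 < t) (htx : t < x) :
    ∫ y in t..x, P1 (x / y) / y * (P1 (t / y) / y) = P1 (x / t) / t - P1 (t / x) / x := by
  have hx : 0 < x := ht.trans htx
  have hm := h.intervalIntegral_mul_inv htx.ne' hx.le ht.le ht htx.le
  rw [h.concomitant_right htx.ne' (mul_one_div_cancel ht.ne'),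
    h.concomitant_left htx.ne' (mul_one_div_cancel hx.ne'), ← mul_sub] at hm
  have hm' := mul_left_cancel₀ (by positivity) hm
  have e : ∀ y, P1 (x / y) / y * (P1 (t / y) / y) = P1 (x / y) * P1 (t / y) / y ^ 2 := fun y => by
    rw [div_mul_div_comm, sq]
  simp_rw [e]
  rw [hm', mul_one_div, mul_one_div]
  ring

/-- The kernel of `K K*` for the kernel `P1 (t / x) / x` on `t < x`. -/
lemma integral_kernel_gram (h : IsLegendre ν P P1 P2) {s t : ℝ} (hs : 0 < s) (hst : s < t) :
    ∫ y in 0..s, P1 (y / s) / s * (P1 (y / t) / t)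
      = P1 (s / t) / t - Real.sin (Real.pi * ν) / Real.pi / (s + t) := by
  have ht : 0 < t := hs.trans hst
  have hne : s⁻¹ ≠ t⁻¹ := fun e => hst.ne (inv_injective e)
  have hm := h.intervalIntegral_mul hne (by positivity) (by positivity) le_rfl hs.le
  rw [h.concomitant_left hne (inv_mul_cancel₀ hs.ne'), h.concomitant_zero hne] at hm
  have e : ∀ y, P1 (y / s) / s * (P1 (y / t) / t) =
      1 / (s * t) * (P1 (s⁻¹ * y) * P1 (t⁻¹ * y)) := fun y => by
    rw [div_eq_inv_mul y, div_eq_inv_mul y]; field_simp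
  simp_rw [e]
  rw [intervalIntegral.integral_const_mul]
  have hs2 : s⁻¹ + t⁻¹ ≠ 0 := by positivity
  have hm' : ∫ x in 0..s, P1 (s⁻¹ * x) * P1 (t⁻¹ * x) =
      s * P1 (s / t) - Real.sin (Real.pi * ν) / Real.pi / (s⁻¹ + t⁻¹) := by
    refine mul_left_cancel₀ hs2 ?_
    rw [hm, inv_mul_eq_div, mul_sub, mul_div_cancel₀ _ hs2]
  rw [hm', mul_sub]
  field_simp
  ring

/-- The kernel of `K* K` for the kernel `P1 (t / x) / x` on `t < x`. -/
lemma integral_kernel_gram' (h : IsLegendre ν P P1 P2) {s t : ℝ} (hs : 0 < s) (hst : s < t)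
    (hint : IntegrableOn (fun y => P1 (s / y) / y * (P1 (t / y) / y)) (Ioi t)) :
    ∫ y in Ioi t, P1 (s / y) / y * (P1 (t / y) / y)
      = P1 (s / t) / t - Real.sin (Real.pi * ν) / Real.pi / (s + t) := by
  have ht : 0 < t := hs.trans hst
  have h1 := intervalIntegral_tendsto_integral_Ioi t hint tendsto_id
  -- The upper limit q → ∞ corresponds to v = 1/q → 0, where the concomitant has the value
  -- sin(πν)/π.
  have hc : Tendsto (fun q : ℝ => concomitant P P1 s t (1 / q)) atTop
      (𝓝 (Real.sin (Real.pi * ν) / Real.pi)) := by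
    rw [← h.concomitant_zero hst.ne]
    have := (h.hasDerivAt_concomitant (v := 0) hst.ne (by norm_num) (by norm_num)).continuousAt
    refine this.tendsto.comp ?_
    exact tendsto_const_nhds.div_atTop tendsto_id
  have h2 : Tendsto (fun q : ℝ => (concomitant P P1 s t (1 / t) - concomitant P P1 s t (1 / q))
      / (s + t)) atTop (𝓝 ((concomitant P P1 s t (1 / t) -
        Real.sin (Real.pi * ν) / Real.pi) / (s + t))) := (hc.const_sub _).div_const _
  have h3 := tendsto_nhds_unique_of_eventuallyEq h1 h2 (by
    filter_upwards [eventually_ge_atTop t] with q hq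
    have hm := h.intervalIntegral_mul_inv hst.ne hs.le ht.le ht hq
    have e : ∀ y, P1 (s / y) / y * (P1 (t / y) / y) = P1 (s / y) * P1 (t / y) / y ^ 2 :=
      fun y => by rw [div_mul_div_comm, sq]
    simp_rw [e]
    rw [eq_div_iff (by positivity), mul_comm]
    exact hm)
  rw [h3, h.concomitant_right hst.ne (mul_one_div_cancel ht.ne'), mul_one_div]
  field_simp

/-! ### Sign and growth of P and P' on (1, ∞). -/

/-- The Legendre equation in divergence form. As P > 0 on (1, ∞) and z² - 1 vanishes at 1, the sign
of P' there is that of ν(ν+1). -/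
lemma hasDerivAt_sq_sub_one_mul (h : IsLegendre ν P P1 P2) {z : ℝ} (hz : -1 < z) :
    HasDerivAt (fun z => (z ^ 2 - 1) * P1 z) (ν * (ν + 1) * P z) z := by
  have e : HasDerivAt (fun z : ℝ => z ^ 2 - 1) (2 * z) z := by
    simpa using (hasDerivAt_pow 2 z).sub_const 1
  refine (e.mul (h.hasDerivAt' z hz)).congr_deriv ?_
  linear_combination -h.ode z hz

lemma nonneg (h : IsLegendre ν P P1 P2) {z : ℝ} (hz : 1 ≤ z) : 0 ≤ P z := by
  rcases hz.eq_or_lt with rfl | hz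
  · rw [h.map_one]; exact zero_le_one
  · exact (h.pos z hz).le

lemma monotoneOn_of_hasDerivAt {f f' : ℝ → ℝ} (hf : ∀ z, 1 ≤ z → HasDerivAt f (f' z) z)
    (hf' : ∀ z, 1 < z → 0 ≤ f' z) : MonotoneOn f (Ici 1) :=
  monotoneOn_of_hasDerivWithinAt_nonneg (convex_Ici 1)
    (fun z hz => (hf z hz).continuousAt.continuousWithinAt)
    (fun z hz => (hf z (interior_subset hz)).hasDerivWithinAt)
    (fun z hz => hf' z (by simpa using hz))

lemma deriv_nonneg (h : IsLegendre ν P P1 P2) (hν : 0 ≤ ν * (ν + 1)) {z : ℝ} (hz : 1 < z) :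
    0 ≤ P1 z := by
  have hm := monotoneOn_of_hasDerivAt (fun z (hz : 1 ≤ z) =>
    h.hasDerivAt_sq_sub_one_mul (by linarith)) (fun z hz => mul_nonneg hν (h.nonneg hz.le))
  have := hm self_mem_Ici hz.le hz.le
  norm_num at this
  exact nonneg_of_mul_nonneg_right (by linarith) (by nlinarith : 0 < z ^ 2 - 1)

lemma deriv_nonpos (h : IsLegendre ν P P1 P2) (hν : ν * (ν + 1) ≤ 0) {z : ℝ} (hz : 1 < z) :
    P1 z ≤ 0 := by
  have hm := monotoneOn_of_hasDerivAt (fun z (hz : 1 ≤ z) =>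
    (h.hasDerivAt_sq_sub_one_mul (z := z) (by linarith)).neg)
    (fun z hz => by have := h.nonneg hz.le; nlinarith)
  have := hm self_mem_Ici hz.le hz.le
  norm_num at this
  exact nonpos_of_mul_nonpos_right this (by nlinarith : 0 < z ^ 2 - 1)

lemma one_le (h : IsLegendre ν P P1 P2) (hν : 0 ≤ ν * (ν + 1)) {z : ℝ} (hz : 1 ≤ z) :
    1 ≤ P z := by
  have hm := monotoneOn_of_hasDerivAt (fun z (hz : 1 ≤ z) => h.hasDerivAt z (by linarith))
    (fun z hz => h.deriv_nonneg hν hz)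
  simpa [h.map_one] using hm self_mem_Ici hz hz

lemma le_one (h : IsLegendre ν P P1 P2) (hν : ν * (ν + 1) ≤ 0) {z : ℝ} (hz : 1 ≤ z) :
    P z ≤ 1 := by
  have hm := monotoneOn_of_hasDerivAt (fun z (hz : 1 ≤ z) => (h.hasDerivAt z (by linarith)).neg)
    (fun z hz => by linarith [h.deriv_nonpos hν hz])
  have := hm self_mem_Ici hz hz
  simp only [Pi.neg_apply, h.map_one] at this
  linarith

/-- `P1` has constant sign on `(1, ∞)`. -/
lemma deriv_const_sign (h : IsLegendre ν P P1 P2) :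
    (∀ z, 1 < z → 0 ≤ P1 z) ∨ ∀ z, 1 < z → P1 z ≤ 0 :=
  (le_total 0 (ν * (ν + 1))).imp (fun hν _ hz => h.deriv_nonneg hν hz)
    fun hν _ hz => h.deriv_nonpos hν hz

/-- Here P ≤ 1, so integration of the divergence form from 1 gives (z²-1)|P'| ≤ -ν(ν+1)(z-1). The
decay 1/z makes L* converge on all of L₂. -/
lemma abs_deriv_le (h : IsLegendre ν P P1 P2) (hν : ν * (ν + 1) ≤ 0) {z : ℝ} (hz : 1 < z) :
    |P1 z| ≤ -(ν * (ν + 1)) / z := by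
  have hm := monotoneOn_of_hasDerivAt (fun z (hz : 1 ≤ z) =>
    (h.hasDerivAt_sq_sub_one_mul (z := z) (by linarith)).sub
      ((hasDerivAt_id z).const_mul (ν * (ν + 1))))
    (fun z hz => by have := h.le_one hν hz.le; nlinarith)
  have := hm self_mem_Ici hz.le hz.le
  simp only [Pi.sub_apply, id] at this
  rw [abs_of_nonpos (h.deriv_nonpos hν hz), le_div_iff₀ (by linarith)]
  have h1 : 0 ≤ (z - 1) * ((z + 1) * P1 z - ν * (ν + 1)) := by nlinarith
  have h2 := nonneg_of_mul_nonneg_right h1 (by linarith : 0 < z - 1)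
  nlinarith [h.deriv_nonpos hν hz]

/-- For ν(ν+1) > 0 the function P grows at least like a power, so P is bounded by a multiple of zP'.
This bounds the majorant of the composed kernels by the kernel of L itself. -/
lemma exists_abs_sub_one_le (h : IsLegendre ν P P1 P2) (hν : 0 ≤ ν * (ν + 1)) :
    ∃ C : ℝ, 0 ≤ C ∧ ∀ z, 1 < z → |P z - 1| ≤ C * (z * |P1 z|) := by
  rcases hν.eq_or_lt with h0 | hpos
  · refine ⟨0, le_rfl, fun z hz => ?_⟩
    have := le_antisymm (h.le_one h0.ge hz.le) (h.one_le h0.le hz.le)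
    simp [this]
  · obtain ⟨κ, hκ0, hκ⟩ : ∃ κ : ℝ, 0 < κ ∧ κ + κ ^ 2 ≤ ν * (ν + 1) := by
      -- As κ ≤ 1, κ + κ² ≤ 2κ ≤ ν(ν+1).
      refine ⟨min 1 (ν * (ν + 1) / 2), lt_min one_pos (by linarith), ?_⟩
      have h1 := min_le_left 1 (ν * (ν + 1) / 2)
      have h2 := min_le_right 1 (ν * (ν + 1) / 2)
      have h3 : 0 ≤ min 1 (ν * (ν + 1) / 2) := le_min zero_le_one (by linarith)
      nlinarith
    -- The aim is (z+1)P' ≥ κP. Multiplied by z - 1, the difference vanishes at 1, and the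
    -- integrating factor (z+1)^κ cancels all terms in P' of its derivative; what is left is P times
    -- a nonnegative factor.
    have hm := monotoneOn_of_hasDerivAt
      (f := fun z => (z + 1) ^ κ * ((z ^ 2 - 1) * P1 z - κ * ((z - 1) * P z)))
      (f' := fun z => (z + 1) ^ κ * (κ / (z + 1)) * ((z ^ 2 - 1) * P1 z - κ * ((z - 1) * P z))
        + (z + 1) ^ κ * (ν * (ν + 1) * P z - κ * (P z + (z - 1) * P1 z))) (fun z hz => by
        have e1 : HasDerivAt (fun z : ℝ => (z + 1) ^ κ) ((z + 1) ^ κ * (κ / (z + 1))) z := by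
          refine (((hasDerivAt_id z).add_const 1).rpow_const (p := κ)
            (Or.inl (by simp only [id]; linarith))).congr_deriv ?_
          simp only [id]
          rw [Real.rpow_sub_one (by linarith)]
          field_simp
        have e2 := (((hasDerivAt_id z).sub_const 1).mul (h.hasDerivAt z (by linarith))).const_mul κ
        refine (e1.mul ((h.hasDerivAt_sq_sub_one_mul (z := z) (by linarith)).sub e2)).congr_deriv
          ?_
        simp)
      (fun z hz => by
        have hp := h.nonneg hz.le
        have hz1 : 0 < z + 1 := by linarith
        rw [mul_assoc, ← mul_add]
        refine mul_nonneg (Real.rpow_nonneg hz1.le _) ?_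
        have e : κ / (z + 1) * ((z ^ 2 - 1) * P1 z - κ * ((z - 1) * P z))
            + (ν * (ν + 1) * P z - κ * (P z + (z - 1) * P1 z))
            = P z * ((ν * (ν + 1) - (κ + κ ^ 2)) + κ ^ 2 * (2 / (z + 1))) := by
          field_simp; ring
        rw [e]
        exact mul_nonneg hp (add_nonneg (by linarith) (by positivity)))
    refine ⟨2 / κ, by positivity, fun z hz => ?_⟩
    have h1 := hm self_mem_Ici hz.le hz.le
    norm_num at h1
    have h2 := nonneg_of_mul_nonneg_right h1 (Real.rpow_pos_of_pos (by linarith : 0 < z + 1) κ)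
    have h3 : 0 ≤ (z - 1) * ((z + 1) * P1 z - κ * P z) := by linarith
    have h4 := nonneg_of_mul_nonneg_right h3 (by linarith : 0 < z - 1)
    have h5 := h.deriv_nonneg hν hz
    have h6 := h.one_le hν hz.le
    rw [abs_of_nonneg (by linarith), abs_of_nonneg h5, div_mul_eq_mul_div, le_div_iff₀ hκ0]
    nlinarith

end IsLegendre

/-! ### Schur's test for kernels dominated by 1/(x+y). -/

lemma ae_halfLine_pos : ∀ᵐ x ∂halfLine, 0 < x := ae_restrict_mem measurableSet_Ioi

lemma ae_halfLine_prod_pos : ∀ᵐ p ∂(halfLine.prod halfLine), 0 < p.1 ∧ 0 < p.2 := by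
  rw [Measure.prod_restrict]
  filter_upwards [ae_restrict_mem (measurableSet_Ioi.prod measurableSet_Ioi)] with p hp using hp

/-- The weight in Schur's test for the kernel `1 / (x + y)`. -/
def schurWeight (x y : ℝ) : ℝ := √x / (√y * (x + y))

lemma measurable_schurWeight : Measurable fun p : ℝ × ℝ => schurWeight p.1 p.2 := by
  unfold schurWeight; fun_prop

lemma schurWeight_nonneg {x y : ℝ} (hx : 0 < x) (hy : 0 < y) : 0 ≤ schurWeight x y := by
  unfold schurWeight; positivity

lemma schurWeight_mul_swap {x y : ℝ} (hx : 0 < x) (hy : 0 < y) :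
    schurWeight x y * schurWeight y x = 1 / (x + y) ^ 2 := by
  unfold schurWeight
  have h1 := Real.sqrt_pos.2 hx
  have h2 := Real.sqrt_pos.2 hy
  field_simp
  rw [add_comm y x]

/-- The arctangent shows that the weight has total mass π for every x; this is the constant in
Hilbert's inequality. -/
lemma hasDerivAt_arctan_sqrt {x y : ℝ} (hx : 0 < x) (hy : 0 < y) :
    HasDerivAt (fun y => 2 * Real.arctan (√y / √x)) (schurWeight x y) y := by
  have h1 := Real.sqrt_pos.2 hx
  have h2 := Real.sqrt_pos.2 hy
  refine (((Real.hasDerivAt_sqrt hy.ne').div_const (√x)).arctan.const_mul 2).congr_deriv ?_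
  unfold schurWeight
  have e : x + y = √x ^ 2 + √y ^ 2 := by rw [Real.sq_sqrt hx.le, Real.sq_sqrt hy.le]
  rw [e]
  field_simp

lemma continuous_arctan_sqrt (x : ℝ) : Continuous fun y => 2 * Real.arctan (√y / √x) := by
  have := Real.continuous_arctan
  fun_prop

lemma tendsto_arctan_sqrt {x : ℝ} (hx : 0 < x) :
    Tendsto (fun y => 2 * Real.arctan (√y / √x)) atTop (𝓝 Real.pi) := by
  have h1 : Tendsto (fun y => √y / √x) atTop atTop :=
    Real.tendsto_sqrt_atTop.atTop_div_const (Real.sqrt_pos.2 hx)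
  have h2 := ((Real.tendsto_arctan_atTop.mono_right nhdsWithin_le_nhds).comp h1).const_mul 2
  rwa [mul_div_cancel₀ _ (two_ne_zero)] at h2

lemma integrable_schurWeight {x : ℝ} (hx : 0 < x) :
    Integrable (fun y => schurWeight x y) halfLine :=
  integrableOn_Ioi_deriv_of_nonneg (continuous_arctan_sqrt x).continuousWithinAt
    (fun _ hy => hasDerivAt_arctan_sqrt hx hy) (fun _ hy => schurWeight_nonneg hx hy)
    (tendsto_arctan_sqrt hx)

lemma integral_schurWeight {x : ℝ} (hx : 0 < x) : ∫ y, schurWeight x y ∂halfLine = Real.pi := by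
  have := integral_Ioi_of_hasDerivAt_of_nonneg (continuous_arctan_sqrt x).continuousWithinAt
    (fun _ hy => hasDerivAt_arctan_sqrt hx hy) (fun _ hy => schurWeight_nonneg hx hy)
    (tendsto_arctan_sqrt hx)
  simpa using this

lemma integrable_schurWeight_mul_sq {f : ℝ → ℂ} (hf : MemLp f 2 halfLine) {x : ℝ} (hx : 0 < x) :
    Integrable (fun y => schurWeight y x * ‖f y‖ ^ 2) halfLine := by
  have hsq := (memLp_two_iff_integrable_sq_norm hf.1).1 hf
  refine hsq.bdd_mul (c := 1 / x) ?_ ?_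
  · exact (measurable_schurWeight.comp measurable_prodMk_right).aestronglyMeasurable
  · filter_upwards [ae_halfLine_pos] with y hy
    rw [Real.norm_of_nonneg (schurWeight_nonneg hy hx), schurWeight,
      div_le_div_iff₀ (by positivity) hx]
    have h1 := Real.sqrt_pos.2 hx
    have h2 := Real.sqrt_pos.2 hy
    have e1 : x = √x ^ 2 := (Real.sq_sqrt hx.le).symm
    have e2 : y = √y ^ 2 := (Real.sq_sqrt hy.le).symm
    have : √y * √x ≤ y + x := by rw [e1, e2]; simp; nlinarith [sq_nonneg (√x - √y)]
    calc √y * x = √x * (√y * √x) := by nth_rw 1 [e1]; ring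
      _ ≤ √x * (y + x) := by gcongr
      _ = 1 * (√x * (y + x)) := by ring

lemma integrable_schurWeight_prod {f : ℝ → ℂ} (hf : MemLp f 2 halfLine) :
    Integrable (fun p : ℝ × ℝ => schurWeight p.1 p.2 * ‖f p.1‖ ^ 2) (halfLine.prod halfLine) := by
  have hsq := (memLp_two_iff_integrable_sq_norm hf.1).1 hf
  have hm : AEStronglyMeasurable (fun p : ℝ × ℝ => schurWeight p.1 p.2 * ‖f p.1‖ ^ 2)
      (halfLine.prod halfLine) :=
    measurable_schurWeight.aestronglyMeasurable.mul (hf.1.comp_fst.norm.pow 2)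
  refine (integrable_prod_iff hm).2 ⟨?_, ?_⟩
  · filter_upwards [ae_halfLine_pos] with x hx
    exact (integrable_schurWeight hx).mul_const _
  · refine (hsq.const_mul Real.pi).congr ?_
    filter_upwards [ae_halfLine_pos] with x hx
    rw [← integral_schurWeight hx, ← integral_mul_const]
    refine integral_congr_ae ?_
    filter_upwards [ae_halfLine_pos] with y hy
    rw [Real.norm_of_nonneg (mul_nonneg (schurWeight_nonneg hx hy) (sq_nonneg _))]

lemma integral_schurWeight_prod {f : ℝ → ℂ} (hf : MemLp f 2 halfLine) :
    ∫ p : ℝ × ℝ, schurWeight p.1 p.2 * ‖f p.1‖ ^ 2 ∂(halfLine.prod halfLine)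
      = Real.pi * ∫ x, ‖f x‖ ^ 2 ∂halfLine := by
  rw [integral_prod _ (integrable_schurWeight_prod hf), ← integral_const_mul]
  refine integral_congr_ae ?_
  filter_upwards [ae_halfLine_pos] with x hx
  simp only [integral_mul_const, integral_schurWeight hx]

lemma integrable_schurWeight_prod_swap {f : ℝ → ℂ} (hf : MemLp f 2 halfLine) :
    Integrable (fun p : ℝ × ℝ => schurWeight p.2 p.1 * ‖f p.2‖ ^ 2) (halfLine.prod halfLine) :=
  (integrable_schurWeight_prod hf).swap

/-- The arithmetic-geometric mean estimate behind Schur's test. -/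
lemma mul_div_add_le {x y a b : ℝ} (hx : 0 < x) (hy : 0 < y) :
    a * b / (x + y) ≤ (schurWeight x y * a ^ 2 + schurWeight y x * b ^ 2) / 2 := by
  have h1 := schurWeight_nonneg hx hy
  have h2 := schurWeight_nonneg hy hx
  have e : √(schurWeight x y) * √(schurWeight y x) = 1 / (x + y) := by
    rw [← Real.sqrt_mul h1, schurWeight_mul_swap hx hy, Real.sqrt_div zero_le_one, Real.sqrt_one,
      Real.sqrt_sq (by positivity)]
  have e1 := Real.sq_sqrt h1
  have e2 := Real.sq_sqrt h2
  have h3 := sq_nonneg (√(schurWeight x y) * a - √(schurWeight y x) * b)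
  have h4 : a * b / (x + y) = √(schurWeight x y) * √(schurWeight y x) * (a * b) := by
    rw [e]; ring
  rw [h4]
  nlinarith

lemma integrable_mul_div_add {f g : ℝ → ℂ} (hf : MemLp f 2 halfLine) (hg : MemLp g 2 halfLine) :
    Integrable (fun p : ℝ × ℝ => ‖f p.1‖ * ‖g p.2‖ / (p.1 + p.2)) (halfLine.prod halfLine) := by
  refine (((integrable_schurWeight_prod hf).add
    (integrable_schurWeight_prod_swap hg)).div_const 2).mono' ?_ ?_
  · exact ((hf.1.comp_fst.norm.mul hg.1.comp_snd.norm).aemeasurable.div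
      (by fun_prop)).aestronglyMeasurable
  · filter_upwards [ae_halfLine_prod_pos] with p hp
    rw [Real.norm_of_nonneg (div_nonneg (by positivity) (by linarith [hp.1, hp.2]))]
    exact mul_div_add_le hp.1 hp.2

/-- The kernel `k` on `(0, ∞)` is measurable and dominated by `M / (x + y)`. -/
structure IsCarleman (k : ℝ → ℝ → ℝ) (M : ℝ) : Prop where
  measurable : Measurable fun p : ℝ × ℝ => k p.1 p.2
  bound : ∀ x y, 0 < x → 0 < y → |k x y| ≤ M / (x + y)

/-- The integral operator with kernel `k` on `(0, ∞)`. -/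
def kernelInt (k : ℝ → ℝ → ℝ) (f : ℝ → ℂ) (x : ℝ) : ℂ := ∫ y, (k x y : ℂ) * f y ∂halfLine

lemma kernelInt_congr (k : ℝ → ℝ → ℝ) {f g : ℝ → ℂ} (h : f =ᵐ[halfLine] g) :
    kernelInt k f = kernelInt k g := by
  funext x
  refine integral_congr_ae ?_
  filter_upwards [h] with y hy
  rw [hy]

namespace IsCarleman

variable {k l : ℝ → ℝ → ℝ} {M N : ℝ}

lemma nonneg (hk : IsCarleman k M) : 0 ≤ M := by
  have := (abs_nonneg _).trans (hk.bound 1 1 one_pos one_pos)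
  linarith

lemma swap (hk : IsCarleman k M) : IsCarleman (fun x y => k y x) M :=
  ⟨hk.measurable.comp measurable_swap, fun x y hx hy => by
    rw [add_comm]; exact hk.bound y x hy hx⟩

lemma measurable_right (hk : IsCarleman k M) (x : ℝ) : Measurable fun y => k x y :=
  hk.measurable.comp measurable_prodMk_left

lemma aestronglyMeasurable_mul (hk : IsCarleman k M) {f : ℝ → ℂ}
    (hf : AEStronglyMeasurable f halfLine) (x : ℝ) :
    AEStronglyMeasurable (fun y => (k x y : ℂ) * f y) halfLine :=
  (Complex.measurable_ofReal.comp (hk.measurable_right x)).aestronglyMeasurable.mul hf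

lemma norm_mul_le (hk : IsCarleman k M) {x y : ℝ} (hx : 0 < x) (hy : 0 < y) (z : ℂ) :
    ‖(k x y : ℂ) * z‖ ≤ M * (‖z‖ / (x + y)) := by
  rw [norm_mul, Complex.norm_real, Real.norm_eq_abs]
  calc |k x y| * ‖z‖ ≤ M / (x + y) * ‖z‖ := by gcongr; exact hk.bound x y hx hy
    _ = _ := by ring

lemma _root_.integrable_norm_div_add {f : ℝ → ℂ} (hf : MemLp f 2 halfLine) {x : ℝ} (hx : 0 < x) :
    Integrable (fun y => ‖f y‖ / (x + y)) halfLine := by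
  refine (((integrable_schurWeight hx).add
    (integrable_schurWeight_mul_sq hf hx)).div_const 2).mono' ?_ ?_
  · exact (hf.1.norm.aemeasurable.div (by fun_prop)).aestronglyMeasurable
  · filter_upwards [ae_halfLine_pos] with y hy
    rw [Real.norm_of_nonneg (by positivity)]
    simpa using mul_div_add_le (a := 1) (b := ‖f y‖) hx hy

lemma integrable_mul (hk : IsCarleman k M) {f : ℝ → ℂ} (hf : MemLp f 2 halfLine) {x : ℝ}
    (hx : 0 < x) : Integrable (fun y => (k x y : ℂ) * f y) halfLine := by
  refine ((integrable_norm_div_add hf hx).const_mul M).mono'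
    (hk.aestronglyMeasurable_mul hf.1 x) ?_
  filter_upwards [ae_halfLine_pos] with y hy using hk.norm_mul_le hx hy _

lemma _root_.sq_integral_norm_div_add_le {f : ℝ → ℂ} (hf : MemLp f 2 halfLine) {x : ℝ}
    (hx : 0 < x) :
    (∫ y, ‖f y‖ / (x + y) ∂halfLine) ^ 2
      ≤ Real.pi * ∫ y, schurWeight y x * ‖f y‖ ^ 2 ∂halfLine := by
  set I := ∫ y, ‖f y‖ / (x + y) ∂halfLine
  set B := ∫ y, schurWeight y x * ‖f y‖ ^ 2 ∂halfLine
  have hI : 0 ≤ I := integral_nonneg_of_ae (by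
    filter_upwards [ae_halfLine_pos] with y hy
    simp only [Pi.zero_apply]; positivity)
  have hB : 0 ≤ B := integral_nonneg_of_ae (by
    filter_upwards [ae_halfLine_pos] with y hy
    exact mul_nonneg (schurWeight_nonneg hy hx) (sq_nonneg _))
  have key : ∀ ε : ℝ, ε * I ≤ (ε ^ 2 * Real.pi + B) / 2 := by
    intro ε
    have h1 : ε * I = ∫ y, ε * ‖f y‖ / (x + y) ∂halfLine := by
      rw [← integral_const_mul]; simp only [mul_div_assoc]
    have h2 : (ε ^ 2 * Real.pi + B) / 2 = ∫ y, (schurWeight x y * ε ^ 2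
        + schurWeight y x * ‖f y‖ ^ 2) / 2 ∂halfLine := by
      rw [integral_div, integral_add ((integrable_schurWeight hx).mul_const _)
        (integrable_schurWeight_mul_sq hf hx), integral_mul_const, integral_schurWeight hx,
        mul_comm (ε ^ 2)]
    rw [h1, h2]
    refine integral_mono_ae ?_ ?_ ?_
    · simpa only [mul_div_assoc] using (integrable_norm_div_add hf hx).const_mul ε
    · exact (((integrable_schurWeight hx).mul_const _).add
        (integrable_schurWeight_mul_sq hf hx)).div_const 2
    · filter_upwards [ae_halfLine_pos] with y hy using mul_div_add_le hx hy
  have hpi := Real.pi_pos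
  -- The ε that makes εI - ε²π/2 largest; the maximum is I²/(2π).
  have := key (I / Real.pi)
  field_simp at this
  nlinarith

lemma norm_kernelInt_le (hk : IsCarleman k M) {f : ℝ → ℂ} (hf : MemLp f 2 halfLine) {x : ℝ}
    (hx : 0 < x) : ‖kernelInt k f x‖ ≤ M * ∫ y, ‖f y‖ / (x + y) ∂halfLine := by
  rw [← integral_const_mul]
  refine norm_integral_le_of_norm_le ((integrable_norm_div_add hf hx).const_mul M) ?_
  filter_upwards [ae_halfLine_pos] with y hy using hk.norm_mul_le hx hy _

lemma sq_norm_kernelInt_le (hk : IsCarleman k M) {f : ℝ → ℂ} (hf : MemLp f 2 halfLine) {x : ℝ}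
    (hx : 0 < x) :
    ‖kernelInt k f x‖ ^ 2 ≤ M ^ 2 * (Real.pi * ∫ y, schurWeight y x * ‖f y‖ ^ 2 ∂halfLine) := by
  calc ‖kernelInt k f x‖ ^ 2 ≤ (M * ∫ y, ‖f y‖ / (x + y) ∂halfLine) ^ 2 := by
        gcongr; exact hk.norm_kernelInt_le hf hx
    _ = M ^ 2 * (∫ y, ‖f y‖ / (x + y) ∂halfLine) ^ 2 := by ring
    _ ≤ _ := by gcongr; exact sq_integral_norm_div_add_le hf hx

lemma aestronglyMeasurable_kernelInt (hk : IsCarleman k M) {f : ℝ → ℂ}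
    (hf : AEStronglyMeasurable f halfLine) : AEStronglyMeasurable (kernelInt k f) halfLine :=
  AEStronglyMeasurable.integral_prod_right' (f := fun p : ℝ × ℝ => (k p.1 p.2 : ℂ) * f p.2)
    ((Complex.measurable_ofReal.comp hk.measurable).aestronglyMeasurable.mul hf.comp_snd)

lemma integrable_sq_kernelInt (hk : IsCarleman k M) {f : ℝ → ℂ} (hf : MemLp f 2 halfLine) :
    Integrable (fun x => ‖kernelInt k f x‖ ^ 2) halfLine := by
  have h := ((integrable_schurWeight_prod_swap hf).integral_prod_left.const_mul
    Real.pi).const_mul (M ^ 2)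
  refine h.mono' ((hk.aestronglyMeasurable_kernelInt hf.1).norm.pow 2) ?_
  filter_upwards [ae_halfLine_pos] with x hx
  rw [Real.norm_of_nonneg (sq_nonneg _)]
  exact hk.sq_norm_kernelInt_le hf hx

lemma memLp_kernelInt (hk : IsCarleman k M) {f : ℝ → ℂ} (hf : MemLp f 2 halfLine) :
    MemLp (kernelInt k f) 2 halfLine :=
  (memLp_two_iff_integrable_sq_norm (hk.aestronglyMeasurable_kernelInt hf.1)).2
    (hk.integrable_sq_kernelInt hf)

lemma integral_sq_kernelInt_le (hk : IsCarleman k M) {f : ℝ → ℂ} (hf : MemLp f 2 halfLine) :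
    ∫ x, ‖kernelInt k f x‖ ^ 2 ∂halfLine ≤ (M * Real.pi) ^ 2 * ∫ x, ‖f x‖ ^ 2 ∂halfLine := by
  have h := ((integrable_schurWeight_prod_swap hf).integral_prod_left.const_mul
    Real.pi).const_mul (M ^ 2)
  calc _ ≤ ∫ x, M ^ 2 * (Real.pi * ∫ y, schurWeight y x * ‖f y‖ ^ 2 ∂halfLine) ∂halfLine := by
        refine integral_mono_ae (hk.integrable_sq_kernelInt hf) h ?_
        filter_upwards [ae_halfLine_pos] with x hx using hk.sq_norm_kernelInt_le hf hx
    _ = _ := by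
        rw [integral_const_mul, integral_const_mul,
          ← integral_prod (fun p : ℝ × ℝ => schurWeight p.2 p.1 * ‖f p.2‖ ^ 2)
            (integrable_schurWeight_prod_swap hf)]
        have := integral_prod_swap (μ := halfLine) (ν := halfLine)
          (fun p : ℝ × ℝ => schurWeight p.1 p.2 * ‖f p.1‖ ^ 2)
        simp only [Prod.fst_swap, Prod.snd_swap] at this
        rw [this, integral_schurWeight_prod hf]
        ring

end IsCarleman

/-! ### Bounded integral operators: adjoints and products. -/

lemma norm_sq_eq_integral (f : HalfLineL2) : ‖f‖ ^ 2 = ∫ x, ‖f x‖ ^ 2 ∂halfLine := by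
  have h := @inner_self_eq_norm_sq ℂ HalfLineL2 _ _ _ f
  rw [← h, L2.inner_def, ← integral_re (L2.integrable_inner f f)]
  refine integral_congr_ae (Eventually.of_forall fun x => ?_)
  exact inner_self_eq_norm_sq (𝕜 := ℂ) (f x)

/-- The bounded operator on `L₂(0, ∞)` with kernel `k`. -/
def kernelOp {k : ℝ → ℝ → ℝ} {M : ℝ} (hk : IsCarleman k M) : HalfLineL2 →L[ℂ] HalfLineL2 :=
  LinearMap.mkContinuous
    { toFun := fun f => (hk.memLp_kernelInt (Lp.memLp f)).toLp _
      map_add' := fun f g => by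
        rw [← MemLp.toLp_add]
        refine MemLp.toLp_congr _ _ ?_
        filter_upwards [ae_halfLine_pos] with x hx
        rw [kernelInt_congr k (Lp.coeFn_add f g), Pi.add_apply, kernelInt, kernelInt, kernelInt,
          ← integral_add (hk.integrable_mul (Lp.memLp f) hx) (hk.integrable_mul (Lp.memLp g) hx)]
        simp only [Pi.add_apply, mul_add]
      map_smul' := fun c f => by
        rw [RingHom.id_apply, ← MemLp.toLp_const_smul]
        refine MemLp.toLp_congr _ _ ?_
        filter_upwards [ae_halfLine_pos] with x hx
        rw [kernelInt_congr k (Lp.coeFn_smul c f), Pi.smul_apply, kernelInt, kernelInt,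
          ← integral_smul]
        simp only [Pi.smul_apply, smul_eq_mul, mul_left_comm] }
    (M * Real.pi) fun f => by
      have hM := mul_nonneg hk.nonneg Real.pi_pos.le
      refine abs_le_of_sq_le_sq' ?_ (by positivity) |>.2
      rw [mul_pow, norm_sq_eq_integral, norm_sq_eq_integral]
      refine le_trans (le_of_eq ?_) (hk.integral_sq_kernelInt_le (Lp.memLp f))
      refine integral_congr_ae ?_
      filter_upwards [(hk.memLp_kernelInt (Lp.memLp f)).coeFn_toLp] with x hx
      simp only [LinearMap.coe_mk, AddHom.coe_mk]
      rw [hx]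

lemma coeFn_kernelOp {k : ℝ → ℝ → ℝ} {M : ℝ} (hk : IsCarleman k M) (f : HalfLineL2) :
    kernelOp hk f =ᵐ[halfLine] kernelInt k f :=
  (hk.memLp_kernelInt (Lp.memLp f)).coeFn_toLp

lemma IsCarleman.integrable_form {k : ℝ → ℝ → ℝ} {M : ℝ} (hk : IsCarleman k M) {f g : ℝ → ℂ}
    (hf : MemLp f 2 halfLine) (hg : MemLp g 2 halfLine) :
    Integrable (fun p : ℝ × ℝ => starRingEnd ℂ (g p.1) * ((k p.1 p.2 : ℂ) * f p.2))
      (halfLine.prod halfLine) := by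
  refine ((integrable_mul_div_add hg hf).const_mul M).mono' ?_ ?_
  · exact (Complex.continuous_conj.comp_aestronglyMeasurable hg.1.comp_fst).mul
      ((Complex.measurable_ofReal.comp hk.measurable).aestronglyMeasurable.mul hf.1.comp_snd)
  · filter_upwards [ae_halfLine_prod_pos] with p hp
    rw [norm_mul, RCLike.norm_conj]
    calc ‖g p.1‖ * ‖(k p.1 p.2 : ℂ) * f p.2‖ ≤ ‖g p.1‖ * (M * (‖f p.2‖ / (p.1 + p.2))) := by
          gcongr; exact hk.norm_mul_le hp.1 hp.2 _
      _ = _ := by ring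

lemma inner_kernelOp {k : ℝ → ℝ → ℝ} {M : ℝ} (hk : IsCarleman k M) (f g : HalfLineL2) :
    inner ℂ g (kernelOp hk f) = ∫ p : ℝ × ℝ, starRingEnd ℂ (g p.1) * ((k p.1 p.2 : ℂ) * f p.2)
      ∂(halfLine.prod halfLine) := by
  rw [integral_prod _ (hk.integrable_form (Lp.memLp f) (Lp.memLp g)), L2.inner_def]
  refine integral_congr_ae ?_
  filter_upwards [coeFn_kernelOp hk f] with x hx
  rw [hx, integral_const_mul, RCLike.inner_apply']
  rfl

lemma adjoint_kernelOp {k : ℝ → ℝ → ℝ} {M : ℝ} (hk : IsCarleman k M) :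
    ContinuousLinearMap.adjoint (kernelOp hk) = kernelOp hk.swap := by
  refine ((ContinuousLinearMap.eq_adjoint_iff _ _).2 fun f g => ?_).symm
  rw [← inner_conj_symm, inner_kernelOp, inner_kernelOp, ← integral_conj]
  have := integral_prod_swap (μ := halfLine) (ν := halfLine)
    (fun p : ℝ × ℝ => starRingEnd ℂ (f p.1) * ((k p.1 p.2 : ℂ) * g p.2))
  rw [← this]
  refine integral_congr_ae (Eventually.of_forall fun p => ?_)
  simp only [map_mul, Complex.conj_conj, Complex.conj_ofReal, Prod.fst_swap, Prod.snd_swap]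
  ring

/-- Composition of two integral operators is the integral operator with the composed kernel. -/
lemma kernelInt_kernelInt {k l : ℝ → ℝ → ℝ} {M N : ℝ} (hk : IsCarleman k M) (hl : IsCarleman l N)
    {f : ℝ → ℂ} (hf : MemLp f 2 halfLine) {x : ℝ} (hx : 0 < x) :
    kernelInt k (kernelInt l f) x
      = kernelInt (fun x z => ∫ y, k x y * l y z ∂halfLine) f x := by
  -- The double integral is dominated by the Carleman kernel applied twice to |f|. This is finite at
  -- every x > 0, because the first application stays in L₂.
  have hcar : IsCarleman (fun x y : ℝ => 1 / (x + y)) 1 :=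
    ⟨by fun_prop, fun x y hx hy => (abs_of_nonneg (by positivity)).le⟩
  have hfn : MemLp (fun y => (‖f y‖ : ℂ)) 2 halfLine := hf.norm.ofReal
  have hC := hcar.integrable_mul (hcar.memLp_kernelInt hfn) hx
  have hint : Integrable (Function.uncurry fun y z => (k x y : ℂ) * ((l y z : ℂ) * f z))
      (halfLine.prod halfLine) := by
    have hm : AEStronglyMeasurable
        (Function.uncurry fun y z => (k x y : ℂ) * ((l y z : ℂ) * f z))
        (halfLine.prod halfLine) :=
      ((Complex.measurable_ofReal.comp
        (hk.measurable_right x)).aestronglyMeasurable.comp_fst).mul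
        ((Complex.measurable_ofReal.comp hl.measurable).aestronglyMeasurable.mul hf.1.comp_snd)
    refine (integrable_prod_iff hm).2 ⟨?_, ?_⟩
    · filter_upwards [ae_halfLine_pos] with y hy
      simpa only [Function.uncurry_apply_pair] using
        (hl.integrable_mul hf hy).const_mul (k x y : ℂ)
    · refine (hC.norm.const_mul (M * N)).mono' hm.norm.integral_prod_right' ?_
      filter_upwards [ae_halfLine_pos] with y hy
      rw [Real.norm_of_nonneg (integral_nonneg fun _ => norm_nonneg _)]
      have e1 : kernelInt (fun x y : ℝ => 1 / (x + y)) (fun y => (‖f y‖ : ℂ)) y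
          = ((∫ z, ‖f z‖ / (y + z) ∂halfLine : ℝ) : ℂ) := by
        rw [kernelInt, ← integral_complex_ofReal]
        refine integral_congr_ae (Eventually.of_forall fun z => ?_)
        simp only []
        push_cast; ring
      have hnn : 0 ≤ ∫ z, ‖f z‖ / (y + z) ∂halfLine := integral_nonneg_of_ae (by
        filter_upwards [ae_halfLine_pos] with z hz
        simp only [Pi.zero_apply]; positivity)
      rw [e1, norm_mul, Complex.norm_real, Complex.norm_real, Real.norm_of_nonneg hnn,
        Real.norm_of_nonneg (by positivity)]
      simp only [Function.uncurry_apply_pair, norm_mul (k x y : ℂ), integral_const_mul]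
      have h1 : ∫ z, ‖(l y z : ℂ) * f z‖ ∂halfLine ≤ N * ∫ z, ‖f z‖ / (y + z) ∂halfLine := by
        rw [← integral_const_mul]
        refine integral_mono_ae (hl.integrable_mul hf hy).norm
          ((integrable_norm_div_add hf hy).const_mul N) ?_
        filter_upwards [ae_halfLine_pos] with z hz using hl.norm_mul_le hy hz _
      calc ‖(k x y : ℂ)‖ * ∫ z, ‖(l y z : ℂ) * f z‖ ∂halfLine
          ≤ M / (x + y) * (N * ∫ z, ‖f z‖ / (y + z) ∂halfLine) := by
            refine mul_le_mul ?_ h1 (integral_nonneg fun _ => norm_nonneg _)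
              (div_nonneg hk.nonneg (by positivity))
            rw [Complex.norm_real]; exact hk.bound x y hx hy
        _ = _ := by ring
  have hswap := integral_integral_swap hint
  simp only [kernelInt]
  simp only [integral_const_mul] at hswap
  rw [hswap]
  refine integral_congr_ae (Eventually.of_forall fun z => ?_)
  simp only []
  rw [← integral_complex_ofReal, ← integral_mul_const]
  refine integral_congr_ae (Eventually.of_forall fun y => ?_)
  simp only []
  push_cast; ring

/-! ### The quadratic form of the Carleman operator and its exact bounds 0 and π. -/

lemma isCarleman_carleman : IsCarleman (fun x y : ℝ => 1 / (x + y)) 1 :=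
  ⟨by fun_prop, fun x y hx hy => (abs_of_nonneg (by positivity)).le⟩

/-- The Carleman operator `f ↦ ∫ f(y) / (x + y) dy`. -/
def carlemanOp : HalfLineL2 →L[ℂ] HalfLineL2 := kernelOp isCarleman_carleman

/-- The quadratic form of the Carleman operator. -/
def carlemanForm (f : HalfLineL2) : ℝ := RCLike.re (inner ℂ f (carlemanOp f))

lemma integral_exp_neg_mul_Ioi_zero {a : ℝ} (ha : 0 < a) :
    IntegrableOn (fun s => Real.exp (-(s * a))) (Ioi 0) ∧
      ∫ s in Ioi 0, Real.exp (-(s * a)) = 1 / a := by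
  have hc : ContinuousWithinAt (fun s => -(Real.exp (-(s * a)) / a)) (Ici 0) 0 := by
    fun_prop
  have hd : ∀ s ∈ Ioi (0 : ℝ),
      HasDerivAt (fun s => -(Real.exp (-(s * a)) / a)) (Real.exp (-(s * a))) s := fun s _ => by
    refine ((((hasDerivAt_id s).mul_const a).fun_neg.exp.div_const a).fun_neg).congr_deriv ?_
    simp only [id]
    field_simp
  have ht : Tendsto (fun s => -(Real.exp (-(s * a)) / a)) atTop (𝓝 0) := by
    have h1 : Tendsto (fun s : ℝ => s * a) atTop atTop := tendsto_id.atTop_mul_const ha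
    simpa using ((Real.tendsto_exp_neg_atTop_nhds_zero.comp h1).div_const a).neg
  refine ⟨integrableOn_Ioi_deriv_of_nonneg hc hd (fun _ _ => (Real.exp_pos _).le) ht, ?_⟩
  rw [integral_Ioi_of_hasDerivAt_of_nonneg hc hd (fun _ _ => (Real.exp_pos _).le) ht]
  simp

/-- As 1/(x+y) = ∫₀^∞ e^{-s(x+y)} ds, the form is the squared L₂ norm of the Laplace transform of f.
-/
lemma carlemanForm_nonneg (f : HalfLineL2) : 0 ≤ carlemanForm f := by
  let G : ℝ × ℝ → ℝ → ℂ := fun p s => (Real.exp (-(s * (p.1 + p.2))) : ℂ) *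
    (starRingEnd ℂ (f p.1) * f p.2)
  have hf := Lp.memLp f
  have hint : Integrable (Function.uncurry G) ((halfLine.prod halfLine).prod halfLine) := by
    have hm : AEStronglyMeasurable (Function.uncurry G)
        ((halfLine.prod halfLine).prod halfLine) := by
      refine AEStronglyMeasurable.mul ?_ ?_
      · exact (by fun_prop : Measurable fun q : (ℝ × ℝ) × ℝ =>
          (Real.exp (-(q.2 * (q.1.1 + q.1.2))) : ℂ)).aestronglyMeasurable
      · exact AEStronglyMeasurable.comp_fst
          (f := fun p : ℝ × ℝ => starRingEnd ℂ (f p.1) * f p.2)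
          ((Complex.continuous_conj.comp_aestronglyMeasurable hf.1.comp_fst).mul hf.1.comp_snd)
    refine (integrable_prod_iff hm).2 ⟨?_, ?_⟩
    · filter_upwards [ae_halfLine_prod_pos] with p hp
      change Integrable (fun s => (Real.exp (-(s * (p.1 + p.2))) : ℂ) *
        (starRingEnd ℂ (f p.1) * f p.2)) halfLine
      exact ((integral_exp_neg_mul_Ioi_zero (add_pos hp.1 hp.2)).1.ofReal (𝕜 := ℂ)).mul_const _
    · refine (integrable_mul_div_add hf hf).congr ?_
      filter_upwards [ae_halfLine_prod_pos] with p hp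
      have e : ∀ s, ‖Function.uncurry G (p, s)‖
          = Real.exp (-(s * (p.1 + p.2))) * (‖f p.1‖ * ‖f p.2‖) := fun s => by
        simp only [Function.uncurry_apply_pair, G, norm_mul, RCLike.norm_conj, Complex.norm_real,
          Real.norm_eq_abs, Real.abs_exp]
      simp only [e]
      rw [integral_mul_const, (integral_exp_neg_mul_Ioi_zero (add_pos hp.1 hp.2)).2]
      ring
  have hswap := integral_integral_swap hint
  have hleft : inner ℂ f (carlemanOp f) = ∫ p, ∫ s, G p s ∂halfLine ∂(halfLine.prod halfLine) := by
    rw [carlemanOp, inner_kernelOp]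
    refine integral_congr_ae ?_
    filter_upwards [ae_halfLine_prod_pos] with p hp
    simp only [G]
    rw [integral_mul_const, integral_complex_ofReal,
      (integral_exp_neg_mul_Ioi_zero (add_pos hp.1 hp.2)).2]
    ring
  have hright : ∀ s, ∫ p, G p s ∂(halfLine.prod halfLine)
      = ((‖∫ y, (Real.exp (-(s * y)) : ℂ) * f y ∂halfLine‖ ^ 2 : ℝ) : ℂ) := by
    intro s
    have e : ∀ p, G p s = starRingEnd ℂ ((Real.exp (-(s * p.1)) : ℂ) * f p.1) *
        ((Real.exp (-(s * p.2)) : ℂ) * f p.2) := fun p => by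
      simp only [G, map_mul, Complex.conj_ofReal]
      rw [mul_add, neg_add, Real.exp_add]
      push_cast; ring
    simp only [e]
    rw [integral_prod_mul (fun x => starRingEnd ℂ ((Real.exp (-(s * x)) : ℂ) * f x))
      (fun y => (Real.exp (-(s * y)) : ℂ) * f y), integral_conj, mul_comm, Complex.mul_conj,
      Complex.normSq_eq_norm_sq]
  rw [carlemanForm, hleft, hswap]
  simp only [hright]
  rw [integral_complex_ofReal]
  exact integral_nonneg fun _ => sq_nonneg _

/-- The defect in Hilbert's inequality. -/
lemma carlemanForm_defect (f : HalfLineL2) :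
    Integrable (fun p : ℝ × ℝ => ‖(√p.1 : ℂ) * f p.1 - (√p.2 : ℂ) * f p.2‖ ^ 2
        / (√p.1 * √p.2 * (p.1 + p.2))) (halfLine.prod halfLine) ∧
    ∫ p : ℝ × ℝ, ‖(√p.1 : ℂ) * f p.1 - (√p.2 : ℂ) * f p.2‖ ^ 2 / (√p.1 * √p.2 * (p.1 + p.2))
      ∂(halfLine.prod halfLine) = 2 * (Real.pi * ‖f‖ ^ 2 - carlemanForm f) := by
  have hf := Lp.memLp f
  have i1 := integrable_schurWeight_prod hf
  have i2 := integrable_schurWeight_prod_swap hf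
  have i3 := isCarleman_carleman.integrable_form hf hf
  have i12 : Integrable (fun p : ℝ × ℝ => schurWeight p.1 p.2 * ‖f p.1‖ ^ 2
      + schurWeight p.2 p.1 * ‖f p.2‖ ^ 2) (halfLine.prod halfLine) := i1.add i2
  have i4 := i12.sub (i3.re.const_mul 2)
  -- Expanding the square, the two diagonal terms carry Schur's weights, of total mass π, and the
  -- cross term carries 1/(x+y).
  have e : (fun p : ℝ × ℝ => ‖(√p.1 : ℂ) * f p.1 - (√p.2 : ℂ) * f p.2‖ ^ 2
      / (√p.1 * √p.2 * (p.1 + p.2))) =ᵐ[halfLine.prod halfLine]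
      fun p => schurWeight p.1 p.2 * ‖f p.1‖ ^ 2 + schurWeight p.2 p.1 * ‖f p.2‖ ^ 2
        - 2 * RCLike.re (starRingEnd ℂ (f p.1) * (((1 / (p.1 + p.2) : ℝ) : ℂ) * f p.2)) := by
    filter_upwards [ae_halfLine_prod_pos] with p hp
    have h1 := Real.sqrt_pos.2 hp.1
    have h2 := Real.sqrt_pos.2 hp.2
    have hs : 0 < p.1 + p.2 := add_pos hp.1 hp.2
    have hs' : 0 < p.2 + p.1 := add_pos hp.2 hp.1
    have hin : RCLike.re (inner ℂ ((√p.1 : ℂ) * f p.1) ((√p.2 : ℂ) * f p.2))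
        = √p.1 * √p.2 * RCLike.re (starRingEnd ℂ (f p.1) * f p.2) := by
      rw [RCLike.inner_apply', map_mul (starRingEnd ℂ), show starRingEnd ℂ (√p.1 : ℂ) = (√p.1 : ℂ) from
        Complex.conj_ofReal _, mul_mul_mul_comm, ← Complex.ofReal_mul]
      exact Complex.re_ofReal_mul _ _
    have hre : RCLike.re (starRingEnd ℂ (f p.1) * (((1 / (p.1 + p.2) : ℝ) : ℂ) * f p.2))
        = 1 / (p.1 + p.2) * RCLike.re (starRingEnd ℂ (f p.1) * f p.2) := by
      rw [mul_left_comm]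
      exact Complex.re_ofReal_mul _ _
    rw [norm_sub_sq (𝕜 := ℂ), hin, hre, norm_mul, norm_mul, Complex.norm_real, Complex.norm_real,
      Real.norm_of_nonneg h1.le, Real.norm_of_nonneg h2.le]
    unfold schurWeight
    rw [add_comm p.2 p.1]
    field_simp
    ring
  refine ⟨i4.congr e.symm, ?_⟩
  rw [integral_congr_ae e, integral_sub i12 (i3.re.const_mul 2), integral_add i1 i2,
    integral_const_mul, integral_re i3, carlemanForm, carlemanOp, inner_kernelOp]
  have := integral_prod_swap (μ := halfLine) (ν := halfLine)
    (fun p : ℝ × ℝ => schurWeight p.1 p.2 * ‖f p.1‖ ^ 2)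
  simp only [Prod.fst_swap, Prod.snd_swap] at this
  rw [this, integral_schurWeight_prod hf, norm_sq_eq_integral]
  ring

lemma defect_nonneg (f : ℝ → ℂ) : ∀ᵐ p : ℝ × ℝ ∂(halfLine.prod halfLine),
    0 ≤ ‖(√p.1 : ℂ) * f p.1 - (√p.2 : ℂ) * f p.2‖ ^ 2 / (√p.1 * √p.2 * (p.1 + p.2)) := by
  filter_upwards [ae_halfLine_prod_pos] with p hp
  have := hp.1
  have := hp.2
  positivity

lemma carlemanForm_le (f : HalfLineL2) : carlemanForm f ≤ Real.pi * ‖f‖ ^ 2 := by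
  have h1 := integral_nonneg_of_ae (defect_nonneg f)
  rw [(carlemanForm_defect f).2] at h1
  linarith

/-- A vanishing defect makes √x f(x) constant almost everywhere, and c/√x is square integrable only
for c = 0. -/
lemma eq_zero_of_carlemanForm_eq {f : HalfLineL2} (h : carlemanForm f = Real.pi * ‖f‖ ^ 2) :
    f = 0 := by
  obtain ⟨hi, he⟩ := carlemanForm_defect f
  rw [h, sub_self, mul_zero, integral_eq_zero_iff_of_nonneg_ae (defect_nonneg f) hi] at he
  have hae : ∀ᵐ p ∂(halfLine.prod halfLine), (√p.1 : ℂ) * f p.1 = (√p.2 : ℂ) * f p.2 := by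
    filter_upwards [he, ae_halfLine_prod_pos] with p hp hpos
    have h1 := Real.sqrt_pos.2 hpos.1
    have h2 := Real.sqrt_pos.2 hpos.2
    have hne : √p.1 * √p.2 * (p.1 + p.2) ≠ 0 := by
      have := hpos.1; have := hpos.2; positivity
    simp only [Pi.zero_apply, div_eq_zero_iff, hne, or_false] at hp
    rw [pow_eq_zero_iff two_ne_zero, norm_eq_zero] at hp
    exact sub_eq_zero.1 hp
  have hne : (ae halfLine).NeBot := by
    rw [ae_neBot]
    intro h0
    simpa using congrArg (fun μ : Measure ℝ => μ univ) h0
  obtain ⟨x, hx⟩ := (Measure.ae_ae_of_ae_prod hae).exists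
  dsimp only at hx
  generalize (√x : ℂ) * f x = c at hx
  have hc : c = 0 := by
    by_contra hc0
    have hsq := (memLp_two_iff_integrable_sq_norm (Lp.memLp f).1).1 (Lp.memLp f)
    have h2 : Integrable (fun y : ℝ => y⁻¹) halfLine := by
      refine (hsq.const_mul (‖c‖ ^ 2)⁻¹).congr ?_
      filter_upwards [hx, ae_halfLine_pos] with y hy hy0
      have hsy := Real.sqrt_pos.2 hy0
      have : ‖c‖ ^ 2 = y * ‖f y‖ ^ 2 := by
        rw [hy, norm_mul, Complex.norm_real, Real.norm_of_nonneg hsy.le, mul_pow,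
          Real.sq_sqrt hy0.le]
      have hcn : ‖c‖ ^ 2 ≠ 0 := by simpa using hc0
      rw [this] at hcn ⊢
      rw [mul_inv, mul_assoc, inv_mul_cancel₀ (right_ne_zero_of_mul hcn), mul_one]
    exact not_integrableOn_Ioi_inv h2
  rw [Lp.eq_zero_iff_ae_eq_zero]
  filter_upwards [hx, ae_halfLine_pos] with y hy hy0
  have hsy := Real.sqrt_pos.2 hy0
  rw [hc] at hy
  simpa [hsy.ne', hy0.not_ge] using hy.symm

/-- The class in `L₂(0, ∞)` of a real function. -/
lemma carlemanForm_toLp {h : ℝ → ℝ} (hh : MemLp (fun x => (h x : ℂ)) 2 halfLine) :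
    carlemanForm (hh.toLp _) = ∫ x, h x * ∫ y, h y / (x + y) ∂halfLine ∂halfLine := by
  have e : inner ℂ (hh.toLp _) (carlemanOp (hh.toLp _))
      = ((∫ x, h x * ∫ y, h y / (x + y) ∂halfLine ∂halfLine : ℝ) : ℂ) := by
    rw [L2.inner_def, ← integral_complex_ofReal]
    refine integral_congr_ae ?_
    filter_upwards [hh.coeFn_toLp, coeFn_kernelOp isCarleman_carleman (hh.toLp _)] with x h1 h2
    rw [h1, carlemanOp, h2, kernelInt_congr _ hh.coeFn_toLp, RCLike.inner_apply', kernelInt]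
    rw [show starRingEnd ℂ (h x : ℂ) = (h x : ℂ) from Complex.conj_ofReal _, Complex.ofReal_mul,
      ← integral_complex_ofReal]
    congr 1
    refine integral_congr_ae (Eventually.of_forall fun y => ?_)
    simp only []
    push_cast; ring
  rw [carlemanForm, e]
  exact Complex.ofReal_re _

lemma norm_sq_toLp {h : ℝ → ℝ} (hh : MemLp (fun x => (h x : ℂ)) 2 halfLine) :
    ‖hh.toLp _‖ ^ 2 = ∫ x, h x ^ 2 ∂halfLine := by
  rw [norm_sq_eq_integral]
  refine integral_congr_ae ?_
  filter_upwards [hh.coeFn_toLp] with x hx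
  rw [hx, Complex.norm_real, Real.norm_eq_abs, sq_abs]

lemma integral_indicator_Ioc {a b : ℝ} (ha : 0 ≤ a) (hab : a ≤ b) (g : ℝ → ℝ) :
    ∫ x, (Ioc a b).indicator g x ∂halfLine = ∫ x in a..b, g x := by
  rw [integral_indicator measurableSet_Ioc, Measure.restrict_restrict measurableSet_Ioc,
    intervalIntegral.integral_of_le hab, inter_eq_left.2]
  exact fun x hx => ha.trans_lt hx.1

lemma memLp_indicator_Ioc {a b : ℝ} {g : ℝ → ℝ} (hg : Measurable g) {B : ℝ}
    (hB : ∀ x ∈ Ioc a b, |g x| ≤ B) :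
    MemLp (fun x => (((Ioc a b).indicator g x : ℝ) : ℂ)) 2 halfLine := by
  have hm : Measurable ((Ioc a b).indicator g) := hg.indicator measurableSet_Ioc
  have h1 : MemLp ((Ioc a b).indicator fun _ => (B : ℂ)) 2 halfLine := by
    refine memLp_indicator_const 2 measurableSet_Ioc _ (Or.inr ?_)
    exact ((Measure.restrict_apply_le _ _).trans_lt (by simp)).ne
  refine h1.mono (Complex.measurable_ofReal.comp hm).aestronglyMeasurable
    (Eventually.of_forall fun x => ?_)
  by_cases hx : x ∈ Ioc a b
  · simp only [indicator_of_mem hx, Complex.norm_real, Real.norm_eq_abs]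
    exact (hB x hx).trans (le_abs_self B)
  · simp [indicator_of_notMem hx]

/-- For the indicator of (1, 1+δ] the kernel is at most 1, so the form is at most δ², while ‖f‖² =
δ. -/
lemma exists_carlemanForm_le {δ : ℝ} (hδ : 0 < δ) :
    ∃ f : HalfLineL2, f ≠ 0 ∧ carlemanForm f ≤ δ * ‖f‖ ^ 2 := by
  have hB : ∀ x ∈ Ioc (1 : ℝ) (1 + δ), |(fun _ => 1 : ℝ → ℝ) x| ≤ 1 := by simp
  have hh := memLp_indicator_Ioc measurable_const hB
  have hn := norm_sq_toLp hh
  have e : ∀ x, (Ioc (1 : ℝ) (1 + δ)).indicator (fun _ => (1 : ℝ)) x ^ 2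
      = (Ioc (1 : ℝ) (1 + δ)).indicator (fun _ => (1 : ℝ)) x := fun x => by
    by_cases hx : x ∈ Ioc (1 : ℝ) (1 + δ) <;> simp [hx]
  simp only [e] at hn
  have hval : ∫ x, (Ioc (1 : ℝ) (1 + δ)).indicator (fun _ => (1 : ℝ)) x ∂halfLine = δ := by
    rw [integral_indicator_Ioc zero_le_one (by linarith)]; simp
  rw [hval] at hn
  have hi : Integrable ((Ioc (1 : ℝ) (1 + δ)).indicator (fun _ => (1 : ℝ))) halfLine :=
    Integrable.of_integral_ne_zero (by rw [hval]; exact hδ.ne')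
  refine ⟨hh.toLp _, fun h0 => ?_, ?_⟩
  · rw [h0, norm_zero] at hn; norm_num at hn; exact hδ.ne hn
  · rw [carlemanForm_toLp, hn]
    have hnn : ∀ x, 0 ≤ (Ioc (1 : ℝ) (1 + δ)).indicator (fun _ => (1 : ℝ)) x := fun x =>
      indicator_nonneg (fun _ _ => zero_le_one) x
    have hle : ∀ x, (Ioc (1 : ℝ) (1 + δ)).indicator (fun _ => (1 : ℝ)) x *
        ∫ y, (Ioc (1 : ℝ) (1 + δ)).indicator (fun _ => (1 : ℝ)) y / (x + y) ∂halfLine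
        ≤ (Ioc (1 : ℝ) (1 + δ)).indicator (fun _ => (1 : ℝ)) x * δ := by
      intro x
      by_cases hx : x ∈ Ioc (1 : ℝ) (1 + δ)
      · refine mul_le_mul_of_nonneg_left ?_ (hnn x)
        refine (integral_mono_of_nonneg ?_ hi ?_).trans hval.le
        · filter_upwards [ae_halfLine_pos] with y hy
          exact div_nonneg (hnn y) (by linarith [hx.1])
        · filter_upwards [ae_halfLine_pos] with y hy
          exact div_le_self (hnn y) (by linarith [hx.1] : 1 ≤ x + y)
      · simp [hx]
    calc _ ≤ ∫ x, (Ioc (1 : ℝ) (1 + δ)).indicator (fun _ => (1 : ℝ)) x * δ ∂halfLine := by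
          refine integral_mono_of_nonneg ?_ (hi.mul_const δ) (Eventually.of_forall hle)
          filter_upwards [ae_halfLine_pos] with x hx
          refine mul_nonneg (hnn x) (integral_nonneg_of_ae ?_)
          filter_upwards [ae_halfLine_pos] with y hy
          exact div_nonneg (hnn y) (by linarith)
      _ = _ := by rw [integral_mul_const, hval]

lemma arctan_le_self {a : ℝ} (ha : 0 ≤ a) : Real.arctan a ≤ a := by
  rcases ha.eq_or_lt with rfl | ha
  · simp
  · have h1 := Real.arctan_pos.2 ha
    have := Real.lt_tan h1 (Real.arctan_lt_pi_div_two a)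
    rw [Real.tan_arctan] at this
    exact this.le

/-- The two subtracted terms estimate what the integral of the weight loses by restriction to (1,
N], from arctan(1/u) = π/2 - arctan u and arctan u ≤ u. -/
lemma le_arctan_sub {x N : ℝ} (hx : 0 < x) (hN : 0 < N) :
    Real.pi - 2 * (√x / √N) - 2 * (1 / √x)
      ≤ 2 * Real.arctan (√N / √x) - 2 * Real.arctan (1 / √x) := by
  have h1 := Real.sqrt_pos.2 hx
  have h2 := Real.sqrt_pos.2 hN
  have h3 : Real.arctan (√N / √x) = Real.pi / 2 - Real.arctan (√x / √N) := by
    rw [← Real.arctan_inv_of_pos (by positivity), inv_div]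
  have h4 := arctan_le_self (show 0 ≤ √x / √N by positivity)
  have h5 := arctan_le_self (show 0 ≤ 1 / √x by positivity)
  rw [h3]; linarith

/-- The function 1/√x, for which Hilbert's inequality would be an equality, is cut off to (1, N].
Then ‖f‖² = log N, and the form differs from π log N by a bounded amount. -/
lemma exists_le_carlemanForm {δ : ℝ} (hδ : 0 < δ) :
    ∃ f : HalfLineL2, f ≠ 0 ∧ (Real.pi - δ) * ‖f‖ ^ 2 ≤ carlemanForm f := by
  -- The two ends of the cut-off cost at most 4 each, by the value of `hlow`.
  obtain ⟨N, hN1, hN⟩ : ∃ N : ℝ, 1 < N ∧ 8 ≤ δ * Real.log N := by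
    refine ⟨Real.exp (8 / δ), Real.one_lt_exp_iff.2 (by positivity), ?_⟩
    rw [Real.log_exp, mul_div_cancel₀ _ hδ.ne']
  have hN0 : 0 < N := by linarith
  have hlog : 0 < Real.log N := Real.log_pos hN1
  let g : ℝ → ℝ := fun x => 1 / √x
  have hg : Measurable g := by fun_prop
  have hB : ∀ x ∈ Ioc 1 N, |g x| ≤ 1 := fun x hx => by
    have : 1 ≤ √x := Real.one_le_sqrt.2 hx.1.le
    simp only [g]
    rw [abs_of_nonneg (by positivity), div_le_one (by linarith)]
    exact this
  have hh := memLp_indicator_Ioc hg hB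
  have hn : ‖hh.toLp _‖ ^ 2 = Real.log N := by
    rw [norm_sq_toLp hh]
    have e : ∀ x, (Ioc 1 N).indicator g x ^ 2 = (Ioc 1 N).indicator (fun x => x⁻¹) x := fun x => by
      by_cases hx : x ∈ Ioc 1 N
      · simp [hx, g, Real.sq_sqrt (by linarith [hx.1] : (0 : ℝ) ≤ x)]
      · simp [hx]
    simp only [e]
    rw [integral_indicator_Ioc zero_le_one hN1.le, integral_inv_of_pos one_pos hN0, div_one]
  refine ⟨hh.toLp _, fun h0 => ?_, ?_⟩
  · rw [h0, norm_zero] at hn; norm_num at hn; exact hlog.ne hn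
  have hinner : ∀ x, 0 < x → ∫ y, (Ioc 1 N).indicator g y / (x + y) ∂halfLine
      = 1 / √x * (2 * Real.arctan (√N / √x) - 2 * Real.arctan (1 / √x)) := by
    intro x hx
    have e : ∀ y, (Ioc 1 N).indicator g y / (x + y)
        = (Ioc 1 N).indicator (fun y => 1 / √x * schurWeight x y) y := fun y => by
      by_cases hy : y ∈ Ioc 1 N
      · have h1 := Real.sqrt_pos.2 hx
        simp only [hy, indicator_of_mem, g, schurWeight]
        field_simp
      · simp [hy]
    simp only [e]
    rw [integral_indicator_Ioc zero_le_one hN1.le, intervalIntegral.integral_const_mul,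
      intervalIntegral.integral_eq_sub_of_hasDerivAt (fun y hy => hasDerivAt_arctan_sqrt hx ?_)]
    · simp
    · refine ContinuousOn.intervalIntegrable fun y hy => ContinuousAt.continuousWithinAt ?_
      rw [uIcc_of_le hN1.le] at hy
      have hy0 : 0 < y := by linarith [hy.1]
      have := Real.sqrt_pos.2 hy0
      unfold schurWeight
      refine ContinuousAt.div (by fun_prop) (by fun_prop) (by positivity)
    · rw [uIcc_of_le hN1.le] at hy
      linarith [hy.1]
  have hform : carlemanForm (hh.toLp _) = ∫ x in (1 : ℝ)..N,
      1 / x * (2 * Real.arctan (√N / √x) - 2 * Real.arctan (1 / √x)) := by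
    rw [carlemanForm_toLp, ← integral_indicator_Ioc zero_le_one hN1.le]
    refine integral_congr_ae ?_
    filter_upwards [ae_halfLine_pos] with x hx
    rw [hinner x hx]
    by_cases hx' : x ∈ Ioc 1 N
    · simp only [hx', indicator_of_mem, g]
      rw [← mul_assoc, div_mul_div_comm, one_mul, Real.mul_self_sqrt hx.le]
    · simp [hx']
  have hc0 : ∀ x ∈ uIcc 1 N, 0 < x := fun x hx => by
    rw [uIcc_of_le hN1.le] at hx; linarith [hx.1]
  have hlow : ∫ x in (1 : ℝ)..N, 1 / x * (Real.pi - 2 * (√x / √N) - 2 * (1 / √x))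
      = (Real.pi * Real.log N - 4 * (√N / √N) + 4 * (1 / √N))
        - (Real.pi * Real.log 1 - 4 * (√1 / √N) + 4 * (1 / √1)) := by
    refine intervalIntegral.integral_eq_sub_of_hasDerivAt
      (f := fun x => Real.pi * Real.log x - 4 * (√x / √N) + 4 * (1 / √x)) (fun x hx => ?_) ?_
    · have hx0 := hc0 x hx
      have h1 := Real.sqrt_pos.2 hx0
      have h2 := Real.sqrt_pos.2 hN0
      have d1 := (Real.hasDerivAt_log hx0.ne').const_mul Real.pi
      have d2 := ((Real.hasDerivAt_sqrt hx0.ne').div_const (√N)).const_mul 4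
      have d3 := ((Real.hasDerivAt_sqrt hx0.ne').fun_inv h1.ne').const_mul 4
      have e : (fun x => Real.pi * Real.log x - 4 * (√x / √N) + 4 * (1 / √x))
          = fun x => Real.pi * Real.log x - 4 * (√x / √N) + 4 * (√x)⁻¹ := by
        simp only [one_div]
      rw [e]
      refine ((d1.fun_sub d2).fun_add d3).congr_deriv ?_
      have hxx : x = √x ^ 2 := (Real.sq_sqrt hx0.le).symm
      generalize √x = w at *
      subst hxx
      field_simp
      ring
    · refine ContinuousOn.intervalIntegrable fun x hx => ContinuousAt.continuousWithinAt ?_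
      have hx0 := hc0 x hx
      have h1 := Real.sqrt_pos.2 hx0
      have h2 := Real.sqrt_pos.2 hN0
      fun_prop (disch := positivity)
  have hge : ∫ x in (1 : ℝ)..N, 1 / x * (Real.pi - 2 * (√x / √N) - 2 * (1 / √x))
      ≤ ∫ x in (1 : ℝ)..N, 1 / x * (2 * Real.arctan (√N / √x) - 2 * Real.arctan (1 / √x)) := by
    refine intervalIntegral.integral_mono_on hN1.le ?_ ?_ fun x hx => ?_
    · refine ContinuousOn.intervalIntegrable fun x hx => ContinuousAt.continuousWithinAt ?_
      have hx0 := hc0 x hx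
      have h1 := Real.sqrt_pos.2 hx0
      have h2 := Real.sqrt_pos.2 hN0
      fun_prop (disch := positivity)
    · refine ContinuousOn.intervalIntegrable fun x hx => ContinuousAt.continuousWithinAt ?_
      have hx0 := hc0 x hx
      have h1 := Real.sqrt_pos.2 hx0
      have h3 : Continuous Real.arctan := Real.continuous_arctan
      fun_prop (disch := positivity)
    · have hx0 : 0 < x := by linarith [hx.1]
      exact mul_le_mul_of_nonneg_left (le_arctan_sub hx0 hN0) (by positivity)
  rw [hn, hform]
  refine le_trans ?_ hge
  rw [hlow]
  have h2 := Real.sqrt_pos.2 hN0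
  rw [div_self h2.ne', Real.sqrt_one, Real.log_one]
  have h3 : 0 < 1 / √N := by positivity
  linarith

/-! ### The operator K with the Legendre kernel and the products KK*, K*K. -/

/-- The kernel `P'(t / x) / x` on `0 < t < x`. -/
def legendreKernel (P1 : ℝ → ℝ) (x t : ℝ) : ℝ := if 0 < t ∧ t < x then P1 (t / x) / x else 0

lemma legendreKernel_of_lt (P1 : ℝ → ℝ) {x t : ℝ} (ht : 0 < t) (htx : t < x) :
    legendreKernel P1 x t = P1 (t / x) / x := if_pos ⟨ht, htx⟩

lemma legendreKernel_of_le (P1 : ℝ → ℝ) {x t : ℝ} (htx : x ≤ t) : legendreKernel P1 x t = 0 :=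
  if_neg fun h => htx.not_gt h.2

/-- P' is bounded on [0, 1], and t < x gives 1/x ≤ 2/(x+t). -/
lemma IsLegendre.exists_isCarleman {ν : ℝ} {P P1 P2 : ℝ → ℝ} (h : IsLegendre ν P P1 P2) :
    ∃ M, IsCarleman (legendreKernel P1) M := by
  obtain ⟨M, hM0, -, hM⟩ := h.exists_bound 1
  refine ⟨2 * M, ?_, fun x t hx ht => ?_⟩
  · have hS : IsOpen {p : ℝ × ℝ | 0 < p.2 ∧ p.2 < p.1} :=
      (isOpen_lt continuous_const continuous_snd).inter (isOpen_lt continuous_snd continuous_fst)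
    have hc : ContinuousOn (fun p : ℝ × ℝ => P1 (p.2 / p.1) / p.1)
        {p : ℝ × ℝ | 0 < p.2 ∧ p.2 < p.1} := by
      have h0 : ∀ p ∈ {p : ℝ × ℝ | 0 < p.2 ∧ p.2 < p.1}, p.1 ≠ 0 := fun p hp =>
        (hp.1.trans hp.2).ne'
      refine (h.continuousOn_deriv.comp (f := fun p : ℝ × ℝ => p.2 / p.1)
        (continuousOn_snd.div continuousOn_fst h0) fun p hp => ?_).div continuousOn_fst h0
      have : 0 < p.2 / p.1 := div_pos hp.1 (hp.1.trans hp.2)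
      simp only [mem_Ioi]; linarith
    have := hc.measurable_piecewise (g := fun _ => (0 : ℝ)) continuousOn_const hS.measurableSet
    exact this
  · rcases lt_or_ge t x with htx | htx
    · rw [legendreKernel_of_lt _ ht htx, abs_div, abs_of_pos hx, div_le_div_iff₀ hx (by positivity)]
      have := hM (t / x) ⟨by positivity, (div_le_one hx).2 htx.le⟩
      nlinarith [abs_nonneg (P1 (t / x))]
    · rw [legendreKernel_of_le _ htx, abs_zero]
      positivity

lemma integral_halfLine_Ioo {E : Type*} [NormedAddCommGroup E] [NormedSpace ℝ E] {F G : ℝ → E}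
    {a b : ℝ} (ha : 0 ≤ a) (h1 : ∀ y, a < y → y < b → F y = G y)
    (h2 : ∀ y, 0 < y → ¬ (a < y ∧ y < b) → F y = 0) :
    ∫ y, F y ∂halfLine = ∫ y in Ioo a b, G y := by
  rw [setIntegral_eq_of_subset_of_forall_sdiff_eq_zero (s := Ioo a b) measurableSet_Ioi
    (fun y hy => ha.trans_lt hy.1) (fun y hy => h2 y hy.1 hy.2)]
  exact setIntegral_congr_fun measurableSet_Ioo fun y hy => h1 y hy.1 hy.2

lemma integral_halfLine_Ioi {E : Type*} [NormedAddCommGroup E] [NormedSpace ℝ E] {F G : ℝ → E}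
    {a : ℝ} (ha : 0 ≤ a) (h1 : ∀ y, a < y → F y = G y) (h2 : ∀ y, 0 < y → y ≤ a → F y = 0) :
    ∫ y, F y ∂halfLine = ∫ y in Ioi a, G y := by
  rw [setIntegral_eq_of_subset_of_forall_sdiff_eq_zero (s := Ioi a) measurableSet_Ioi
    (fun y hy => ha.trans_lt hy) (fun y hy => h2 y hy.1 (not_lt.1 hy.2))]
  exact setIntegral_congr_fun measurableSet_Ioi fun y hy => h1 y hy

lemma kernelInt_legendreKernel (P1 : ℝ → ℝ) (f : ℝ → ℂ) (x : ℝ) :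
    kernelInt (legendreKernel P1) f x = ∫ t in Ioo 0 x, ((P1 (t / x) / x : ℝ) : ℂ) * f t := by
  refine integral_halfLine_Ioo le_rfl (fun y h0 h1 => ?_) fun y h0 h1 => ?_
  · rw [legendreKernel_of_lt _ h0 h1]
  · rw [legendreKernel, if_neg h1]; simp

lemma kernelInt_legendreKernel_swap (P1 : ℝ → ℝ) (f : ℝ → ℂ) {x : ℝ} (hx : 0 < x) :
    kernelInt (fun x t => legendreKernel P1 t x) f x
      = ∫ t in Ioi x, ((P1 (x / t) / t : ℝ) : ℂ) * f t := by
  refine integral_halfLine_Ioi hx.le (fun y h1 => ?_) fun y h0 h1 => ?_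
  · dsimp only
    rw [legendreKernel_of_lt _ hx h1]
  · dsimp only
    rw [legendreKernel_of_le _ h1]; simp

namespace IsLegendre

variable {ν : ℝ} {P P1 P2 : ℝ → ℝ}

/-- The kernel of KK*, off the diagonal, where the concomitant has its denominator; the diagonal is
a null set. Only one of the first two terms on the right is nonzero. -/
lemma integral_legendreKernel_mul (h : IsLegendre ν P P1 P2) {x z : ℝ} (hx : 0 < x) (hz : 0 < z)
    (hne : x ≠ z) : ∫ y, legendreKernel P1 x y * legendreKernel P1 z y ∂halfLine
      = legendreKernel P1 x z + legendreKernel P1 z x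
        - Real.sin (Real.pi * ν) / Real.pi / (x + z) := by
  have key : ∀ s t, 0 < s → s < t → ∫ y, legendreKernel P1 s y * legendreKernel P1 t y ∂halfLine
      = P1 (s / t) / t - Real.sin (Real.pi * ν) / Real.pi / (s + t) := by
    intro s t hs hst
    rw [← h.integral_kernel_gram hs hst, intervalIntegral.integral_of_le hs.le,
      integral_Ioc_eq_integral_Ioo]
    refine integral_halfLine_Ioo le_rfl (fun y h0 h1 => ?_) fun y h0 h1 => ?_
    · rw [legendreKernel_of_lt _ h0 h1, legendreKernel_of_lt _ h0 (h1.trans hst)]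
    · rw [legendreKernel, if_neg h1, zero_mul]
  rcases lt_or_gt_of_ne hne with hlt | hlt
  · rw [key x z hx hlt, legendreKernel_of_le _ hlt.le, legendreKernel_of_lt _ hx hlt, zero_add]
  · simp only [mul_comm (legendreKernel P1 x _)]
    rw [key z x hz hlt, legendreKernel_of_le _ hlt.le, legendreKernel_of_lt _ hz hlt, add_zero,
      add_comm z x]

lemma integral_legendreKernel_mul' (h : IsLegendre ν P P1 P2) {x z : ℝ} (hx : 0 < x) (hz : 0 < z)
    (hne : x ≠ z) : ∫ y, legendreKernel P1 y x * legendreKernel P1 y z ∂halfLine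
      = legendreKernel P1 z x + legendreKernel P1 x z
        - Real.sin (Real.pi * ν) / Real.pi / (x + z) := by
  obtain ⟨M, hM0, -, hM⟩ := h.exists_bound 1
  have key : ∀ s t, 0 < s → s < t → ∫ y, legendreKernel P1 y s * legendreKernel P1 y t ∂halfLine
      = P1 (s / t) / t - Real.sin (Real.pi * ν) / Real.pi / (s + t) := by
    intro s t hs hst
    have ht : 0 < t := hs.trans hst
    -- Both arguments of P' lie in [0, 1], so the integrand is O(y⁻²) at infinity.
    have hint : IntegrableOn (fun y => P1 (s / y) / y * (P1 (t / y) / y)) (Ioi t) := by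
      have hr : IntegrableOn (fun y : ℝ => M ^ 2 * y ^ (-2 : ℝ)) (Ioi t) :=
        (integrableOn_Ioi_rpow_of_lt (by norm_num) ht).const_mul _
      refine hr.mono' (ContinuousOn.aestronglyMeasurable ?_ measurableSet_Ioi) ?_
      · have hc (γ : ℝ) (hγ : 0 < γ) : ContinuousOn (fun y => P1 (γ / y) / y) (Ioi t) := by
          have h0 : ∀ y ∈ Ioi t, y ≠ 0 := fun y hy => (ht.trans hy).ne'
          refine (h.continuousOn_deriv.comp (f := fun y => γ / y)
            (continuousOn_const.div continuousOn_id h0) fun y hy => ?_).div continuousOn_id h0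
          have : 0 < γ / y := div_pos hγ (ht.trans hy)
          simp only [mem_Ioi]; linarith
        exact (hc s hs).mul (hc t ht)
      · filter_upwards [ae_restrict_mem measurableSet_Ioi] with y hy
        have hy0 : 0 < y := ht.trans hy
        have h1 := hM (s / y) ⟨by positivity, (div_le_one hy0).2 (hst.trans hy).le⟩
        have h2 := hM (t / y) ⟨by positivity, (div_le_one hy0).2 (le_of_lt hy)⟩
        rw [Real.norm_eq_abs, div_mul_div_comm, abs_div, abs_mul, abs_mul, abs_of_pos hy0,
          Real.rpow_neg hy0.le, div_eq_mul_inv]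
        norm_num
        rw [sq, sq, mul_inv]
        gcongr
    rw [← h.integral_kernel_gram' hs hst hint]
    refine integral_halfLine_Ioi ht.le (fun y h1 => ?_) fun y h0 h1 => ?_
    · rw [legendreKernel_of_lt _ hs (hst.trans h1), legendreKernel_of_lt _ ht h1]
    · rw [legendreKernel_of_le _ h1, mul_zero]
  rcases lt_or_gt_of_ne hne with hlt | hlt
  · rw [key x z hx hlt, legendreKernel_of_le _ hlt.le, legendreKernel_of_lt _ hx hlt, add_zero]
  · simp only [mul_comm (legendreKernel P1 _ x)]
    rw [key z x hz hlt, legendreKernel_of_le _ hlt.le, legendreKernel_of_lt _ hz hlt, zero_add,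
      add_comm z x]

end IsLegendre

/-- If `K K* = K + K* - c C` for the Carleman operator `C`, then `(1 - K)(1 - K*) = 1 - c C`. -/
lemma norm_sq_sub_kernelOp {k : ℝ → ℝ → ℝ} {M c : ℝ} (hk : IsCarleman k M)
    (h : ∀ x z, 0 < x → 0 < z → x ≠ z →
      ∫ y, k x y * k z y ∂halfLine = k x z + k z x - c / (x + z)) (f : HalfLineL2) :
    ‖f - kernelOp hk.swap f‖ ^ 2 = ‖f‖ ^ 2 - c * carlemanForm f := by
  have hop : kernelOp hk (kernelOp hk.swap f)
      = kernelOp hk f + kernelOp hk.swap f - (c : ℂ) • carlemanOp f := by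
    refine Lp.ext ?_
    filter_upwards [coeFn_kernelOp hk (kernelOp hk.swap f),
      Lp.coeFn_sub (kernelOp hk f + kernelOp hk.swap f) ((c : ℂ) • carlemanOp f),
      Lp.coeFn_add (kernelOp hk f) (kernelOp hk.swap f), Lp.coeFn_smul (c : ℂ) (carlemanOp f),
      coeFn_kernelOp hk f, coeFn_kernelOp hk.swap f, coeFn_kernelOp isCarleman_carleman f,
      ae_halfLine_pos] with x e1 e2 e3 e4 e5 e6 e7 hx
    have hf := Lp.memLp f
    rw [e1, e2, Pi.sub_apply, e3, Pi.add_apply, e4, Pi.smul_apply, e5, e6, carlemanOp, e7,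
      kernelInt_congr k (coeFn_kernelOp hk.swap f), kernelInt_kernelInt hk hk.swap hf hx]
    simp only [kernelInt]
    have i1 : Integrable (fun y => (k x y : ℂ) * f y + (k y x : ℂ) * f y) halfLine :=
      (hk.integrable_mul hf hx).add (hk.swap.integrable_mul hf hx)
    have i2 : Integrable (fun y => (c : ℂ) • (((1 / (x + y) : ℝ) : ℂ) * f y)) halfLine :=
      (isCarleman_carleman.integrable_mul hf hx).smul (c : ℂ)
    rw [← integral_add (hk.integrable_mul hf hx) (hk.swap.integrable_mul hf hx), ← integral_smul,
      ← integral_sub i1 i2]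
    refine integral_congr_ae ?_
    have hne : ∀ᵐ z ∂halfLine, z ≠ x := ae_restrict_of_ae (by simp [ae_iff])
    filter_upwards [ae_halfLine_pos, hne] with z hz hzx
    rw [h x z hx hz hzx.symm, smul_eq_mul]
    push_cast
    ring
  have hadj : ∀ u v, inner ℂ (kernelOp hk.swap u) v = inner ℂ u (kernelOp hk v) := fun u v => by
    rw [← adjoint_kernelOp hk, ContinuousLinearMap.adjoint_inner_left]
  -- The terms of ‖K*f‖² = ⟨f, KK*f⟩ that are linear in K cancel the cross term of ‖f - K*f‖²,
  -- because K and K* have the same real part of the form.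
  have h1 : RCLike.re (inner ℂ f (kernelOp hk f)) = RCLike.re (inner ℂ f (kernelOp hk.swap f)) := by
    rw [← hadj, inner_re_symm (𝕜 := ℂ)]
  have h2 : ‖kernelOp hk.swap f‖ ^ 2 = RCLike.re (inner ℂ f (kernelOp hk.swap f))
      + RCLike.re (inner ℂ f (kernelOp hk.swap f)) - c * carlemanForm f := by
    rw [← inner_self_eq_norm_sq (𝕜 := ℂ), hadj, hop, inner_sub_right, inner_add_right,
      inner_smul_right, map_sub, map_add, h1, carlemanForm]
    congr 1
    exact Complex.re_ofReal_mul _ _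
  rw [norm_sub_sq (𝕜 := ℂ), h2]
  ring

/-! ### Fubini's theorem and locally absolutely continuous functions. -/

/-- Fubini's theorem for a real kernel `γ` applied to a function `f`. -/
lemma integral_kernel_swap {μ₁ μ₂ : Measure ℝ} [SFinite μ₁] [SFinite μ₂] {γ : ℝ → ℝ → ℝ} {f : ℝ → ℂ}
    (hγ : AEStronglyMeasurable (Function.uncurry γ) (μ₁.prod μ₂)) (hf : AEStronglyMeasurable f μ₂)
    (h1 : ∀ᵐ t ∂μ₂, Integrable (fun y => γ y t) μ₁)
    (h2 : Integrable (fun t => (∫ y, |γ y t| ∂μ₁) * ‖f t‖) μ₂) :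
    Integrable (fun y => ∫ t, (γ y t : ℂ) * f t ∂μ₂) μ₁ ∧
      Integrable (fun t => ((∫ y, γ y t ∂μ₁ : ℝ) : ℂ) * f t) μ₂ ∧
      ∫ y, ∫ t, (γ y t : ℂ) * f t ∂μ₂ ∂μ₁ = ∫ t, ((∫ y, γ y t ∂μ₁ : ℝ) : ℂ) * f t ∂μ₂ := by
  have hint : Integrable (Function.uncurry fun y t => (γ y t : ℂ) * f t) (μ₁.prod μ₂) := by
    have hm : AEStronglyMeasurable (Function.uncurry fun y t => (γ y t : ℂ) * f t)
        (μ₁.prod μ₂) :=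
      (Complex.continuous_ofReal.comp_aestronglyMeasurable hγ).mul hf.comp_snd
    refine (integrable_prod_iff' hm).2 ⟨?_, ?_⟩
    · filter_upwards [h1] with t ht
      exact (ht.ofReal (𝕜 := ℂ)).mul_const (f t)
    · refine h2.congr (Eventually.of_forall fun t => ?_)
      simp only [Function.uncurry_apply_pair, norm_mul, Complex.norm_real, Real.norm_eq_abs]
      rw [integral_mul_const]
  have e : ∀ t, ∫ y, (γ y t : ℂ) * f t ∂μ₁ = ((∫ y, γ y t ∂μ₁ : ℝ) : ℂ) * f t := fun t => by
    rw [integral_mul_const, integral_complex_ofReal]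
  refine ⟨hint.integral_prod_left, ?_, ?_⟩
  · simpa only [Function.uncurry_apply_pair, e] using hint.integral_prod_right
  · rw [integral_integral_swap hint]
    simp only [e]

namespace IsACDeriv

variable {F G f g : ℝ → ℂ}

lemma congr (h : IsACDeriv F f) (hF : ∀ x, 0 < x → G x = F x) (hf : g =ᵐ[halfLine] f) :
    IsACDeriv G g := by
  intro a b ha hb
  obtain ⟨h1, h2⟩ := h a b ha hb
  have hsub : uIoc a b ⊆ Ioi 0 := fun x hx => (lt_min ha hb).trans hx.1
  have hr : g =ᵐ[volume.restrict (uIoc a b)] f := ae_restrict_of_ae_restrict_of_subset hsub hf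
  refine ⟨h1.congr_ae hr.symm, ?_⟩
  rw [hF a ha, hF b hb, ← h2]
  exact intervalIntegral.integral_congr_ae_restrict hr

lemma of_le (h : ∀ a b, 0 < a → a ≤ b → IntegrableOn f (Ioc a b) ∧
    ∫ x in Ioc a b, f x = F b - F a) : IsACDeriv F f := by
  intro a b ha hb
  rcases le_total a b with hab | hab
  · obtain ⟨h1, h2⟩ := h a b ha hab
    exact ⟨(intervalIntegrable_iff_integrableOn_Ioc_of_le hab).2 h1,
      by rw [intervalIntegral.integral_of_le hab, h2]⟩
  · obtain ⟨h1, h2⟩ := h b a hb hab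
    exact ⟨((intervalIntegrable_iff_integrableOn_Ioc_of_le hab).2 h1).symm,
      by rw [intervalIntegral.integral_of_ge hab, h2]; ring⟩

lemma integrableOn (h : IsACDeriv F f) {a b : ℝ} (ha : 0 < a) (hab : a ≤ b) :
    IntegrableOn f (Ioc a b) :=
  (intervalIntegrable_iff_integrableOn_Ioc_of_le hab).1 (h a b ha (ha.trans_le hab)).1

lemma integral_Ioc (h : IsACDeriv F f) {a b : ℝ} (ha : 0 < a) (hab : a ≤ b) :
    ∫ x in Ioc a b, f x = F b - F a := by
  rw [← intervalIntegral.integral_of_le hab]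
  exact (h a b ha (ha.trans_le hab)).2

lemma iUnion_Ioc_inv_natCast : ⋃ n : ℕ, Ioc (1 / ((n : ℝ) + 1)) ((n : ℝ) + 1) = Ioi 0 := by
  ext x
  simp only [mem_iUnion, mem_Ioc, mem_Ioi]
  constructor
  · rintro ⟨n, h1, -⟩
    exact lt_trans (by positivity) h1
  · intro hx
    obtain ⟨n, hn⟩ := exists_nat_gt (max x (1 / x))
    have h1 := (le_max_left _ _).trans_lt hn
    have h2 := (le_max_right _ _).trans_lt hn
    refine ⟨n, ?_, by linarith⟩
    rw [div_lt_iff₀ hx] at h2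
    rw [div_lt_iff₀ (by positivity)]
    nlinarith

lemma aestronglyMeasurable (h : IsACDeriv F f) : AEStronglyMeasurable f halfLine := by
  rw [halfLine, ← iUnion_Ioc_inv_natCast, aestronglyMeasurable_iUnion_iff]
  intro n
  refine (h.integrableOn (by positivity) ?_).aestronglyMeasurable
  rw [div_le_iff₀ (by positivity)]
  nlinarith [(Nat.cast_nonneg n : (0 : ℝ) ≤ n)]

/-- Lebesgue's differentiation theorem on an exhaustion of (0, ∞) by bounded intervals. -/
lemma unique (hf : IsACDeriv F f) (hg : IsACDeriv F g) : f =ᵐ[halfLine] g := by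
  have key : ∀ n : ℕ, ∀ᵐ x ∂(volume.restrict (Ioc (1 / ((n : ℝ) + 1)) ((n : ℝ) + 1))),
      f x = g x := by
    intro n
    set a : ℝ := 1 / ((n : ℝ) + 1)
    set b : ℝ := (n : ℝ) + 1
    have ha : 0 < a := by positivity
    have hb : 0 < b := by positivity
    have hd : IntervalIntegrable (fun x => f x - g x) volume a b :=
      (hf a b ha hb).1.sub (hg a b ha hb).1
    have hne : ∀ᵐ x ∂(volume : Measure ℝ), x ≠ b := by simp [ae_iff]
    rw [ae_restrict_iff' measurableSet_Ioc]
    filter_upwards [hd.ae_hasDerivAt_integral, hne] with x hx hxb hxm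
    have hab : a ≤ b := hxm.1.le.trans hxm.2
    have hD := hx (by rw [uIcc_of_le hab]; exact ⟨hxm.1.le, hxm.2⟩) a left_mem_uIcc
    have hz : HasDerivAt (fun x => ∫ t in a..x, (f t - g t)) 0 x := by
      refine (hasDerivAt_const x (0 : ℂ)).congr_of_eventuallyEq ?_
      filter_upwards [Ioi_mem_nhds hxm.1] with y hy
      have hy0 : 0 < y := ha.trans hy
      rw [intervalIntegral.integral_sub (hf a y ha hy0).1 (hg a y ha hy0).1, (hf a y ha hy0).2,
        (hg a y ha hy0).2, sub_self]
    exact sub_eq_zero.1 (hD.unique hz)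
  rw [Filter.EventuallyEq, halfLine, ← iUnion_Ioc_inv_natCast, ae_restrict_iUnion_iff]
  exact key

lemma continuousOn (h : IsACDeriv F f) : ContinuousOn F (Ioi 0) := by
  intro x hx
  have hx0 : 0 < x := hx
  refine ContinuousAt.continuousWithinAt ?_
  have hab : x / 2 ≤ 2 * x := by linarith
  have h1 := intervalIntegral.continuousOn_primitive_interval'
    (h (x / 2) (2 * x) (by linarith) (by linarith)).1 left_mem_uIcc
  have h2 : ContinuousAt (fun y => ∫ t in (x / 2)..y, f t) x :=
    h1.continuousAt (by rw [uIcc_of_le hab]; exact Icc_mem_nhds (by linarith) (by linarith))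
  refine (h2.add (continuousAt_const (y := F (x / 2)))).congr ?_
  filter_upwards [Ioi_mem_nhds hx0] with y hy
  rw [Pi.add_apply, (h (x / 2) y (by linarith) hy).2]
  ring

/-- Integration by parts against a continuously differentiable real function. -/
lemma integral_mul (h : IsACDeriv F f) {a b : ℝ} (ha : 0 < a) (hab : a ≤ b) {p p' : ℝ → ℝ}
    (hp : ∀ x ∈ Icc a b, HasDerivAt p (p' x) x) (hp' : ContinuousOn p' (Icc a b)) :
    ∫ s in Ioc a b, (p s : ℂ) * f s
      = p b * F b - p a * F a - ∫ t in Ioc a b, (p' t : ℂ) * F t := by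
  have hfi := h.integrableOn ha hab
  have hpi : IntegrableOn p' (Ioc a b) := (hp'.integrableOn_Icc).mono_set Ioc_subset_Icc_self
  have hpsub : ∀ s ∈ Icc a b, ∫ t in Ioc a s, p' t = p s - p a := fun s hs => by
    rw [← intervalIntegral.integral_of_le hs.1]
    refine intervalIntegral.integral_eq_sub_of_hasDerivAt (fun x hx => ?_) ?_
    · rw [uIcc_of_le hs.1] at hx
      exact hp x ⟨hx.1, hx.2.trans hs.2⟩
    · exact (intervalIntegrable_iff_integrableOn_Ioc_of_le hs.1).2
        (hpi.mono_set (Ioc_subset_Ioc_right hs.2))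
  -- Fubini on the triangle t ≤ s, with p(s) - p(a) written as the integral of p' over (a, s].
  let γ : ℝ → ℝ → ℝ := fun t s => (Iic s).indicator p' t
  have hγm : AEStronglyMeasurable (Function.uncurry γ)
      ((volume.restrict (Ioc a b)).prod (volume.restrict (Ioc a b))) := by
    have h1 : AEStronglyMeasurable (fun q : ℝ × ℝ => p' q.1)
        ((volume.restrict (Ioc a b)).prod (volume.restrict (Ioc a b))) :=
      hpi.aestronglyMeasurable.comp_fst
    exact h1.indicator (measurableSet_le measurable_fst measurable_snd)
  have hγi : ∀ s, Integrable (fun t => γ t s) (volume.restrict (Ioc a b)) := fun s =>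
    hpi.indicator measurableSet_Iic
  have hγabs : ∀ s, ∫ t in Ioc a b, |γ t s| ≤ ∫ t in Ioc a b, |p' t| := fun s =>
    integral_mono_ae (hγi s).abs hpi.abs (Eventually.of_forall fun t => by
      simp only [γ, indicator]
      split_ifs
      · exact le_rfl
      · simp)
  have hint2 : Integrable (fun s => (∫ t in Ioc a b, |γ t s|) * ‖f s‖)
      (volume.restrict (Ioc a b)) := by
    refine (hfi.norm.const_mul (∫ t in Ioc a b, |p' t|)).mono' ?_ (Eventually.of_forall fun s => ?_)
    · exact hγm.norm.prod_swap.integral_prod_right'.mul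
        hfi.aestronglyMeasurable.norm
    · rw [Real.norm_of_nonneg (mul_nonneg (integral_nonneg fun _ => abs_nonneg _) (norm_nonneg _))]
      exact mul_le_mul_of_nonneg_right (hγabs s) (norm_nonneg _)
  obtain ⟨-, i2, e⟩ := integral_kernel_swap hγm hfi.aestronglyMeasurable
    (Eventually.of_forall hγi) hint2
  have hin : ∀ s ∈ Ioc a b, ∫ t in Ioc a b, γ t s = p s - p a := fun s hs => by
    simp only [γ]
    rw [setIntegral_indicator measurableSet_Iic, Ioc_inter_Iic, min_eq_right hs.2,
      hpsub s ⟨hs.1.le, hs.2⟩]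
  have hright : ∫ s in Ioc a b, ((∫ t in Ioc a b, γ t s : ℝ) : ℂ) * f s
      = (∫ s in Ioc a b, (p s : ℂ) * f s) - p a * (F b - F a) := by
    have hsum : ∫ s in Ioc a b, (p s : ℂ) * f s
        = ∫ s in Ioc a b, (((∫ t in Ioc a b, γ t s : ℝ) : ℂ) * f s + p a * f s) := by
      refine setIntegral_congr_fun measurableSet_Ioc fun s hs => ?_
      simp only [hin s hs]
      push_cast; ring
    rw [hsum, integral_add i2 (hfi.const_mul _), integral_const_mul, h.integral_Ioc ha hab]
    ring
  have hleft : ∫ t in Ioc a b, ∫ s in Ioc a b, (γ t s : ℂ) * f s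
      = (p b - p a) * F b - ∫ t in Ioc a b, (p' t : ℂ) * F t := by
    have hFi : IntegrableOn (fun t => (p' t : ℂ) * F t) (Ioc a b) := by
      have hc : ContinuousOn F (Icc a b) := h.continuousOn.mono fun x hx => ha.trans_le hx.1
      exact ((Complex.continuous_ofReal.comp_continuousOn hp').mul hc).integrableOn_Icc.mono_set
        Ioc_subset_Icc_self
    have e1 : ∫ t in Ioc a b, ∫ s in Ioc a b, (γ t s : ℂ) * f s
        = ∫ t in Ioc a b, ((p' t : ℂ) * F b - (p' t : ℂ) * F t) := by
      refine setIntegral_congr_fun measurableSet_Ioc fun t ht => ?_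
      have e2 : ∀ s, (γ t s : ℂ) * f s = (Ici t).indicator (fun s => (p' t : ℂ) * f s) s :=
        fun s => by
          by_cases hs : t ≤ s <;> simp [γ, indicator, hs]
      simp only [e2]
      rw [setIntegral_indicator measurableSet_Ici, setIntegral_congr_set
        (t := Ioc t b), integral_const_mul, h.integral_Ioc (ha.trans ht.1) ht.2, mul_sub]
      have : Ioc a b ∩ Ici t = Icc t b := by
        ext s; simp only [mem_inter_iff, mem_Ioc, mem_Ici, mem_Icc]
        exact ⟨fun hh => ⟨hh.2, hh.1.2⟩, fun hh => ⟨⟨ht.1.trans_le hh.1, hh.2⟩, hh.1⟩⟩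
      rw [this]
      exact Ioc_ae_eq_Icc.symm
    have hpF : IntegrableOn (fun t => (p' t : ℂ) * F b) (Ioc a b) :=
      (hpi.ofReal (𝕜 := ℂ)).mul_const _
    rw [e1, integral_sub hpF hFi, integral_mul_const, integral_complex_ofReal,
      hpsub b ⟨hab, le_rfl⟩]
    push_cast; ring
  rw [hleft, hright] at e
  linear_combination -e

end IsACDeriv

/-- Square integrable functions on the half-line are integrable on bounded intervals. -/
lemma MeasureTheory.MemLp.integrableOn_Ioo {f : ℝ → ℂ} (hf : MemLp f 2 halfLine) {a b : ℝ}
    (ha : 0 ≤ a) : IntegrableOn f (Ioo a b) := by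
  have hsub : Ioo a b ⊆ Ioi 0 := fun x hx => ha.trans_lt hx.1
  have h1 : MemLp f 2 (volume.restrict (Ioo a b)) :=
    hf.mono_measure (Measure.restrict_mono hsub le_rfl)
  exact h1.integrable (by norm_num)

lemma MeasureTheory.MemLp.integrableOn_div {f : ℝ → ℂ} (hf : MemLp f 2 halfLine) {a : ℝ}
    (ha : 0 < a) : IntegrableOn (fun t => ‖f t‖ / t) (Ioi a) := by
  have hsub : Ioi a ⊆ Ioi 0 := Ioi_subset_Ioi ha.le
  have h1 : IntegrableOn (fun t => 2 * (‖f t‖ / (a + t))) (Ioi a) :=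
    ((integrable_norm_div_add hf ha).const_mul 2).mono_measure (Measure.restrict_mono hsub le_rfl)
  have hm := hf.1.mono_measure (Measure.restrict_mono hsub le_rfl)
  refine h1.mono' (hm.norm.aemeasurable.div aemeasurable_id).aestronglyMeasurable ?_
  filter_upwards [ae_restrict_mem measurableSet_Ioi] with t ht
  have ht0 : 0 < t := ha.trans ht
  have hat : a < t := ht
  rw [Real.norm_of_nonneg (by positivity), mul_div_assoc', div_le_div_iff₀ ht0 (by positivity)]
  nlinarith [norm_nonneg (f t)]

/-! ### The inverse kernel L and the relations KL = LK = L - K. -/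

/-- The kernel `P'(x / t) / t` on `0 < t < x`. -/
def legendreKernelInv (P1 : ℝ → ℝ) (x t : ℝ) : ℝ := if 0 < t ∧ t < x then P1 (x / t) / t else 0

lemma legendreKernelInv_of_lt (P1 : ℝ → ℝ) {x t : ℝ} (ht : 0 < t) (htx : t < x) :
    legendreKernelInv P1 x t = P1 (x / t) / t := if_pos ⟨ht, htx⟩

lemma legendreKernelInv_of_le (P1 : ℝ → ℝ) {x t : ℝ} (htx : x ≤ t) :
    legendreKernelInv P1 x t = 0 :=
  if_neg fun h => htx.not_gt h.2

/-- Since P' has constant sign on (1, ∞), absolute integrals of the kernel of L are exact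
differences of values of P. Fubini thereby needs no more than absolute convergence of integrals with
P. -/
lemma abs_setIntegral_of_sign {g : ℝ → ℝ} {S : Set ℝ} (hS : MeasurableSet S)
    (h : (∀ y ∈ S, 0 ≤ g y) ∨ ∀ y ∈ S, g y ≤ 0) : ∫ y in S, |g y| = |∫ y in S, g y| := by
  rcases h with h | h
  · rw [abs_of_nonneg (setIntegral_nonneg hS h)]
    exact setIntegral_congr_fun hS fun y hy => abs_of_nonneg (h y hy)
  · rw [abs_of_nonpos (setIntegral_nonpos hS h), ← integral_neg]
    exact setIntegral_congr_fun hS fun y hy => abs_of_nonpos (h y hy)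

namespace IsLegendre

variable {ν : ℝ} {P P1 P2 : ℝ → ℝ}

lemma measurable_legendreKernelInv (h : IsLegendre ν P P1 P2) :
    Measurable fun p : ℝ × ℝ => legendreKernelInv P1 p.1 p.2 := by
  have hS : IsOpen {p : ℝ × ℝ | 0 < p.2 ∧ p.2 < p.1} :=
    (isOpen_lt continuous_const continuous_snd).inter (isOpen_lt continuous_snd continuous_fst)
  have hc : ContinuousOn (fun p : ℝ × ℝ => P1 (p.1 / p.2) / p.2)
      {p : ℝ × ℝ | 0 < p.2 ∧ p.2 < p.1} := by
    have h0 : ∀ p ∈ {p : ℝ × ℝ | 0 < p.2 ∧ p.2 < p.1}, p.2 ≠ 0 := fun p hp => hp.1.ne'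
    refine (h.continuousOn_deriv.comp (f := fun p : ℝ × ℝ => p.1 / p.2)
      (continuousOn_fst.div continuousOn_snd h0) fun p hp => ?_).div continuousOn_snd h0
    have : 0 < p.1 / p.2 := div_pos (hp.1.trans hp.2) hp.1
    simp only [mem_Ioi]; linarith
  exact hc.measurable_piecewise (g := fun _ => (0 : ℝ)) continuousOn_const hS.measurableSet

lemma hasDerivAt_comp_div (h : IsLegendre ν P P1 P2) {t x : ℝ} (ht : 0 < t) (hx : 0 < x) :
    HasDerivAt (fun y => P (y / t)) (P1 (x / t) / t) x := by
  have h1 : (-1 : ℝ) < x / t := by linarith [div_pos hx ht]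
  have := (h.hasDerivAt _ h1).comp x ((hasDerivAt_id x).div_const t)
  exact this.congr_deriv (by ring)

lemma hasDerivAt_comp_div' (h : IsLegendre ν P P1 P2) {t x : ℝ} (ht : 0 < t) (hx : 0 < x) :
    HasDerivAt (fun y => P (t / y)) (-(P1 (t / x) * t / x ^ 2)) x := by
  have h1 : (-1 : ℝ) < t / x := by linarith [div_pos ht hx]
  have := (h.hasDerivAt _ h1).comp x ((hasDerivAt_inv hx.ne').const_mul t)
  refine (this.congr_deriv ?_).congr_of_eventuallyEq (Eventually.of_forall fun y => ?_)
  · field_simp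
  · simp [div_eq_mul_inv]

lemma continuousOn_deriv_comp_div (h : IsLegendre ν P P1 P2) {t : ℝ} (ht : 0 < t) :
    ContinuousOn (fun y => P1 (y / t) / t) (Ioi 0) := by
  refine (h.continuousOn_deriv.comp (f := fun y => y / t)
    (continuousOn_id.div_const t) fun y hy => ?_).div_const t
  have : 0 < y / t := div_pos hy ht
  simp only [mem_Ioi]; linarith

lemma continuousOn_deriv_comp_div' (h : IsLegendre ν P P1 P2) {t : ℝ} (ht : 0 < t) :
    ContinuousOn (fun y => P1 (t / y) / y) (Ioi 0) := by
  have h0 : ∀ y ∈ Ioi (0 : ℝ), y ≠ 0 := fun y hy => ne_of_gt hy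
  refine (h.continuousOn_deriv.comp (f := fun y => t / y)
    (continuousOn_const.div continuousOn_id h0) fun y hy => ?_).div continuousOn_id h0
  have : 0 < t / y := div_pos ht hy
  simp only [mem_Ioi]; linarith

lemma integral_deriv_comp_div (h : IsLegendre ν P P1 P2) {t a b : ℝ} (ht : 0 < t) (ha : 0 < a)
    (hab : a ≤ b) : ∫ y in Ioc a b, P1 (y / t) / t = P (b / t) - P (a / t) := by
  rw [← intervalIntegral.integral_of_le hab]
  refine intervalIntegral.integral_eq_sub_of_hasDerivAt (f := fun y => P (y / t))
    (fun y hy => ?_) ?_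
  · rw [uIcc_of_le hab] at hy
    exact h.hasDerivAt_comp_div ht (ha.trans_le hy.1)
  · refine ContinuousOn.intervalIntegrable ((h.continuousOn_deriv_comp_div ht).mono ?_)
    rw [uIcc_of_le hab]
    exact fun y hy => ha.trans_le hy.1

/-- The majorant of the kernels of the compositions of the two Legendre kernels. -/
def majorant (P : ℝ → ℝ) (x t : ℝ) : ℝ := if 0 < t ∧ t < x then |P (x / t) - 1| / x else 0

lemma majorant_of_lt {x t : ℝ} (ht : 0 < t) (htx : t < x) :
    majorant P x t = |P (x / t) - 1| / x := if_pos ⟨ht, htx⟩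

lemma majorant_of_le {x t : ℝ} (htx : x ≤ t) : majorant P x t = 0 :=
  if_neg fun h => htx.not_gt h.2

lemma majorant_nonneg {x t : ℝ} (hx : 0 < x) : 0 ≤ majorant P x t := by
  unfold majorant
  split_ifs <;> positivity

/-- Common to both orders of composition: u is the product of the kernels, v its formula on (t, x),
and q the part of constant sign, with integral P(x/t) - 1; the other factor has its argument in [0,
1] and is bounded. -/
lemma integral_comp_kernel_of_bound {x t M r : ℝ} (ht : 0 < t) {u v q : ℝ → ℝ}
    (hu : ∀ y, t < y → y < x → u y = v y)
    (hu' : ∀ y, 0 < y → ¬ (t < y ∧ y < x) → u y = 0) (hv : ContinuousOn v (Icc t x))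
    (hi : t < x → ∫ y in t..x, v y = r) (hr : x ≤ t → r = 0)
    (hq : ContinuousOn q (Icc t x)) (hvq : ∀ y ∈ Ioo t x, |v y| ≤ M / x * |q y|)
    (hsign : (∀ y ∈ Ioo t x, 0 ≤ q y) ∨ ∀ y ∈ Ioo t x, q y ≤ 0)
    (hqi : t < x → ∫ y in t..x, q y = P (x / t) - 1) :
    Integrable u halfLine ∧ ∫ y, u y ∂halfLine = r ∧
      ∫ y, |u y| ∂halfLine ≤ M * majorant P x t := by
  have hvi : IntegrableOn v (Ioo t x) := hv.integrableOn_Icc.mono_set Ioo_subset_Icc_self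
  refine ⟨?_, ?_, ?_⟩
  · have h1 : Integrable ((Ioo t x).indicator v) halfLine :=
      ((integrable_indicator_iff measurableSet_Ioo).2 hvi).restrict
    refine h1.congr ?_
    filter_upwards [ae_halfLine_pos] with y hy
    by_cases hm : t < y ∧ y < x
    · rw [indicator_of_mem (show y ∈ Ioo t x from hm), hu y hm.1 hm.2]
    · rw [indicator_of_notMem (show y ∉ Ioo t x from hm), hu' y hy hm]
  · rw [integral_halfLine_Ioo ht.le hu hu']
    rcases lt_or_ge t x with htx | htx
    · rw [← hi htx, intervalIntegral.integral_of_le htx.le, integral_Ioc_eq_integral_Ioo]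
    · rw [hr htx, Ioo_eq_empty htx.not_gt, setIntegral_empty]
  · rw [integral_halfLine_Ioo (G := fun y => |v y|) ht.le (fun y h1 h2 => by rw [hu y h1 h2])
      (fun y h1 h2 => by rw [hu' y h1 h2, abs_zero])]
    rcases lt_or_ge t x with htx | htx
    · have hqI : IntegrableOn q (Ioo t x) := hq.integrableOn_Icc.mono_set Ioo_subset_Icc_self
      calc ∫ y in Ioo t x, |v y| ≤ ∫ y in Ioo t x, M / x * |q y| :=
            setIntegral_mono_on hvi.abs (hqI.abs.const_mul _) measurableSet_Ioo hvq
        _ = M * majorant P x t := by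
          rw [integral_const_mul, abs_setIntegral_of_sign measurableSet_Ioo hsign,
            ← integral_Ioc_eq_integral_Ioo, ← intervalIntegral.integral_of_le htx.le, hqi htx,
            majorant_of_lt ht htx]
          ring
    · rw [Ioo_eq_empty htx.not_gt, setIntegral_empty, majorant_of_le htx, mul_zero]

/-- The kernels of the compositions of the two Legendre kernels. -/
lemma exists_comp_kernel (h : IsLegendre ν P P1 P2) : ∃ M, 0 ≤ M ∧ ∀ x t, 0 < x → 0 < t →
    (Integrable (fun y => legendreKernel P1 x y * legendreKernelInv P1 y t) halfLine ∧
      ∫ y, legendreKernel P1 x y * legendreKernelInv P1 y t ∂halfLine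
        = legendreKernelInv P1 x t - legendreKernel P1 x t ∧
      ∫ y, |legendreKernel P1 x y * legendreKernelInv P1 y t| ∂halfLine ≤ M * majorant P x t) ∧
    (Integrable (fun y => legendreKernelInv P1 x y * legendreKernel P1 y t) halfLine ∧
      ∫ y, legendreKernelInv P1 x y * legendreKernel P1 y t ∂halfLine
        = legendreKernelInv P1 x t - legendreKernel P1 x t ∧
      ∫ y, |legendreKernelInv P1 x y * legendreKernel P1 y t| ∂halfLine ≤ M * majorant P x t) := by
  obtain ⟨M, hM0, -, hM⟩ := h.exists_bound 1
  refine ⟨M, hM0, fun x t hx ht => ?_⟩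
  have hsub : Icc t x ⊆ Ioi 0 := fun y hy => ht.trans_le hy.1
  have hr : x ≤ t → legendreKernelInv P1 x t - legendreKernel P1 x t = 0 := fun hxt => by
    rw [legendreKernelInv_of_le _ hxt, legendreKernel_of_le _ hxt, sub_zero]
  have hi : t < x → P1 (x / t) / t - P1 (t / x) / x
      = legendreKernelInv P1 x t - legendreKernel P1 x t := fun htx => by
    rw [legendreKernelInv_of_lt _ ht htx, legendreKernel_of_lt _ ht htx]
  have hz : ∀ y, 0 < y → ¬ (t < y ∧ y < x) → x ≤ y ∨ y ≤ t := fun y _ hy => by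
    by_contra! hh; exact hy ⟨hh.2, hh.1⟩
  have hP1 : P (t / t) = 1 := by rw [div_self ht.ne', h.map_one]
  have hPx : P (x / x) = 1 := by rw [div_self hx.ne', h.map_one]
  constructor
  · refine integral_comp_kernel_of_bound ht (v := fun y => P1 (y / x) / x * (P1 (y / t) / t))
      (q := fun y => P1 (y / t) / t) (fun y h1 h2 => ?_) (fun y h0 h1 => ?_)
      (((h.continuousOn_deriv_comp_div hx).mul (h.continuousOn_deriv_comp_div ht)).mono hsub)
      (fun htx => (h.integral_kernel_comp ht htx).trans (hi htx)) hr
      ((h.continuousOn_deriv_comp_div ht).mono hsub) (fun y hy => ?_) ?_ (fun htx => ?_)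
    · rw [legendreKernel_of_lt _ (ht.trans h1) h2, legendreKernelInv_of_lt _ ht h1]
    · rcases hz y h0 h1 with h2 | h2
      · rw [legendreKernel_of_le _ h2, zero_mul]
      · rw [legendreKernelInv_of_le _ h2, mul_zero]
    · have hy0 : 0 < y := ht.trans hy.1
      rw [abs_mul, abs_div (P1 (y / x)), abs_of_pos hx]
      have := hM (y / x) ⟨by positivity, (div_le_one hx).2 hy.2.le⟩
      gcongr
    · rcases h.deriv_const_sign with hs | hs
      · exact Or.inl fun y hy => div_nonneg (hs _ ((one_lt_div ht).2 hy.1)) ht.le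
      · exact Or.inr fun y hy =>
          div_nonpos_of_nonpos_of_nonneg (hs _ ((one_lt_div ht).2 hy.1)) ht.le
    · rw [intervalIntegral.integral_of_le htx.le, h.integral_deriv_comp_div ht ht htx.le, hP1]
  -- Here q is minus the y-derivative of P(x/y), and y < x turns the factor 1/y into the bound M/x.
  · refine integral_comp_kernel_of_bound ht (v := fun y => P1 (x / y) / y * (P1 (t / y) / y))
      (q := fun y => P1 (x / y) * x / y ^ 2) (fun y h1 h2 => ?_) (fun y h0 h1 => ?_)
      (((h.continuousOn_deriv_comp_div' hx).mul (h.continuousOn_deriv_comp_div' ht)).mono hsub)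
      (fun htx => (h.integral_kernel_comp' ht htx).trans (hi htx)) hr ?_ (fun y hy => ?_) ?_
      (fun htx => ?_)
    · rw [legendreKernel_of_lt _ ht h1, legendreKernelInv_of_lt _ (ht.trans h1) h2]
    · rcases hz y h0 h1 with h2 | h2
      · rw [legendreKernelInv_of_le _ h2, zero_mul]
      · rw [legendreKernel_of_le _ h2, mul_zero]
    · have : ContinuousOn (fun y => P1 (x / y) / y * (x / y)) (Icc t x) :=
        ((h.continuousOn_deriv_comp_div' hx).mono hsub).mul
          (continuousOn_const.div continuousOn_id fun y hy => (ht.trans_le hy.1).ne')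
      exact this.congr fun y hy => by ring
    · have hy0 : 0 < y := ht.trans hy.1
      have := hM (t / y) ⟨by positivity, (div_le_one hy0).2 hy.1.le⟩
      rw [abs_mul, abs_div, abs_div, abs_div (P1 (x / y) * x), abs_mul, abs_of_pos hx,
        abs_of_pos hy0, abs_of_pos (pow_pos hy0 2)]
      have e : M / x * (|P1 (x / y)| * x / y ^ 2) = |P1 (x / y)| / y * (M / y) := by
        field_simp
      rw [e]
      gcongr
    · rcases h.deriv_const_sign with hs | hs
      · exact Or.inl fun y hy => div_nonneg
          (mul_nonneg (hs _ ((one_lt_div (ht.trans hy.1)).2 hy.2)) hx.le) (sq_nonneg y)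
      · exact Or.inr fun y hy => div_nonpos_of_nonpos_of_nonneg (mul_nonpos_of_nonpos_of_nonneg
          (hs _ ((one_lt_div (ht.trans hy.1)).2 hy.2)) hx.le) (sq_nonneg y)
    · have hc : ContinuousOn (fun y => -(P1 (x / y) * x / y ^ 2)) (uIcc t x) := by
        rw [uIcc_of_le htx.le]
        have : ContinuousOn (fun y => -(P1 (x / y) / y * (x / y))) (Icc t x) :=
          (((h.continuousOn_deriv_comp_div' hx).mono hsub).mul
            (continuousOn_const.div continuousOn_id fun y hy => (ht.trans_le hy.1).ne')).neg
        exact this.congr fun y hy => by ring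
      have := intervalIntegral.integral_eq_sub_of_hasDerivAt (f := fun y => P (x / y))
        (fun y hy => by
          rw [uIcc_of_le htx.le] at hy
          exact h.hasDerivAt_comp_div' hx (ht.trans_le hy.1)) hc.intervalIntegrable
      rw [intervalIntegral.integral_neg, hPx] at this
      linarith

end IsLegendre

/-- The composition of two kernels, applied to a function. -/
lemma kernelInt_comp {u v : ℝ → ℝ → ℝ} (hu : Measurable fun p : ℝ × ℝ => u p.1 p.2)
    (hv : Measurable fun p : ℝ × ℝ => v p.1 p.2) {f : ℝ → ℂ} (hf : AEStronglyMeasurable f halfLine)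
    {x : ℝ} {l k : ℝ → ℝ → ℝ} {D : ℝ → ℝ}
    (h : ∀ t, 0 < t → Integrable (fun y => u x y * v y t) halfLine ∧
      ∫ y, u x y * v y t ∂halfLine = l x t - k x t ∧ ∫ y, |u x y * v y t| ∂halfLine ≤ D t)
    (hD : Integrable (fun t => D t * ‖f t‖) halfLine)
    (hk : Integrable (fun t => (k x t : ℂ) * f t) halfLine) :
    kernelInt u (kernelInt v f) x = kernelInt l f x - kernelInt k f x := by
  have hγ : AEStronglyMeasurable (Function.uncurry fun y t => u x y * v y t)
      (halfLine.prod halfLine) :=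
    ((hu.comp (measurable_const.prodMk measurable_fst)).mul hv).aestronglyMeasurable
  obtain ⟨-, hi, e⟩ := integral_kernel_swap hγ hf
    (by filter_upwards [ae_halfLine_pos] with t ht using (h t ht).1) (by
      refine hD.mono' ?_ ?_
      · exact hγ.norm.prod_swap.integral_prod_right'.mul hf.norm
      · filter_upwards [ae_halfLine_pos] with t ht
        rw [Real.norm_of_nonneg
          (mul_nonneg (integral_nonneg fun _ => abs_nonneg _) (norm_nonneg _))]
        exact mul_le_mul_of_nonneg_right (h t ht).2.2 (norm_nonneg _))
  have e1 : kernelInt u (kernelInt v f) x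
      = ∫ y, ∫ t, ((u x y * v y t : ℝ) : ℂ) * f t ∂halfLine ∂halfLine := by
    refine integral_congr_ae (Eventually.of_forall fun y => ?_)
    simp only [kernelInt]
    rw [← integral_const_mul]
    refine integral_congr_ae (Eventually.of_forall fun t => ?_)
    push_cast
    ring
  have hsub : ∀ᵐ t ∂halfLine, ((∫ y, u x y * v y t ∂halfLine : ℝ) : ℂ) * f t + (k x t : ℂ) * f t
      = (l x t : ℂ) * f t := by
    filter_upwards [ae_halfLine_pos] with t ht
    rw [(h t ht).2.1]
    push_cast
    ring
  rw [e1, e, eq_sub_iff_add_eq, kernelInt, kernelInt, ← integral_add hi hk]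
  exact integral_congr_ae hsub

lemma integrable_indicator_halfLine {E : Type*} [NormedAddCommGroup E] {S : Set ℝ} {F : ℝ → E}
    (hS : MeasurableSet S) (hF : IntegrableOn F S) : Integrable (S.indicator F) halfLine :=
  ((integrable_indicator_iff hS).2 hF).restrict

lemma integral_indicator_halfLine {E : Type*} [NormedAddCommGroup E] [NormedSpace ℝ E] {S : Set ℝ}
    {F : ℝ → E} (hS : MeasurableSet S) (h : S ⊆ Ioi 0) :
    ∫ t, S.indicator F t ∂halfLine = ∫ t in S, F t := by
  rw [integral_indicator hS, halfLine, Measure.restrict_restrict hS, inter_eq_left.2 h]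

/-! ### Differentiation of the integrals that define ₁S₋ and ₁S₀₊. -/

namespace IsLegendre

variable {ν : ℝ} {P P1 P2 : ℝ → ℝ}

lemma integrableOn_deriv_comp_div (h : IsLegendre ν P P1 P2) {t a b : ℝ} (ht : 0 < t)
    (ha : 0 < a) : IntegrableOn (fun x => P1 (x / t) / t) (Ioc a b) :=
  ((h.continuousOn_deriv_comp_div ht).mono fun _ hx =>
    ha.trans_le hx.1).integrableOn_Icc.mono_set Ioc_subset_Icc_self

/-- The kernel is the derivative of P(x/t) in x, cut off at x = t. Its integral is the increment of
P(x/t), and the cut-off leaves P(1) = 1, the source of the identity in 1 - K*. -/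
lemma integral_legendreKernel_left (h : IsLegendre ν P P1 P2) {t a b : ℝ} (ht : 0 < t)
    (ha : 0 < a) (hab : a ≤ b) : ∫ x in Ioc a b, legendreKernel P1 t x
      = (Ioi b).indicator (fun t => P (b / t)) t + (Ioc a b).indicator 1 t
        - (Ioi a).indicator (fun t => P (a / t)) t := by
  have hP1 : P (t / t) = 1 := by rw [div_self ht.ne', h.map_one]
  rcases le_or_gt t a with hta | hta
  · rw [indicator_of_notMem (by simpa using hta.trans hab),
      indicator_of_notMem (by simp [hta.not_gt]), indicator_of_notMem (by simpa using hta),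
      setIntegral_congr_fun measurableSet_Ioc fun x hx =>
        legendreKernel_of_le P1 (hta.trans hx.1.le)]
    simp
  rcases le_or_gt t b with htb | htb
  · rw [indicator_of_notMem (by simpa using htb), indicator_of_mem (show t ∈ Ioc a b from ⟨hta, htb⟩),
      indicator_of_mem (show t ∈ Ioi a from hta), setIntegral_eq_of_subset_of_forall_sdiff_eq_zero
        (s := Ioo a t) measurableSet_Ioc (fun x hx => ⟨hx.1, hx.2.le.trans htb⟩)
        (fun x hx => legendreKernel_of_le P1 (not_lt.1 fun h' => hx.2 ⟨hx.1.1, h'⟩)),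
      setIntegral_congr_fun measurableSet_Ioo fun x hx =>
        legendreKernel_of_lt P1 (ha.trans hx.1) hx.2, ← integral_Ioc_eq_integral_Ioo,
      h.integral_deriv_comp_div ht ha hta.le, hP1]
    simp
  · rw [indicator_of_mem (show t ∈ Ioi b from htb),
      indicator_of_notMem (by simp [htb]), indicator_of_mem (show t ∈ Ioi a from hta),
      setIntegral_congr_fun measurableSet_Ioc fun x hx =>
        legendreKernel_of_lt P1 (ha.trans hx.1) (hx.2.trans_lt htb),
      h.integral_deriv_comp_div ht ha hab]
    simp

lemma integral_legendreKernelInv_left (h : IsLegendre ν P P1 P2) {t a b : ℝ} (ht : 0 < t)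
    (ha : 0 < a) (hab : a ≤ b) : ∫ x in Ioc a b, legendreKernelInv P1 x t
      = (Ioo 0 b).indicator (fun t => P (b / t)) t - (Ico a b).indicator 1 t
        - (Ioo 0 a).indicator (fun t => P (a / t)) t := by
  have hP1 : P (t / t) = 1 := by rw [div_self ht.ne', h.map_one]
  rcases le_or_gt b t with htb | htb
  · rw [indicator_of_notMem (by simp [htb]), indicator_of_notMem (by simp [htb]),
      indicator_of_notMem (by simp [hab.trans htb]),
      setIntegral_congr_fun measurableSet_Ioc fun x hx =>
        legendreKernelInv_of_le P1 (hx.2.trans htb)]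
    simp
  rcases le_or_gt a t with hta | hta
  · rw [indicator_of_mem (show t ∈ Ioo 0 b from ⟨ht, htb⟩),
      indicator_of_mem (show t ∈ Ico a b from ⟨hta, htb⟩), indicator_of_notMem (by simp [hta]),
      setIntegral_eq_of_subset_of_forall_sdiff_eq_zero
        (s := Ioc t b) measurableSet_Ioc (fun x hx => ⟨hta.trans_lt hx.1, hx.2⟩)
        (fun x hx => legendreKernelInv_of_le P1 (not_lt.1 fun h' => hx.2 ⟨h', hx.1.2⟩)),
      setIntegral_congr_fun measurableSet_Ioc fun x hx =>
        legendreKernelInv_of_lt P1 ht hx.1,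
      h.integral_deriv_comp_div ht ht htb.le, hP1]
    simp
  · rw [indicator_of_mem (show t ∈ Ioo 0 b from ⟨ht, htb⟩),
      indicator_of_notMem (by simp [hta]), indicator_of_mem (show t ∈ Ioo 0 a from ⟨ht, hta⟩),
      setIntegral_congr_fun measurableSet_Ioc fun x hx =>
        legendreKernelInv_of_lt P1 ht (hta.trans hx.1),
      h.integral_deriv_comp_div ht ha hab]
    simp

/-- Differentiation under the integral sign, in integrated form: Fubini over (a, b] and the previous
integrals of the kernel. -/
lemma isACDeriv_integral_Ioi (h : IsLegendre ν P P1 P2) {f : ℝ → ℂ} (hf : MemLp f 2 halfLine)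
    (hi : ∀ x, 0 < x → IntegrableOn (fun t => (P (x / t) : ℂ) * f t) (Ioi x)) :
    IsACDeriv (fun x => -∫ t in Ioi x, (P (x / t) : ℂ) * f t)
      (fun x => f x - kernelInt (fun x t => legendreKernel P1 t x) f x) := by
  obtain ⟨M, hk⟩ := h.exists_isCarleman
  refine IsACDeriv.of_le fun a b ha hab => ?_
  have hb : 0 < b := ha.trans_le hab
  have hγ : Measurable (Function.uncurry fun x t => legendreKernel P1 t x) :=
    hk.measurable.comp measurable_swap
  have hbd : ∀ t, 0 < t → ∀ x ∈ Ioc a b, ‖legendreKernel P1 t x‖ ≤ M / (a + t) := fun t ht x hx => by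
    refine (hk.bound t x ht (ha.trans hx.1)).trans ?_
    exact div_le_div_of_nonneg_left hk.nonneg (by positivity) (by linarith [hx.1])
  have h1 : ∀ t, 0 < t → IntegrableOn (fun x => legendreKernel P1 t x) (Ioc a b) := fun t ht =>
    Integrable.mono' (integrable_const (M / (a + t))) (hk.measurable_right t).aestronglyMeasurable
      (by filter_upwards [ae_restrict_mem measurableSet_Ioc] with x hx using hbd t ht x hx)
  have h2 : Integrable (fun t => (∫ x in Ioc a b, |legendreKernel P1 t x|) * ‖f t‖) halfLine := by
    refine ((integrable_norm_div_add hf ha).const_mul (M * (b - a))).mono' ?_ ?_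
    · exact (hγ.norm.comp measurable_swap).stronglyMeasurable.integral_prod_right'.aestronglyMeasurable.mul
        hf.1.norm
    · filter_upwards [ae_halfLine_pos] with t ht
      rw [Real.norm_of_nonneg (mul_nonneg (integral_nonneg fun _ => abs_nonneg _) (norm_nonneg _))]
      have e : ∫ x in Ioc a b, |legendreKernel P1 t x| ≤ M / (a + t) * (b - a) := by
        have := setIntegral_mono_on (h1 t ht).abs (integrableOn_const (C := M / (a + t))
          (by simp)) measurableSet_Ioc (hbd t ht)
        refine this.trans_eq ?_
        rw [setIntegral_const, smul_eq_mul, Real.volume_real_Ioc_of_le hab, mul_comm]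
      calc _ ≤ M / (a + t) * (b - a) * ‖f t‖ := by gcongr
        _ = _ := by ring
  obtain ⟨i1, -, e⟩ := integral_kernel_swap (μ₁ := volume.restrict (Ioc a b))
    hγ.aestronglyMeasurable hf.1
    (by filter_upwards [ae_halfLine_pos] with t ht using h1 t ht) h2
  have hfi : IntegrableOn f (Ioc a b) :=
    (integrableOn_Ioc_iff_integrableOn_Ioo).2 (hf.integrableOn_Ioo ha.le)
  refine ⟨hfi.sub i1, ?_⟩
  have e2 : ∫ t, ((∫ x in Ioc a b, legendreKernel P1 t x : ℝ) : ℂ) * f t ∂halfLine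
      = ∫ t, ((Ioi b).indicator (fun t => (P (b / t) : ℂ) * f t) t + (Ioc a b).indicator f t
        - (Ioi a).indicator (fun t => (P (a / t) : ℂ) * f t) t) ∂halfLine := by
    refine integral_congr_ae ?_
    filter_upwards [ae_halfLine_pos] with t ht
    rw [h.integral_legendreKernel_left ht ha hab]
    simp only [indicator]
    split_ifs <;> push_cast [Pi.one_apply] <;> ring
  have j1 := integrable_indicator_halfLine measurableSet_Ioi (hi b hb)
  have j2 := integrable_indicator_halfLine measurableSet_Ioc hfi
  have j3 := integrable_indicator_halfLine measurableSet_Ioi (hi a ha)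
  have j12 : Integrable (fun t => (Ioi b).indicator (fun t => (P (b / t) : ℂ) * f t) t
      + (Ioc a b).indicator f t) halfLine := j1.add j2
  have e' : ∫ x in Ioc a b, kernelInt (fun x t => legendreKernel P1 t x) f x = _ := e
  rw [show ∫ x in Ioc a b, (f x - kernelInt (fun x t => legendreKernel P1 t x) f x) = _ from
      integral_sub hfi i1, e', e2, integral_sub j12 j3, integral_add j1 j2,
    integral_indicator_halfLine measurableSet_Ioi (Ioi_subset_Ioi hb.le),
    integral_indicator_halfLine measurableSet_Ioi (Ioi_subset_Ioi ha.le),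
    integral_indicator_halfLine measurableSet_Ioc fun x hx => ha.trans hx.1]
  ring

/-- Nothing dominates the kernel of L in general. As it has constant sign, its absolute integral
over (a, b] is a combination of P(b/t), P(a/t) and 1, and f times these is integrable by hypothesis.
-/
lemma isACDeriv_integral_Ioo (h : IsLegendre ν P P1 P2) {f : ℝ → ℂ} (hf : MemLp f 2 halfLine)
    (hi : ∀ x, 0 < x → IntegrableOn (fun t => (P (x / t) : ℂ) * f t) (Ioo 0 x)) :
    IsACDeriv (fun x => ∫ t in Ioo 0 x, (P (x / t) : ℂ) * f t)
      (fun x => f x + kernelInt (legendreKernelInv P1) f x) := by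
  refine IsACDeriv.of_le fun a b ha hab => ?_
  have hb : 0 < b := ha.trans_le hab
  have hγ : Measurable (Function.uncurry (legendreKernelInv P1)) := h.measurable_legendreKernelInv
  have hfi : IntegrableOn f (Ioc a b) :=
    (integrableOn_Ioc_iff_integrableOn_Ioo).2 (hf.integrableOn_Ioo ha.le)
  have hfi' : IntegrableOn f (Ico a b) :=
    (integrableOn_Ico_iff_integrableOn_Ioo).2 (hf.integrableOn_Ioo ha.le)
  have h1 : ∀ t, 0 < t → IntegrableOn (fun x => legendreKernelInv P1 x t) (Ioc a b) := by
    intro t ht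
    have := (h.integrableOn_deriv_comp_div (b := b) ht ha).indicator (measurableSet_Ioi (a := t))
    refine this.congr (Eventually.of_forall fun x => ?_)
    dsimp only
    by_cases hx : t < x
    · rw [indicator_of_mem (show x ∈ Ioi t from hx), legendreKernelInv_of_lt _ ht hx]
    · rw [indicator_of_notMem (by simpa using hx), legendreKernelInv_of_le _ (not_lt.1 hx)]
  have hsign : ∀ t, 0 < t → ∫ x in Ioc a b, |legendreKernelInv P1 x t|
      = |∫ x in Ioc a b, legendreKernelInv P1 x t| := fun t ht => by
    refine abs_setIntegral_of_sign measurableSet_Ioc ?_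
    rcases h.deriv_const_sign with hs | hs
    · refine Or.inl fun x _ => ?_
      unfold legendreKernelInv
      split_ifs with hx
      · exact div_nonneg (hs _ ((one_lt_div ht).2 hx.2)) ht.le
      · exact le_rfl
    · refine Or.inr fun x _ => ?_
      unfold legendreKernelInv
      split_ifs with hx
      · exact div_nonpos_of_nonpos_of_nonneg (hs _ ((one_lt_div ht).2 hx.2)) ht.le
      · exact le_rfl
  have j1 := integrable_indicator_halfLine measurableSet_Ioo (hi b hb)
  have j2 := integrable_indicator_halfLine measurableSet_Ico hfi'
  have j3 := integrable_indicator_halfLine measurableSet_Ioo (hi a ha)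
  have hw : ∀ t, 0 < t → ((∫ x in Ioc a b, legendreKernelInv P1 x t : ℝ) : ℂ) * f t
      = (Ioo 0 b).indicator (fun t => (P (b / t) : ℂ) * f t) t - (Ico a b).indicator f t
        - (Ioo 0 a).indicator (fun t => (P (a / t) : ℂ) * f t) t := fun t ht => by
    rw [h.integral_legendreKernelInv_left ht ha hab]
    simp only [indicator]
    split_ifs <;> push_cast [Pi.one_apply] <;> ring
  have h2 : Integrable (fun t => (∫ x in Ioc a b, |legendreKernelInv P1 x t|) * ‖f t‖) halfLine := by
    refine ((j1.sub j2).sub j3).norm.congr ?_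
    filter_upwards [ae_halfLine_pos] with t ht
    rw [hsign t ht, Pi.sub_apply, Pi.sub_apply, ← hw t ht, norm_mul, Complex.norm_real,
      Real.norm_eq_abs]
  obtain ⟨i1, -, e⟩ := integral_kernel_swap (μ₁ := volume.restrict (Ioc a b))
    hγ.aestronglyMeasurable hf.1
    (by filter_upwards [ae_halfLine_pos] with t ht using h1 t ht) h2
  refine ⟨hfi.add i1, ?_⟩
  have j12 : Integrable (fun t => (Ioo 0 b).indicator (fun t => (P (b / t) : ℂ) * f t) t
      - (Ico a b).indicator f t) halfLine := j1.sub j2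
  have e' : ∫ x in Ioc a b, kernelInt (legendreKernelInv P1) f x = _ := e
  rw [show ∫ x in Ioc a b, (f x + kernelInt (legendreKernelInv P1) f x) = _ from
      integral_add hfi i1, e',
    integral_congr_ae (show _ =ᵐ[halfLine] _ by
      filter_upwards [ae_halfLine_pos] with t ht using hw t ht),
    integral_sub j12 j3, integral_sub j1 j2,
    integral_indicator_halfLine measurableSet_Ioo fun x hx => hx.1,
    integral_indicator_halfLine measurableSet_Ioo fun x hx => hx.1,
    integral_indicator_halfLine measurableSet_Ico fun x hx => ha.trans_le hx.1,
    integral_Ico_eq_integral_Ioo, integral_Ioc_eq_integral_Ioo]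
  ring

end IsLegendre

/-! ### The operators ₁S₋ and ₁S₀₊ against 1 - K* and 1 - K. -/

lemma kernelInt_sub {k : ℝ → ℝ → ℝ} {f g : ℝ → ℂ} {x : ℝ}
    (hf : Integrable (fun t => (k x t : ℂ) * f t) halfLine)
    (hg : Integrable (fun t => (k x t : ℂ) * g t) halfLine) :
    kernelInt k (fun t => f t - g t) x = kernelInt k f x - kernelInt k g x := by
  simp only [kernelInt, mul_sub]
  exact integral_sub hf hg

lemma coeFn_sub_kernelOp {k : ℝ → ℝ → ℝ} {M : ℝ} (hk : IsCarleman k M) (f : HalfLineL2) :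
    ⇑(f - kernelOp hk f) =ᵐ[halfLine] fun x => f x - kernelInt k f x := by
  filter_upwards [Lp.coeFn_sub f (kernelOp hk f), coeFn_kernelOp hk f] with x h1 h2
  rw [h1, Pi.sub_apply, h2]

lemma integrable_mul_of_bounded_Ioo {q : ℝ → ℝ} {f : ℝ → ℂ} {a x C : ℝ} (ha : 0 ≤ a)
    (hq : AEStronglyMeasurable q (volume.restrict (Ioo a x))) (hC : ∀ t ∈ Ioo a x, |q t| ≤ C)
    (hf : MemLp f 2 halfLine) : IntegrableOn (fun t => (q t : ℂ) * f t) (Ioo a x) := by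
  refine (hf.integrableOn_Ioo ha).bdd_mul (c := C)
    (Complex.continuous_ofReal.comp_aestronglyMeasurable hq) ?_
  filter_upwards [ae_restrict_mem measurableSet_Ioo] with t ht
  rw [Complex.norm_real]
  exact hC t ht

namespace IsLegendre

variable {ν : ℝ} {P P1 P2 : ℝ → ℝ} {M : ℝ}

lemma continuousOn_comp_div (h : IsLegendre ν P P1 P2) {t : ℝ} (ht : 0 < t) :
    ContinuousOn (fun y => P (y / t)) (Ioi 0) := fun _ hy =>
  (h.hasDerivAt_comp_div ht hy).continuousAt.continuousWithinAt

lemma continuousOn_comp_div' (h : IsLegendre ν P P1 P2) {t : ℝ} (ht : 0 < t) :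
    ContinuousOn (fun y => P (t / y)) (Ioi 0) := fun _ hy =>
  (h.hasDerivAt_comp_div' ht hy).continuousAt.continuousWithinAt

/-- The convergence required in the domain of ₁S₀₊ is what justifies Fubini for the product KL. -/
lemma integrable_majorant_mul {f : ℝ → ℂ} {x : ℝ}
    (hf : MemLp f 2 halfLine) (hi : IntegrableOn (fun t => (P (x / t) : ℂ) * f t) (Ioo 0 x)) :
    Integrable (fun t => majorant P x t * ‖f t‖) halfLine := by
  have h1 : IntegrableOn (fun t => ‖(P (x / t) : ℂ) * f t - f t‖ / x) (Ioo 0 x) :=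
    (hi.sub (hf.integrableOn_Ioo le_rfl)).norm.div_const x
  refine (integrable_indicator_halfLine measurableSet_Ioo h1).congr ?_
  filter_upwards [ae_halfLine_pos] with t ht
  by_cases htx : t < x
  · rw [indicator_of_mem (show t ∈ Ioo 0 x from ⟨ht, htx⟩), majorant_of_lt ht htx,
      div_mul_eq_mul_div, ← Real.norm_eq_abs, ← Complex.norm_real, ← norm_mul]
    push_cast
    rw [sub_mul, one_mul]
  · rw [indicator_of_notMem (fun hh => htx hh.2), majorant_of_le (not_lt.1 htx), zero_mul]

lemma integrableOn_comp_div_mul_of_support (h : IsLegendre ν P P1 P2) {f : ℝ → ℂ} {a x : ℝ}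
    (ha : 0 < a) (hx : 0 < x) (hf : MemLp f 2 halfLine) (hsupp : ∀ᵐ t ∂halfLine, t ≤ a → f t = 0) :
    IntegrableOn (fun t => (P (x / t) : ℂ) * f t) (Ioo 0 x) := by
  have hc : ContinuousOn (fun t => P (x / t)) (Icc a x) :=
    (h.continuousOn_comp_div' hx).mono fun t ht => ha.trans_le ht.1
  obtain ⟨C, hC⟩ := isCompact_Icc.exists_bound_of_continuousOn hc
  have h1 : IntegrableOn (fun t => (P (x / t) : ℂ) * f t) (Ioo a x) :=
    integrable_mul_of_bounded_Ioo ha.le ((hc.mono Ioo_subset_Icc_self).aestronglyMeasurable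
      measurableSet_Ioo) (fun t ht => hC t (Ioo_subset_Icc_self ht)) hf
  refine ((integrable_indicator_iff measurableSet_Ioo).2 h1).restrict.congr ?_
  filter_upwards [ae_restrict_of_ae_restrict_of_subset (show Ioo 0 x ⊆ Ioi 0 from fun t ht => ht.1)
    hsupp, ae_restrict_mem measurableSet_Ioo] with t ht hm
  by_cases hta : a < t
  · rw [indicator_of_mem (show t ∈ Ioo a x from ⟨hta, hm.2⟩)]
  · rw [indicator_of_notMem (fun hh => hta hh.1), ht (not_lt.1 hta), mul_zero]

lemma integrable_legendreKernelInv_mul_of_support (h : IsLegendre ν P P1 P2) {f : ℝ → ℂ} {a x : ℝ}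
    (ha : 0 < a) (hx : 0 < x) (hf : MemLp f 2 halfLine) (hsupp : ∀ᵐ t ∂halfLine, t ≤ a → f t = 0) :
    Integrable (fun t => (legendreKernelInv P1 x t : ℂ) * f t) halfLine := by
  have hc : ContinuousOn (fun t => P1 (x / t) / t) (Icc a x) :=
    (h.continuousOn_deriv_comp_div' hx).mono fun t ht => ha.trans_le ht.1
  obtain ⟨C, hC⟩ := isCompact_Icc.exists_bound_of_continuousOn hc
  have h1 : IntegrableOn (fun t => ((P1 (x / t) / t : ℝ) : ℂ) * f t) (Ioo a x) :=
    integrable_mul_of_bounded_Ioo ha.le ((hc.mono Ioo_subset_Icc_self).aestronglyMeasurable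
      measurableSet_Ioo) (fun t ht => hC t (Ioo_subset_Icc_self ht)) hf
  refine (integrable_indicator_halfLine measurableSet_Ioo h1).congr ?_
  filter_upwards [hsupp, ae_halfLine_pos] with t ht ht0
  by_cases hta : a < t
  · by_cases htx : t < x
    · rw [indicator_of_mem (show t ∈ Ioo a x from ⟨hta, htx⟩), legendreKernelInv_of_lt _ ht0 htx]
    · rw [indicator_of_notMem (fun hh => htx hh.2), legendreKernelInv_of_le _ (not_lt.1 htx)]
      simp
  · rw [indicator_of_notMem (fun hh => hta hh.1), ht (not_lt.1 hta), mul_zero]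

/-- Pointwise (1-K)(1+L)f = f = (1+L)(1-K)f, as far as the terms can be separated; `hD` is the
integrability that Fubini needs. -/
lemma kernelInt_comp_majorant (h : IsLegendre ν P P1 P2) (hk : IsCarleman (legendreKernel P1) M)
    {f : ℝ → ℂ} (hf : MemLp f 2 halfLine) {x : ℝ} (hx : 0 < x)
    (hD : Integrable (fun t => majorant P x t * ‖f t‖) halfLine) :
    kernelInt (legendreKernel P1) (kernelInt (legendreKernelInv P1) f) x
        = kernelInt (legendreKernelInv P1) f x - kernelInt (legendreKernel P1) f x ∧
      kernelInt (legendreKernelInv P1) (kernelInt (legendreKernel P1) f) x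
        = kernelInt (legendreKernelInv P1) f x - kernelInt (legendreKernel P1) f x := by
  obtain ⟨N, hN0, hN⟩ := h.exists_comp_kernel
  have hD' : Integrable (fun t => N * majorant P x t * ‖f t‖) halfLine := by
    simp only [mul_assoc]
    exact hD.const_mul N
  exact ⟨kernelInt_comp hk.measurable h.measurable_legendreKernelInv hf.1
      (fun t ht => (hN x t hx ht).1) hD' (hk.integrable_mul hf hx),
    kernelInt_comp h.measurable_legendreKernelInv hk.measurable hf.1
      (fun t ht => (hN x t hx ht).2) hD' (hk.integrable_mul hf hx)⟩

lemma kernelInt_comp_majorant_swap (h : IsLegendre ν P P1 P2)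
    (hk : IsCarleman (legendreKernel P1) M)
    {f : ℝ → ℂ} (hf : MemLp f 2 halfLine) {x : ℝ} (hx : 0 < x)
    (hD : Integrable (fun t => majorant P t x * ‖f t‖) halfLine) :
    kernelInt (fun x t => legendreKernel P1 t x) (kernelInt (fun x t => legendreKernelInv P1 t x) f)
        x = kernelInt (fun x t => legendreKernelInv P1 t x) f x
          - kernelInt (fun x t => legendreKernel P1 t x) f x ∧
      kernelInt (fun x t => legendreKernelInv P1 t x) (kernelInt (fun x t => legendreKernel P1 t x) f)
        x = kernelInt (fun x t => legendreKernelInv P1 t x) f x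
          - kernelInt (fun x t => legendreKernel P1 t x) f x := by
  obtain ⟨N, hN0, hN⟩ := h.exists_comp_kernel
  have hD' : Integrable (fun t => N * majorant P t x * ‖f t‖) halfLine := by
    simp only [mul_assoc]
    exact hD.const_mul N
  have hl : Measurable fun p : ℝ × ℝ => legendreKernelInv P1 p.2 p.1 :=
    h.measurable_legendreKernelInv.comp measurable_swap
  refine ⟨kernelInt_comp hk.swap.measurable hl hf.1 (fun t ht => ?_) hD'
      (hk.swap.integrable_mul hf hx),
    kernelInt_comp hl hk.swap.measurable hf.1 (fun t ht => ?_) hD' (hk.swap.integrable_mul hf hx)⟩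
  · have := (hN t x ht hx).2
    simpa only [mul_comm (legendreKernelInv P1 t _)] using this
  · have := (hN t x ht hx).1
    simpa only [mul_comm (legendreKernel P1 t _)] using this

lemma eq_of_Sminus (h : IsLegendre ν P P1 P2) (hk : IsCarleman (legendreKernel P1) M)
    {f g : HalfLineL2} (hfg : Sminus ν f g) : g = f - kernelOp hk.swap f := by
  obtain ⟨h1, h2⟩ := hfg
  have e : ∀ x, 0 < x → EqOn (fun t => (legendreP ν (x / t) : ℂ) * f t)
      (fun t => (P (x / t) : ℂ) * f t) (Ioi x) := fun x hx t ht => by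
    dsimp only
    rw [h.legendreP_eq _ (div_pos hx (hx.trans ht))]
  have h3 := h.isACDeriv_integral_Ioi (Lp.memLp f) fun x hx =>
    (integrableOn_congr_fun (e x hx) measurableSet_Ioi).1 (h1 x hx)
  have h4 := h2.unique (h3.congr (fun x hx => by
    rw [setIntegral_congr_fun measurableSet_Ioi (e x hx)]) (EventuallyEq.refl _ _))
  exact Lp.ext (h4.trans (coeFn_sub_kernelOp hk.swap f).symm)

lemma Sminus_of_support (h : IsLegendre ν P P1 P2) (hk : IsCarleman (legendreKernel P1) M)
    {f : HalfLineL2} {b : ℝ} (hf : ∀ᵐ t ∂halfLine, b ≤ t → f t = 0) :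
    Sminus ν f (f - kernelOp hk.swap f) := by
  have e : ∀ x, 0 < x → EqOn (fun t => (legendreP ν (x / t) : ℂ) * f t)
      (fun t => (P (x / t) : ℂ) * f t) (Ioi x) := fun x hx t ht => by
    dsimp only
    rw [h.legendreP_eq _ (div_pos hx (hx.trans ht))]
  obtain ⟨C, -, hC, -⟩ := h.exists_bound 1
  have h1 : ∀ x, 0 < x → IntegrableOn (fun t => (P (x / t) : ℂ) * f t) (Ioi x) := fun x hx => by
    have h2 : IntegrableOn (fun t => (P (x / t) : ℂ) * f t) (Ioo x b) :=
      integrable_mul_of_bounded_Ioo hx.le (((h.continuousOn_comp_div' hx).mono fun t ht =>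
        hx.trans ht.1).aestronglyMeasurable measurableSet_Ioo)
        (fun t ht => hC _ ⟨(div_pos hx (hx.trans ht.1)).le,
          (div_le_one (hx.trans ht.1)).2 ht.1.le⟩) (Lp.memLp f)
    refine ((integrable_indicator_iff measurableSet_Ioo).2 h2).restrict.congr ?_
    filter_upwards [ae_restrict_of_ae_restrict_of_subset (Ioi_subset_Ioi hx.le) hf,
      ae_restrict_mem measurableSet_Ioi] with t ht hm
    by_cases hta : t < b
    · rw [indicator_of_mem (show t ∈ Ioo x b from ⟨hm, hta⟩)]
    · rw [indicator_of_notMem (fun hh => hta hh.2), ht (not_lt.1 hta), mul_zero]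
  refine ⟨fun x hx => (integrableOn_congr_fun (e x hx) measurableSet_Ioi).2 (h1 x hx),
    (h.isACDeriv_integral_Ioi (Lp.memLp f) h1).congr (fun x hx => ?_)
      (coeFn_sub_kernelOp hk.swap f)⟩
  rw [setIntegral_congr_fun measurableSet_Ioi (e x hx)]

/-- As g = f + Lf, the relation KLf = Lf - Kf says K(g - f) = g - f - Kf, that is, (1-K)g = f. -/
lemma eq_of_S0plus (h : IsLegendre ν P P1 P2) (hk : IsCarleman (legendreKernel P1) M)
    {f g : HalfLineL2} (hfg : S0plus ν f g) : f = g - kernelOp hk g := by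
  obtain ⟨h1, h2⟩ := hfg
  have e : ∀ x, 0 < x → EqOn (fun t => (legendreP ν (x / t) : ℂ) * f t)
      (fun t => (P (x / t) : ℂ) * f t) (Ioo 0 x) := fun x hx t ht => by
    dsimp only
    rw [h.legendreP_eq _ (div_pos hx ht.1)]
  have hi : ∀ x, 0 < x → IntegrableOn (fun t => (P (x / t) : ℂ) * f t) (Ioo 0 x) := fun x hx =>
    (integrableOn_congr_fun (e x hx) measurableSet_Ioo).1 (h1 x hx)
  have h3 := h.isACDeriv_integral_Ioo (Lp.memLp f) hi
  have hg := h2.unique (h3.congr (fun x hx => by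
    rw [setIntegral_congr_fun measurableSet_Ioo (e x hx)]) (EventuallyEq.refl _ _))
  have hL : ⇑(g - f) =ᵐ[halfLine] kernelInt (legendreKernelInv P1) f := by
    filter_upwards [hg, Lp.coeFn_sub g f] with x e1 e2
    rw [e2, Pi.sub_apply, e1, add_sub_cancel_left]
  refine Lp.ext ?_
  have hsub := coeFn_sub_kernelOp hk g
  filter_upwards [hsub, ae_halfLine_pos, hL, Lp.coeFn_sub g f] with x e1 hx e3 e4
  have hgf := (h.kernelInt_comp_majorant hk (Lp.memLp f) hx
    (integrable_majorant_mul (Lp.memLp f) (hi x hx))).1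
  rw [← kernelInt_congr _ hL, kernelInt_congr _ (Lp.coeFn_sub g f), ← e3, e4] at hgf
  have := kernelInt_sub (hk.integrable_mul (Lp.memLp g) hx) (hk.integrable_mul (Lp.memLp f) hx)
  rw [e1]
  simp only [Pi.sub_apply] at hgf
  change kernelInt (legendreKernel P1) (fun t => g t - f t) x = _ at hgf
  rw [this] at hgf
  linear_combination hgf

/-- If f vanishes near 0, so does Kf. All integrals then run over compact intervals [a, x], where
the kernels are bounded, and (1+L)(1-K)f = f may be expanded. -/
lemma S0plus_of_support (h : IsLegendre ν P P1 P2) (hk : IsCarleman (legendreKernel P1) M)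
    {f : HalfLineL2} {a : ℝ} (ha : 0 < a) (hf : ∀ᵐ t ∂halfLine, t ≤ a → f t = 0) :
    S0plus ν (f - kernelOp hk f) f := by
  have e : ∀ g : ℝ → ℂ, ∀ x, 0 < x → EqOn (fun t => (legendreP ν (x / t) : ℂ) * g t)
      (fun t => (P (x / t) : ℂ) * g t) (Ioo 0 x) := fun g x hx t ht => by
    dsimp only
    rw [h.legendreP_eq _ (div_pos hx ht.1)]
  have hKf : ∀ t, t ≤ a → kernelInt (legendreKernel P1) f t = 0 := fun t hta => by
    rw [kernelInt, integral_eq_zero_of_ae]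
    filter_upwards [hf] with s hs
    rcases le_or_gt s a with hsa | hsa
    · rw [hs hsa, mul_zero, Pi.zero_apply]
    · rw [legendreKernel_of_le _ (hta.trans hsa.le)]; simp
  have hKs : ∀ᵐ t ∂halfLine, t ≤ a → kernelOp hk f t = 0 := by
    filter_upwards [coeFn_kernelOp hk f] with t ht hta
    rw [ht, hKf t hta]
  have hgs : ∀ᵐ t ∂halfLine, t ≤ a → (f - kernelOp hk f) t = 0 := by
    filter_upwards [hf, hKs, Lp.coeFn_sub f (kernelOp hk f)] with t h1 h2 h3 hta
    rw [h3, Pi.sub_apply, h1 hta, h2 hta, sub_zero]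
  have hi : ∀ x, 0 < x → IntegrableOn (fun t => (P (x / t) : ℂ) * (f - kernelOp hk f) t)
      (Ioo 0 x) := fun x hx =>
    h.integrableOn_comp_div_mul_of_support ha hx (Lp.memLp _) hgs
  refine ⟨fun x hx => (integrableOn_congr_fun (e _ x hx) measurableSet_Ioo).2 (hi x hx),
    (h.isACDeriv_integral_Ioo (Lp.memLp _) hi).congr (fun x hx => ?_) ?_⟩
  · rw [setIntegral_congr_fun measurableSet_Ioo (e _ x hx)]
  · filter_upwards [coeFn_sub_kernelOp hk f, ae_halfLine_pos] with x e1 hx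
    have hc := (h.kernelInt_comp_majorant hk (Lp.memLp f) hx (integrable_majorant_mul
      (Lp.memLp f) (h.integrableOn_comp_div_mul_of_support ha hx (Lp.memLp f) hf))).2
    rw [← kernelInt_congr _ (coeFn_kernelOp hk f)] at hc
    have := kernelInt_sub (h.integrable_legendreKernelInv_mul_of_support ha hx (Lp.memLp f) hf)
      (h.integrable_legendreKernelInv_mul_of_support ha hx (Lp.memLp (kernelOp hk f)) hKs)
    rw [e1, kernelInt_congr _ (Lp.coeFn_sub f (kernelOp hk f))]
    change _ = _ + kernelInt (legendreKernelInv P1) (fun t => f t - kernelOp hk f t) x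
    rw [this, hc]
    ring

end IsLegendre

lemma tendsto_setIntegral_Ioc_left {F : ℝ → ℂ} {x : ℝ} (hx : 0 < x)
    (hF : IntegrableOn F (Ioo 0 x)) :
    Tendsto (fun ε => ∫ t in Ioc ε x, F t) (𝓝[>] 0) (𝓝 (∫ t in Ioo 0 x, F t)) := by
  have h1 : IntegrableOn F (uIcc 0 x) := by
    rw [uIcc_of_le hx.le]; exact (integrableOn_Icc_iff_integrableOn_Ioo (by simp) (by simp)).2 hF
  have h2 := (intervalIntegral.continuousOn_primitive_interval_left h1) 0 left_mem_uIcc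
  rw [ContinuousWithinAt, intervalIntegral.integral_of_le hx.le, integral_Ioc_eq_integral_Ioo,
    uIcc_of_le hx.le] at h2
  have h3 : 𝓝[>] (0 : ℝ) ≤ 𝓝[Icc 0 x] 0 := by
    rw [← nhdsWithin_Ioo_eq_nhdsGT hx]
    exact nhdsWithin_mono _ Ioo_subset_Icc_self
  refine (h2.mono_left h3).congr' ?_
  filter_upwards [Ioo_mem_nhdsGT hx] with ε hε
  rw [intervalIntegral.integral_of_le hε.2.le]

/-! ### The operator ₁P₀₊ against 1 - K. -/

/-- The test functions on the half-line. -/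
structure IsTestFunction (φ : ℝ → ℂ) : Prop where
  contDiff : ContDiff ℝ 2 φ
  exists_support : ∃ a b, 0 < a ∧ a < b ∧ (∀ t, t ≤ a → φ t = 0) ∧ ∀ t, b ≤ t → φ t = 0

namespace IsTestFunction

variable {φ : ℝ → ℂ}

lemma continuous_deriv (h : IsTestFunction φ) : Continuous (deriv φ) :=
  h.contDiff.continuous_deriv (by norm_num)

lemma hasDerivAt (h : IsTestFunction φ) (t : ℝ) : HasDerivAt φ (deriv φ t) t :=
  (h.contDiff.differentiable (by norm_num) t).hasDerivAt

lemma isACDeriv (h : IsTestFunction φ) : IsACDeriv φ (deriv φ) := fun a b _ _ =>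
  ⟨h.continuous_deriv.intervalIntegrable a b,
    intervalIntegral.integral_eq_sub_of_hasDerivAt (fun t _ => h.hasDerivAt t)
      (h.continuous_deriv.intervalIntegrable a b)⟩

end IsTestFunction

namespace IsLegendre

variable {ν : ℝ} {P P1 P2 : ℝ → ℝ} {M : ℝ}

/-- Integration by parts on (ε, x]. The other terms converge as ε → 0, hence so does the boundary
term at ε. -/
lemma tendsto_boundary_zero (h : IsLegendre ν P P1 P2) (hk : IsCarleman (legendreKernel P1) M)
    {f₀ f₁ : ℝ → ℂ} (hf : MemLp f₀ 2 halfLine) (hac : IsACDeriv f₀ f₁) {x : ℝ} (hx : 0 < x)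
    (hi : IntegrableOn (fun t => (P (t / x) : ℂ) * f₁ t) (Ioo 0 x)) :
    Tendsto (fun ε => (P (ε / x) : ℂ) * f₀ ε) (𝓝[>] 0)
      (𝓝 (f₀ x - kernelInt (legendreKernel P1) f₀ x
        - ∫ t in Ioo 0 x, (P (t / x) : ℂ) * f₁ t)) := by
  have hk1 : IntegrableOn (fun t => ((P1 (t / x) / x : ℝ) : ℂ) * f₀ t) (Ioo 0 x) := by
    have : IntegrableOn (fun t => (legendreKernel P1 x t : ℂ) * f₀ t) (Ioo 0 x) :=
      (hk.integrable_mul hf hx).mono_measure (Measure.restrict_mono (fun t ht => ht.1) le_rfl)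
    refine (integrableOn_congr_fun (fun t ht => ?_) measurableSet_Ioo).1 this
    rw [legendreKernel_of_lt _ ht.1 ht.2]
  rw [kernelInt_legendreKernel]
  refine ((tendsto_const_nhds.sub (tendsto_setIntegral_Ioc_left hx hk1)).sub
    (tendsto_setIntegral_Ioc_left hx hi)).congr' ?_
  filter_upwards [Ioo_mem_nhdsGT hx] with ε hε
  have hpx : P (x / x) = 1 := by rw [div_self hx.ne', h.map_one]
  have := hac.integral_mul hε.1 hε.2.le (p := fun t => P (t / x)) (p' := fun t => P1 (t / x) / x)
    (fun t ht => h.hasDerivAt_comp_div hx (hε.1.trans_le ht.1))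
    ((h.continuousOn_deriv_comp_div hx).mono fun t ht => hε.1.trans_le ht.1)
  rw [this, hpx]
  push_cast
  ring

/-- If P(0) ≠ 0, then f₀ has a limit at 0 and B is constant, so zero in L₂. If P(0) = 0, then P(ε/x)
= O(ε), and B(x) ≠ 0 would force |f₀(ε)| ≥ c/ε near 0, contrary to local integrability. -/
lemma boundary_zero_eq_zero (h : IsLegendre ν P P1 P2) {f₀ B : ℝ → ℂ} (hf : MemLp f₀ 2 halfLine)
    (hB : MemLp B 2 halfLine) (hlim : ∀ x, 0 < x →
      Tendsto (fun ε => (P (ε / x) : ℂ) * f₀ ε) (𝓝[>] 0) (𝓝 (B x))) {x : ℝ} (hx : 0 < x) :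
    B x = 0 := by
  have hPc : ∀ y, 0 < y → Tendsto (fun ε : ℝ => (P (ε / y) : ℂ)) (𝓝[>] 0) (𝓝 (P 0 : ℂ)) := by
    intro y hy
    have h1 : ContinuousAt P (0 / y) := by
      rw [zero_div]; exact (h.hasDerivAt 0 (by norm_num)).continuousAt
    have h2 : ContinuousAt (fun ε : ℝ => P (ε / y)) 0 :=
      ContinuousAt.comp (f := fun ε : ℝ => ε / y) h1 (by fun_prop)
    have h3 : Tendsto (fun ε : ℝ => P (ε / y)) (𝓝[>] 0) (𝓝 (P 0)) := by
      have := h2.tendsto.mono_left (nhdsWithin_le_nhds (s := Ioi 0))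
      rwa [zero_div] at this
    exact (Complex.continuous_ofReal.tendsto _).comp h3
  by_cases hP0 : P 0 = 0
  · obtain ⟨C, hC0, -, hC⟩ := h.exists_bound 1
    have hbd : ∀ z ∈ Icc (0 : ℝ) 1, |P z| ≤ C * z := fun z hz => by
      have := (convex_Icc (0 : ℝ) 1).norm_image_sub_le_of_norm_hasDerivWithin_le
        (f := P) (f' := P1) (C := C) (fun y hy => (h.hasDerivAt y
          (by linarith [hy.1])).hasDerivWithinAt) (fun y hy => hC y hy)
        (left_mem_Icc.2 zero_le_one) hz
      simpa [hP0, abs_of_nonneg hz.1] using this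
    by_contra hne
    have hpos : 0 < ‖B x‖ / 2 := by positivity
    have hev : ∀ᶠ ε in 𝓝[>] (0 : ℝ), ‖B x‖ / 2 < ‖(P (ε / x) : ℂ) * f₀ ε‖ :=
      (hlim x hx).norm.eventually (lt_mem_nhds (by linarith))
    obtain ⟨δ, hδ, hδs⟩ := (mem_nhdsGT_iff_exists_Ioo_subset).1 hev
    have hδ0 : 0 < δ := hδ
    set d := min δ x
    have hd : 0 < d := lt_min hδ0 hx
    have hint : IntegrableOn (fun t : ℝ => t⁻¹) (Ioo 0 d) := by
      refine ((hf.integrableOn_Ioo le_rfl).norm.const_mul (C / x / (‖B x‖ / 2))).mono'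
        (measurable_inv.aestronglyMeasurable) ?_
      filter_upwards [ae_restrict_mem measurableSet_Ioo] with t ht
      have h1 : ‖B x‖ / 2 < ‖(P (t / x) : ℂ) * f₀ t‖ := hδs ⟨ht.1, ht.2.trans_le (min_le_left _ _)⟩
      have h2 := hbd (t / x) ⟨(div_pos ht.1 hx).le,
        (div_le_one hx).2 (ht.2.le.trans (min_le_right _ _))⟩
      rw [norm_mul, Complex.norm_real, Real.norm_eq_abs] at h1
      have h3 : ‖B x‖ / 2 ≤ C * (t / x) * ‖f₀ t‖ :=
        h1.le.trans (mul_le_mul_of_nonneg_right h2 (norm_nonneg _))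
      have ht0 : 0 < t := ht.1
      rw [Real.norm_of_nonneg (by positivity), inv_eq_one_div, div_mul_eq_mul_div,
        div_le_div_iff₀ ht0 hpos]
      calc 1 * (‖B x‖ / 2) ≤ C * (t / x) * ‖f₀ t‖ := by rwa [one_mul]
        _ = _ := by ring
    have := (intervalIntegrable_iff_integrableOn_Ioo_of_le hd.le).2 hint
    rw [intervalIntegrable_inv_iff] at this
    rcases this with h0 | h0
    · exact hd.ne h0
    · exact h0 left_mem_uIcc
  · have hP0' : (P 0 : ℂ) ≠ 0 := by exact_mod_cast hP0
    have hlim' : ∀ y, 0 < y → Tendsto f₀ (𝓝[>] 0) (𝓝 (B y / P 0)) := fun y hy => by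
      refine ((hlim y hy).div (hPc y hy) hP0').congr' ?_
      filter_upwards [(hPc y hy).eventually_ne hP0'] with ε hε
      rw [Pi.div_apply, mul_div_cancel_left₀ _ hε]
    have hconst : ∀ y, 0 < y → B y = B x := fun y hy => by
      have := tendsto_nhds_unique (hlim' y hy) (hlim' x hx)
      exact (div_left_inj' hP0').1 this
    have h2 : MemLp (fun _ : ℝ => B x) 2 halfLine := hB.ae_eq (by
      filter_upwards [ae_halfLine_pos] with y hy using hconst y hy)
    rcases (memLp_const_iff (by norm_num) (by norm_num)).1 h2 with h3 | h3
    · exact h3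
    · simp at h3

lemma eq_of_P0plus (h : IsLegendre ν P P1 P2) (hk : IsCarleman (legendreKernel P1) M)
    {f g : HalfLineL2} (hfg : P0plus ν f g) : g = f - kernelOp hk f := by
  obtain ⟨f₀, f₁, hf, hac, hi, hg⟩ := hfg
  have e : ∀ x, 0 < x → EqOn (fun t => (legendreP ν (t / x) : ℂ) * f₁ t)
      (fun t => (P (t / x) : ℂ) * f₁ t) (Ioo 0 x) := fun x hx t ht => by
    dsimp only
    rw [h.legendreP_eq _ (div_pos ht.1 hx)]
  have hm : MemLp f₀ 2 halfLine := (Lp.memLp f).ae_eq hf.symm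
  have hlim := fun x hx => h.tendsto_boundary_zero hk hm hac hx
    ((integrableOn_congr_fun (e x hx) measurableSet_Ioo).1 (hi x hx))
  have hBm : MemLp (fun x => f₀ x - kernelInt (legendreKernel P1) f₀ x
      - ∫ t in Ioo 0 x, (P (t / x) : ℂ) * f₁ t) 2 halfLine := by
    refine ((hm.sub (hk.memLp_kernelInt hm)).sub (Lp.memLp g)).ae_eq ?_
    filter_upwards [hg, ae_halfLine_pos] with x hgx hx
    rw [Pi.sub_apply, Pi.sub_apply, hgx, setIntegral_congr_fun measurableSet_Ioo (e x hx)]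
  refine Lp.ext ?_
  filter_upwards [hg, hf, ae_halfLine_pos, coeFn_sub_kernelOp hk f] with x hgx hfx hx hs
  have h0 := h.boundary_zero_eq_zero hm hBm hlim hx
  rw [hs, hgx, setIntegral_congr_fun measurableSet_Ioo (e x hx), ← hfx, ← kernelInt_congr _ hf]
  linear_combination -h0

lemma P0plus_of_isTestFunction (h : IsLegendre ν P P1 P2) (hk : IsCarleman (legendreKernel P1) M)
    {f : HalfLineL2} {φ : ℝ → ℂ} (hφ : IsTestFunction φ) (hf : φ =ᵐ[halfLine] f) :
    P0plus ν f (f - kernelOp hk f) := by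
  have e : ∀ x, 0 < x → EqOn (fun t => (legendreP ν (t / x) : ℂ) * deriv φ t)
      (fun t => (P (t / x) : ℂ) * deriv φ t) (Ioo 0 x) := fun x hx t ht => by
    dsimp only
    rw [h.legendreP_eq _ (div_pos ht.1 hx)]
  have hi : ∀ x, 0 < x → IntegrableOn (fun t => (P (t / x) : ℂ) * deriv φ t) (Ioo 0 x) :=
    fun x hx => by
      have hc : ContinuousOn (fun t => (P (t / x) : ℂ) * deriv φ t) (Icc 0 x) := by
        refine (Complex.continuous_ofReal.comp_continuousOn
          (h.continuousOn.comp (f := fun t => t / x) (by fun_prop) fun t ht => ?_)).mul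
          hφ.continuous_deriv.continuousOn
        have : 0 ≤ t / x := div_nonneg ht.1 hx.le
        simp only [mem_Ioi]; linarith
      exact hc.integrableOn_Icc.mono_set Ioo_subset_Icc_self
  refine ⟨φ, deriv φ, hf, hφ.isACDeriv, fun x hx =>
    (integrableOn_congr_fun (e x hx) measurableSet_Ioo).2 (hi x hx), ?_⟩
  have hm : MemLp φ 2 halfLine := (Lp.memLp f).ae_eq hf.symm
  filter_upwards [hf, ae_halfLine_pos, coeFn_sub_kernelOp hk f] with x hfx hx hs
  obtain ⟨a, b, ha, -, h1, -⟩ := hφ.exists_support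
  have hlim := h.tendsto_boundary_zero hk hm hφ.isACDeriv hx (hi x hx)
  have h0 : Tendsto (fun ε => (P (ε / x) : ℂ) * φ ε) (𝓝[>] 0) (𝓝 0) := by
    refine tendsto_const_nhds.congr' ?_
    filter_upwards [Ioo_mem_nhdsGT ha] with ε hε
    rw [h1 ε hε.2.le, mul_zero]
  have := tendsto_nhds_unique hlim h0
  rw [hs, setIntegral_congr_fun measurableSet_Ioo (e x hx), ← hfx, ← kernelInt_congr _ hf]
  linear_combination this

end IsLegendre

/-! ### The operator ₁P₋ against the inverse of 1 - K*. -/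

/-- A limit at infinity of a function dominated by a square integrable one vanishes. -/
lemma MeasureTheory.MemLp.eq_zero_of_tendsto {f G : ℝ → ℂ} (hf : MemLp f 2 halfLine) {c : ℂ}
    (hG : Tendsto G atTop (𝓝 c)) (hle : ∀ᶠ T in atTop, ‖G T‖ ≤ ‖f T‖) : c = 0 := by
  by_contra hne
  have hpos : 0 < ‖c‖ / 2 := by positivity
  have hev : ∀ᶠ T in atTop, ‖c‖ / 2 < ‖G T‖ := hG.norm.eventually (lt_mem_nhds (by linarith))
  obtain ⟨N, hN⟩ := ((hev.and hle).and (eventually_gt_atTop 0)).exists_forall_of_atTop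
  have hN0 : 0 < N := (hN N le_rfl).2
  have h1 : MemLp f 2 (volume.restrict (Ioi N)) :=
    hf.mono_measure (Measure.restrict_mono (Ioi_subset_Ioi hN0.le) le_rfl)
  have h2 : MemLp (fun _ : ℝ => ‖c‖ / 2) 2 (volume.restrict (Ioi N)) := by
    refine h1.mono aestronglyMeasurable_const ?_
    filter_upwards [ae_restrict_mem measurableSet_Ioi] with t ht
    have := hN t (le_of_lt ht)
    rw [Real.norm_of_nonneg hpos.le]
    linarith [this.1.1, this.1.2]
  rcases (memLp_const_iff (by norm_num) (by norm_num)).1 h2 with h3 | h3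
  · exact hpos.ne' h3
  · simp at h3

lemma kernelInt_legendreKernelInv_swap (P1 : ℝ → ℝ) (f : ℝ → ℂ) {x : ℝ} (hx : 0 < x) :
    kernelInt (fun x t => legendreKernelInv P1 t x) f x
      = ∫ t in Ioi x, ((P1 (t / x) / x : ℝ) : ℂ) * f t := by
  refine integral_halfLine_Ioi hx.le (fun y h1 => ?_) fun y h0 h1 => ?_
  · dsimp only
    rw [legendreKernelInv_of_lt _ hx h1]
  · dsimp only
    rw [legendreKernelInv_of_le _ h1]; simp

namespace IsACDeriv

variable {F f : ℝ → ℂ}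

lemma eq_neg_integral_Ioi (h : IsACDeriv F f) (hF : MemLp F 2 halfLine) {x : ℝ} (hx : 0 < x)
    (hf : IntegrableOn f (Ioi x)) : F x = -∫ t in Ioi x, f t := by
  have h1 := intervalIntegral_tendsto_integral_Ioi x hf tendsto_id
  have h2 : Tendsto F atTop (𝓝 ((∫ t in Ioi x, f t) + F x)) := by
    refine (h1.add_const (F x)).congr' ?_
    filter_upwards [eventually_gt_atTop 0] with T hT
    rw [id, (h x T hx hT).2, sub_add_cancel]
  have := hF.eq_zero_of_tendsto h2 (Eventually.of_forall fun _ => le_rfl)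
  linear_combination this

end IsACDeriv

namespace IsLegendre

variable {ν : ℝ} {P P1 P2 : ℝ → ℝ} {M : ℝ}

/-- Here P ≥ 1 and P may grow, so integration by parts up to T leaves an uncontrolled boundary term.
Instead, P ≥ 1 makes f₁ integrable at infinity, f₀ is minus its tail integral, and Fubini with P' ≥
0 gives the formula. -/
lemma add_kernelInt_of_nonneg (h : IsLegendre ν P P1 P2) (hν : 0 ≤ ν * (ν + 1)) {f₀ f₁ : ℝ → ℂ}
    (hf : MemLp f₀ 2 halfLine) (hac : IsACDeriv f₀ f₁) {x : ℝ} (hx : 0 < x)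
    (hi : ∀ x, 0 < x → IntegrableOn (fun t => (P (t / x) : ℂ) * f₁ t) (Ioi x)) :
    Integrable (fun t => majorant P t x * ‖f₀ t‖) halfLine ∧
      f₀ x + kernelInt (fun x t => legendreKernelInv P1 t x) f₀ x
        = -∫ t in Ioi x, (P (t / x) : ℂ) * f₁ t := by
  have hf1m := hac.aestronglyMeasurable
  have hf1 : ∀ y, 0 < y → IntegrableOn f₁ (Ioi y) := fun y hy => by
    refine Integrable.mono (hi y hy) (hf1m.mono_measure
      (Measure.restrict_mono (Ioi_subset_Ioi hy.le) le_rfl)) ?_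
    filter_upwards [ae_restrict_mem measurableSet_Ioi] with t ht
    have h1 := h.one_le hν ((one_lt_div hy).2 ht).le
    rw [norm_mul, Complex.norm_real, Real.norm_eq_abs, abs_of_nonneg (by linarith)]
    nlinarith [norm_nonneg (f₁ t)]
  have hf0 : ∀ y, 0 < y → f₀ y = -∫ t in Ioi y, f₁ t := fun y hy =>
    hac.eq_neg_integral_Ioi hf hy (hf1 y hy)
  let γ : ℝ → ℝ → ℝ := fun y t => (Ioi y).indicator (fun _ => legendreKernelInv P1 y x) t
  have hγm : Measurable (Function.uncurry γ) := by
    have h1 : Measurable fun p : ℝ × ℝ => legendreKernelInv P1 p.1 x :=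
      h.measurable_legendreKernelInv.comp (measurable_fst.prodMk measurable_const)
    exact h1.indicator (measurableSet_lt measurable_fst measurable_snd)
  have hP1 : P (x / x) = 1 := by rw [div_self hx.ne', h.map_one]
  have hγ : ∀ t, 0 < t → ∀ y, 0 < y → γ y t
      = (Ioo x t).indicator (fun y => P1 (y / x) / x) y := fun t ht y hy => by
    simp only [γ, indicator, legendreKernelInv, mem_Ioi, mem_Ioo]
    by_cases h1 : y < t <;> by_cases h2 : x < y <;> simp [h1, h2, hx]
  have hq : ∀ t, IntegrableOn (fun y => P1 (y / x) / x) (Ioo x t) := fun t =>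
    (h.integrableOn_deriv_comp_div hx hx).mono_set Ioo_subset_Ioc_self
  have h1 : ∀ t, 0 < t → Integrable (fun y => γ y t) halfLine := fun t ht =>
    (integrable_indicator_halfLine measurableSet_Ioo (hq t)).congr (by
      filter_upwards [ae_halfLine_pos] with y hy using (hγ t ht y hy).symm)
  have hsub : ∀ t, Ioo x t ⊆ Ioi 0 := fun t y hy => hx.trans hy.1
  have e1 : ∀ t, 0 < t → ∫ y, γ y t ∂halfLine = (Ioi x).indicator (fun t => P (t / x) - 1) t := by
    intro t ht
    rw [integral_congr_ae (show _ =ᵐ[halfLine] _ by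
      filter_upwards [ae_halfLine_pos] with y hy using hγ t ht y hy),
      integral_indicator_halfLine measurableSet_Ioo (hsub t)]
    rcases lt_or_ge x t with hxt | hxt
    · rw [indicator_of_mem (show t ∈ Ioi x from hxt), ← integral_Ioc_eq_integral_Ioo,
        h.integral_deriv_comp_div hx hx hxt.le, hP1]
    · rw [indicator_of_notMem (by simpa using hxt), Ioo_eq_empty hxt.not_gt, setIntegral_empty]
  have e2 : ∀ t, 0 < t → ∫ y, |γ y t| ∂halfLine = |∫ y, γ y t ∂halfLine| := by
    intro t ht
    refine abs_setIntegral_of_sign measurableSet_Ioi (Or.inl fun y hy => ?_)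
    rw [hγ t ht y hy]
    refine indicator_nonneg (fun y hy => ?_) _
    exact div_nonneg (h.deriv_nonneg hν ((one_lt_div hx).2 hy.1)) hx.le
  have j1 : IntegrableOn (fun t => (P (t / x) : ℂ) * f₁ t - f₁ t) (Ioi x) :=
    (hi x hx).sub (hf1 x hx)
  have h2 : Integrable (fun t => (∫ y, |γ y t| ∂halfLine) * ‖f₁ t‖) halfLine := by
    refine (integrable_indicator_halfLine measurableSet_Ioi j1).norm.congr ?_
    filter_upwards [ae_halfLine_pos] with t ht
    rw [e2 t ht, e1 t ht]
    by_cases hxt : t ∈ Ioi x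
    · rw [indicator_of_mem hxt, indicator_of_mem hxt, ← Real.norm_eq_abs, ← Complex.norm_real,
        ← norm_mul]
      push_cast
      rw [sub_mul, one_mul]
    · rw [indicator_of_notMem hxt, indicator_of_notMem hxt]; simp
  obtain ⟨i1, -, e⟩ := integral_kernel_swap hγm.aestronglyMeasurable hf1m
    (by filter_upwards [ae_halfLine_pos] with t ht using h1 t ht) h2
  have e3 : ∀ y, 0 < y → ∫ t, (γ y t : ℂ) * f₁ t ∂halfLine
      = -((legendreKernelInv P1 y x : ℂ) * f₀ y) := fun y hy => by
    have : ∀ t, (γ y t : ℂ) * f₁ t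
        = (Ioi y).indicator (fun t => (legendreKernelInv P1 y x : ℂ) * f₁ t) t := fun t => by
      simp only [γ, indicator]
      split_ifs <;> simp
    simp only [this]
    rw [integral_indicator_halfLine measurableSet_Ioi (Ioi_subset_Ioi hy.le), integral_const_mul,
      hf0 y hy]
    ring
  have i2 : Integrable (fun y => (legendreKernelInv P1 y x : ℂ) * f₀ y) halfLine :=
    i1.neg.congr (by
      filter_upwards [ae_halfLine_pos] with y hy
      rw [Pi.neg_apply, e3 y hy, neg_neg])
  constructor
  -- The integral L*f₀(x) is already known to converge absolutely, and it dominates the majorant.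
  · obtain ⟨C, hC0, hC⟩ := h.exists_abs_sub_one_le hν
    have hmm : AEStronglyMeasurable (fun t => majorant P t x) halfLine := by
      have hcont : ContinuousOn (fun t => |P (t / x) - 1| / t) (Ioi x) :=
        (((h.continuousOn_comp_div hx).mono (Ioi_subset_Ioi hx.le)).sub
          continuousOn_const).abs.div continuousOn_id fun t ht => (hx.trans ht).ne'
      have := (aestronglyMeasurable_indicator_iff (μ := volume) measurableSet_Ioi).2
        (hcont.aestronglyMeasurable measurableSet_Ioi)
      refine (this.mono_measure Measure.restrict_le_self : AEStronglyMeasurable _ halfLine).congr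
        (Eventually.of_forall fun t => ?_)
      dsimp only
      by_cases hxt : x < t
      · rw [indicator_of_mem (show t ∈ Ioi x from hxt), majorant_of_lt hx hxt]
      · rw [indicator_of_notMem (by simpa using hxt), majorant_of_le (not_lt.1 hxt)]
    refine (i2.norm.const_mul C).mono' (hmm.mul hf.1.norm) ?_
    filter_upwards [ae_halfLine_pos] with t ht
    rw [Real.norm_of_nonneg (mul_nonneg (majorant_nonneg ht) (norm_nonneg _)), norm_mul,
      Complex.norm_real, Real.norm_eq_abs, ← mul_assoc]
    gcongr
    by_cases hxt : x < t
    · rw [majorant_of_lt hx hxt, legendreKernelInv_of_lt _ hx hxt, div_le_iff₀ ht, abs_div,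
        abs_of_pos hx]
      refine (hC (t / x) ((one_lt_div hx).2 hxt)).trans_eq ?_
      ring
    · rw [majorant_of_le (not_lt.1 hxt)]
      positivity
  · have e4 : ∫ t, ((∫ y, γ y t ∂halfLine : ℝ) : ℂ) * f₁ t ∂halfLine
        = ∫ t in Ioi x, ((P (t / x) : ℂ) * f₁ t - f₁ t) := by
      rw [← integral_indicator_halfLine measurableSet_Ioi (Ioi_subset_Ioi hx.le)]
      refine integral_congr_ae ?_
      filter_upwards [ae_halfLine_pos] with t ht
      rw [e1 t ht]
      simp only [indicator]
      split_ifs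
      · push_cast; ring
      · simp
    rw [e4, integral_sub (hi x hx) (hf1 x hx), integral_congr_ae (show _ =ᵐ[halfLine] _ by
      filter_upwards [ae_halfLine_pos] with y hy using e3 y hy), integral_neg] at e
    rw [hf0 x hx, kernelInt]
    linear_combination -e

/-- Here 0 < P ≤ 1 and P' = O(1/z), so L*f₀ converges for every square integrable f₀. Integration by
parts up to T leaves a convergent boundary term bounded by |f₀(T)|, and its limit is 0. -/
lemma add_kernelInt_of_nonpos (h : IsLegendre ν P P1 P2) (hν : ν * (ν + 1) ≤ 0) {f₀ f₁ : ℝ → ℂ}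
    (hf : MemLp f₀ 2 halfLine) (hac : IsACDeriv f₀ f₁) {x : ℝ} (hx : 0 < x)
    (hi : IntegrableOn (fun t => (P (t / x) : ℂ) * f₁ t) (Ioi x)) :
    Integrable (fun t => majorant P t x * ‖f₀ t‖) halfLine ∧
      f₀ x + kernelInt (fun x t => legendreKernelInv P1 t x) f₀ x
        = -∫ t in Ioi x, (P (t / x) : ℂ) * f₁ t := by
  have hdiv := hf.integrableOn_div hx
  have hPb : ∀ t, x < t → 0 < P (t / x) ∧ P (t / x) ≤ 1 := fun t ht =>
    ⟨h.pos _ ((one_lt_div hx).2 ht), h.le_one hν ((one_lt_div hx).2 ht).le⟩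
  have hfm : AEStronglyMeasurable f₀ (volume.restrict (Ioi x)) :=
    hf.1.mono_measure (Measure.restrict_mono (Ioi_subset_Ioi hx.le) le_rfl)
  constructor
  · have h1 : IntegrableOn (fun t => |P (t / x) - 1| / t * ‖f₀ t‖) (Ioi x) := by
      have hcont : ContinuousOn (fun t => |P (t / x) - 1| / t) (Ioi x) :=
        (((h.continuousOn_comp_div hx).mono (Ioi_subset_Ioi hx.le)).sub
          continuousOn_const).abs.div continuousOn_id fun t ht => (hx.trans ht).ne'
      refine hdiv.mono' ((hcont.aestronglyMeasurable measurableSet_Ioi).mul hfm.norm) ?_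
      filter_upwards [ae_restrict_mem measurableSet_Ioi] with t ht
      have ht0 : 0 < t := hx.trans ht
      have hb := hPb t ht
      have : |P (t / x) - 1| ≤ 1 := abs_le.2 ⟨by linarith, by linarith⟩
      rw [Real.norm_of_nonneg (by positivity), div_mul_eq_mul_div]
      gcongr
      nlinarith [norm_nonneg (f₀ t)]
    refine (integrable_indicator_halfLine measurableSet_Ioi h1).congr ?_
    filter_upwards [ae_halfLine_pos] with t ht
    by_cases hxt : x < t
    · rw [indicator_of_mem (show t ∈ Ioi x from hxt), majorant_of_lt hx hxt]
    · rw [indicator_of_notMem (by simpa using hxt), majorant_of_le (not_lt.1 hxt), zero_mul]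
  · have h2 : IntegrableOn (fun t => ((P1 (t / x) / x : ℝ) : ℂ) * f₀ t) (Ioi x) := by
      have hcont := (h.continuousOn_deriv_comp_div hx).mono (Ioi_subset_Ioi hx.le)
      refine (hdiv.const_mul (-(ν * (ν + 1)))).mono' ((Complex.continuous_ofReal.comp_aestronglyMeasurable
        (hcont.aestronglyMeasurable measurableSet_Ioi)).mul hfm) ?_
      filter_upwards [ae_restrict_mem measurableSet_Ioi] with t ht
      have ht0 : 0 < t := hx.trans ht
      have := h.abs_deriv_le hν ((one_lt_div hx).2 ht)
      rw [norm_mul, Complex.norm_real, Real.norm_eq_abs, abs_div, abs_of_pos hx]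
      calc |P1 (t / x)| / x * ‖f₀ t‖ ≤ (-(ν * (ν + 1)) / (t / x)) / x * ‖f₀ t‖ := by gcongr
        _ = _ := by field_simp
    have hpx : P (x / x) = 1 := by rw [div_self hx.ne', h.map_one]
    have hlim : Tendsto (fun T => (P (T / x) : ℂ) * f₀ T) atTop
        (𝓝 ((∫ t in Ioi x, (P (t / x) : ℂ) * f₁ t) + f₀ x
          + ∫ t in Ioi x, ((P1 (t / x) / x : ℝ) : ℂ) * f₀ t)) := by
      refine (((intervalIntegral_tendsto_integral_Ioi x hi tendsto_id).add_const (f₀ x)).add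
        (intervalIntegral_tendsto_integral_Ioi x h2 tendsto_id)).congr' ?_
      filter_upwards [eventually_gt_atTop x] with T hT
      have := hac.integral_mul hx hT.le (p := fun t => P (t / x))
        (p' := fun t => P1 (t / x) / x)
        (fun t ht => h.hasDerivAt_comp_div hx (hx.trans_le ht.1))
        ((h.continuousOn_deriv_comp_div hx).mono fun t ht => hx.trans_le ht.1)
      rw [id, intervalIntegral.integral_of_le hT.le, intervalIntegral.integral_of_le hT.le, this,
        hpx]
      push_cast
      ring
    have h0 := hf.eq_zero_of_tendsto hlim (by
      filter_upwards [eventually_gt_atTop x] with T hT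
      have hb := hPb T hT
      rw [norm_mul, Complex.norm_real, Real.norm_of_nonneg hb.1.le]
      exact mul_le_of_le_one_left (norm_nonneg _) hb.2)
    rw [kernelInt_legendreKernelInv_swap _ _ hx]
    linear_combination h0

/-- As g = f + L*f, the relation K*L*f = L*f - K*f gives (1-K*)g = f. -/
lemma eq_of_Pminus (h : IsLegendre ν P P1 P2) (hk : IsCarleman (legendreKernel P1) M)
    {f g : HalfLineL2} (hfg : Pminus ν f g) : f = g - kernelOp hk.swap g := by
  obtain ⟨f₀, f₁, hf, hac, hi, hg⟩ := hfg
  have e : ∀ x, 0 < x → EqOn (fun t => (legendreP ν (t / x) : ℂ) * -f₁ t)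
      (fun t => -((P (t / x) : ℂ) * f₁ t)) (Ioi x) := fun x hx t ht => by
    dsimp only
    rw [h.legendreP_eq _ (div_pos (hx.trans ht) hx), mul_neg]
  have hm : MemLp f₀ 2 halfLine := (Lp.memLp f).ae_eq hf.symm
  have hi' : ∀ x, 0 < x → IntegrableOn (fun t => (P (t / x) : ℂ) * f₁ t) (Ioi x) := fun x hx => by
    have := ((integrableOn_congr_fun (e x hx) measurableSet_Ioi).1 (hi x hx)).neg
    exact this.congr (Eventually.of_forall fun t => by simp)
  have key : ∀ x, 0 < x → Integrable (fun t => majorant P t x * ‖f₀ t‖) halfLine ∧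
      f₀ x + kernelInt (fun x t => legendreKernelInv P1 t x) f₀ x
        = -∫ t in Ioi x, (P (t / x) : ℂ) * f₁ t := fun x hx => by
    rcases le_total 0 (ν * (ν + 1)) with hν | hν
    · exact h.add_kernelInt_of_nonneg hν hm hac hx hi'
    · exact h.add_kernelInt_of_nonpos hν hm hac hx (hi' x hx)
  have hg' : g =ᵐ[halfLine] fun x =>
      f₀ x + kernelInt (fun x t => legendreKernelInv P1 t x) f₀ x := by
    filter_upwards [hg, ae_halfLine_pos] with x hgx hx
    rw [hgx, setIntegral_congr_fun measurableSet_Ioi (e x hx), integral_neg, (key x hx).2]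
  have hL : (fun x => g x - f₀ x) =ᵐ[halfLine]
      kernelInt (fun x t => legendreKernelInv P1 t x) f₀ := by
    filter_upwards [hg'] with x e1
    rw [e1, add_sub_cancel_left]
  refine Lp.ext ?_
  filter_upwards [coeFn_sub_kernelOp hk.swap g, ae_halfLine_pos, hL, hf] with x e1 hx e3 e4
  have hc := (h.kernelInt_comp_majorant_swap hk hm hx (key x hx).1).1
  rw [← kernelInt_congr _ hL, ← e3,
    kernelInt_sub (hk.swap.integrable_mul (Lp.memLp g) hx) (hk.swap.integrable_mul hm hx)] at hc
  rw [e1, ← e4]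
  linear_combination hc

end IsLegendre

/-! ### Functions of bounded support in the range of ₁P₋. -/

lemma integrableOn_Ioi_mul_of_support {q : ℝ → ℝ} {g : ℝ → ℂ} {x b : ℝ} (hx : 0 < x)
    (hq : ContinuousOn q (Ioi 0)) (hg : IntegrableOn g (Ioo x b)) (hs : ∀ t, b ≤ t → g t = 0) :
    IntegrableOn (fun t => (q t : ℂ) * g t) (Ioi x) := by
  have hc : ContinuousOn q (Icc x b) := hq.mono fun t ht => hx.trans_le ht.1
  obtain ⟨C, hC⟩ := isCompact_Icc.exists_bound_of_continuousOn hc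
  have h1 : IntegrableOn (fun t => (q t : ℂ) * g t) (Ioo x b) := by
    refine Integrable.bdd_mul (c := C) hg (Complex.continuous_ofReal.comp_aestronglyMeasurable
      ((hc.mono Ioo_subset_Icc_self).aestronglyMeasurable measurableSet_Ioo)) ?_
    filter_upwards [ae_restrict_mem measurableSet_Ioo] with t ht
    rw [Complex.norm_real]
    exact hC t (Ioo_subset_Icc_self ht)
  refine ((integrable_indicator_iff measurableSet_Ioo).2 h1).restrict.congr ?_
  filter_upwards [ae_restrict_mem measurableSet_Ioi] with t ht
  by_cases htb : t < b
  · rw [indicator_of_mem (show t ∈ Ioo x b from ⟨ht, htb⟩)]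
  · rw [indicator_of_notMem (fun hh => htb hh.2), hs t (not_lt.1 htb), mul_zero]

lemma setIntegral_Ioi_of_support {G : ℝ → ℂ} {x T : ℝ} (hs : ∀ t, T ≤ t → G t = 0) :
    ∫ t in Ioi x, G t = ∫ t in Ioc x T, G t :=
  setIntegral_eq_of_subset_of_forall_sdiff_eq_zero measurableSet_Ioi (fun _ ht => ht.1)
    fun t ht => hs t (le_of_lt (not_le.1 fun h => ht.2 ⟨ht.1, h⟩))

lemma IsACDeriv.mul {F f : ℝ → ℂ} (h : IsACDeriv F f) {p p' : ℝ → ℝ}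
    (hp : ∀ x, 0 < x → HasDerivAt p (p' x) x) (hp' : ContinuousOn p' (Ioi 0)) :
    IsACDeriv (fun x => (p x : ℂ) * F x) (fun x => (p x : ℂ) * f x + (p' x : ℂ) * F x) := by
  refine IsACDeriv.of_le fun a b ha hab => ?_
  have hsub : Icc a b ⊆ Ioi 0 := fun x hx => ha.trans_le hx.1
  have hpc : ContinuousOn p (Icc a b) := fun x hx =>
    (hp x (hsub hx)).continuousAt.continuousWithinAt
  obtain ⟨C, hC⟩ := isCompact_Icc.exists_bound_of_continuousOn hpc
  have h1 : IntegrableOn (fun x => (p x : ℂ) * f x) (Ioc a b) := by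
    refine Integrable.bdd_mul (c := C) (h.integrableOn ha hab)
      (Complex.continuous_ofReal.comp_aestronglyMeasurable
        ((hpc.mono Ioc_subset_Icc_self).aestronglyMeasurable measurableSet_Ioc)) ?_
    filter_upwards [ae_restrict_mem measurableSet_Ioc] with t ht
    rw [Complex.norm_real]
    exact hC t (Ioc_subset_Icc_self ht)
  have h2 : IntegrableOn (fun x => (p' x : ℂ) * F x) (Ioc a b) :=
    ((Complex.continuous_ofReal.comp_continuousOn (hp'.mono hsub)).mul
      (h.continuousOn.mono hsub)).integrableOn_Icc.mono_set Ioc_subset_Icc_self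
  refine ⟨h1.add h2, ?_⟩
  rw [integral_add h1 h2, h.integral_mul ha hab (fun x hx => hp x (hsub hx)) (hp'.mono hsub)]
  ring

lemma IsTestFunction.exists_bound_support {φ : ℝ → ℂ} (h : IsTestFunction φ) :
    ∃ b, 0 < b ∧ ∀ t, b ≤ t → φ t = 0 ∧ deriv φ t = 0 := by
  obtain ⟨a, b, ha, hab, -, h2⟩ := h.exists_support
  refine ⟨b + 1, by linarith, fun t ht => ⟨h2 t (by linarith), ?_⟩⟩
  have : φ =ᶠ[𝓝 t] fun _ => 0 := by
    filter_upwards [Ioi_mem_nhds (show b < t by linarith)] with s hs using h2 s (le_of_lt hs)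
  rw [this.deriv_eq, deriv_const]

lemma memLp_of_continuous_of_support {ψ : ℝ → ℂ} (hψ : Continuous ψ) {b : ℝ} (hs : ∀ t, b ≤ t → ψ t = 0) :
    MemLp ψ 2 halfLine := by
  refine (memLp_two_iff_integrable_sq_norm hψ.aestronglyMeasurable).2 ?_
  have hc : IntegrableOn (fun t => ‖ψ t‖ ^ 2) (Ioc 0 b) :=
    (hψ.norm.pow 2).continuousOn.integrableOn_Icc.mono_set Ioc_subset_Icc_self
  refine (integrable_indicator_halfLine measurableSet_Ioc hc).congr ?_
  filter_upwards [ae_halfLine_pos] with t ht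
  by_cases htb : t ≤ b
  · rw [indicator_of_mem (show t ∈ Ioc 0 b from ⟨ht, htb⟩)]
  · rw [indicator_of_notMem (fun hh => htb hh.2), hs t (not_le.1 htb).le]; simp

namespace IsLegendre

variable {ν : ℝ} {P P1 P2 : ℝ → ℝ} {M : ℝ}

lemma kernelInt_swap_eq_zero (P1 : ℝ → ℝ) {g : ℝ → ℂ} {b : ℝ} (hs : ∀ t, b ≤ t → g t = 0) {t : ℝ}
    (ht : b ≤ t) : kernelInt (fun x t => legendreKernel P1 t x) g t = 0 := by
  refine integral_eq_zero_of_ae (Eventually.of_forall fun s => ?_)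
  rcases le_or_gt s t with hst | hst
  · simp [legendreKernel_of_le P1 hst]
  · simp [hs s (ht.trans hst.le)]

/-- Integration by parts with (tφ)' = φ + tφ'. It presents x(1-K*)φ(x) as an integral of the type of
₁S₋, whose local absolute continuity is already known. -/
lemma integral_Ioi_eq_mul_sub (h : IsLegendre ν P P1 P2) {φ : ℝ → ℂ} (hφ : IsTestFunction φ)
    {x : ℝ} (hx : 0 < x) : -∫ t in Ioi x, (P (x / t) : ℂ) * (φ t + t * deriv φ t)
      = x * (φ x - kernelInt (fun x t => legendreKernel P1 t x) φ x) := by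
  obtain ⟨b, hb0, hb⟩ := hφ.exists_bound_support
  set T := max x b
  have hxT : x ≤ T := le_max_left _ _
  have hT : ∀ t, T ≤ t → φ t = 0 ∧ deriv φ t = 0 := fun t ht => hb t ((le_max_right _ _).trans ht)
  have hac : IsACDeriv (fun t => ((id t : ℝ) : ℂ) * φ t)
      (fun t => ((id t : ℝ) : ℂ) * deriv φ t + ((1 : ℝ) : ℂ) * φ t) :=
    hφ.isACDeriv.mul (fun t _ => hasDerivAt_id t) continuousOn_const
  have hsub : Icc x T ⊆ Ioi 0 := fun t ht => hx.trans_le ht.1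
  have hc : ContinuousOn (fun t => -(P1 (x / t) * x / t ^ 2)) (Icc x T) := by
    have : ContinuousOn (fun t => -(P1 (x / t) / t * (x / t))) (Icc x T) :=
      (((h.continuousOn_deriv_comp_div' hx).mono hsub).mul
        (continuousOn_const.div continuousOn_id fun y hy => (hx.trans_le hy.1).ne')).neg
    exact this.congr fun y hy => by ring
  have key := hac.integral_mul hx hxT (p := fun t => P (x / t))
    (p' := fun t => -(P1 (x / t) * x / t ^ 2))
    (fun t ht => h.hasDerivAt_comp_div' hx (hsub ht)) hc
  have hP1 : P (x / x) = 1 := by rw [div_self hx.ne', h.map_one]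
  rw [kernelInt_legendreKernel_swap _ _ hx,
    setIntegral_Ioi_of_support (T := T) fun t ht => by rw [(hT t ht).1, (hT t ht).2]; simp,
    setIntegral_Ioi_of_support (T := T) fun t ht => by rw [(hT t ht).1]; simp]
  have e1 : ∫ t in Ioc x T, (P (x / t) : ℂ) * (φ t + t * deriv φ t)
      = ∫ t in Ioc x T, (P (x / t) : ℂ) * (((id t : ℝ) : ℂ) * deriv φ t + ((1 : ℝ) : ℂ) * φ t) := by
    refine setIntegral_congr_fun measurableSet_Ioc fun t _ => ?_
    simp only [id]
    push_cast
    ring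
  have e2 : ∫ t in Ioc x T, ((-(P1 (x / t) * x / t ^ 2) : ℝ) : ℂ) * (((id t : ℝ) : ℂ) * φ t)
      = -(x : ℂ) * ∫ t in Ioc x T, ((P1 (x / t) / t : ℝ) : ℂ) * φ t := by
    rw [← integral_const_mul]
    refine setIntegral_congr_fun measurableSet_Ioc fun t ht => ?_
    have ht0 : (t : ℂ) ≠ 0 := by exact_mod_cast (hx.trans ht.1).ne'
    simp only [id]
    push_cast
    field_simp
  rw [e1, key, e2, hP1, (hT T le_rfl).1]
  simp only [id]
  push_cast
  ring

/-- For ₁P₋ to act on (1-K*)φ, this function must be locally absolutely continuous; it is, as 1/x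
times an integral of the type of ₁S₋. Its derivative inherits the bounded support. -/
lemma exists_isACDeriv_sub_kernelInt (h : IsLegendre ν P P1 P2) {φ : ℝ → ℂ} (hφ : IsTestFunction φ) : ∃ f₁ : ℝ → ℂ,
    IsACDeriv (fun x => φ x - kernelInt (fun x t => legendreKernel P1 t x) φ x) f₁ ∧
      ∃ b, 0 < b ∧ (∀ t, b ≤ t → φ t = 0) ∧ ∀ t, b ≤ t → f₁ t = 0 := by
  obtain ⟨b, hb0, hb⟩ := hφ.exists_bound_support
  set ψ : ℝ → ℂ := fun t => φ t + t * deriv φ t with hψ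
  have hψs : ∀ t, b ≤ t → ψ t = 0 := fun t ht => by
    simp only [hψ]; rw [(hb t ht).1, (hb t ht).2]; simp
  have hψc : Continuous ψ := hφ.contDiff.continuous.add
    (Complex.continuous_ofReal.mul hφ.continuous_deriv)
  have hψm : MemLp ψ 2 halfLine := memLp_of_continuous_of_support hψc hψs
  have hi : ∀ x, 0 < x → IntegrableOn (fun t => (P (x / t) : ℂ) * ψ t) (Ioi x) := fun x hx =>
    integrableOn_Ioi_mul_of_support hx (h.continuousOn_comp_div' hx)
      (hψm.integrableOn_Ioo hx.le) hψs
  have hac := (h.isACDeriv_integral_Ioi hψm hi).mul (p := fun x => x⁻¹)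
    (p' := fun x => -(x ^ 2)⁻¹) (fun x hx => hasDerivAt_inv hx.ne')
    ((continuousOn_inv₀.comp (continuousOn_pow 2)
      fun x hx => pow_ne_zero 2 (ne_of_gt hx)).neg)
  refine ⟨_, hac.congr (fun x hx => ?_) (EventuallyEq.refl _ _), b, hb0, fun t ht => (hb t ht).1,
    fun t ht => ?_⟩
  · have hx0 : (x : ℂ) ≠ 0 := by exact_mod_cast hx.ne'
    rw [h.integral_Ioi_eq_mul_sub hφ hx]
    push_cast
    field_simp
  · have ht0 : 0 < t := hb0.trans_le ht
    rw [hψs t ht, kernelInt_swap_eq_zero P1 hψs ht, h.integral_Ioi_eq_mul_sub hφ ht0, (hb t ht).1,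
      kernelInt_swap_eq_zero P1 (fun t ht => (hb t ht).1) ht]
    simp

lemma integrable_majorant_swap_mul_of_support (h : IsLegendre ν P P1 P2) {φ : ℝ → ℂ} {x b : ℝ}
    (hx : 0 < x) (hφ : MemLp φ 2 halfLine) (hs : ∀ t, b ≤ t → φ t = 0) :
    Integrable (fun t => majorant P t x * ‖φ t‖) halfLine := by
  have hc : ContinuousOn (fun t => |P (t / x) - 1| / t) (Ioi 0) :=
    ((h.continuousOn_comp_div hx).sub continuousOn_const).abs.div continuousOn_id
      fun t ht => ne_of_gt ht
  have h1 := (integrableOn_Ioi_mul_of_support hx hc (hφ.integrableOn_Ioo hx.le) hs).norm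
  refine (integrable_indicator_halfLine measurableSet_Ioi h1).congr ?_
  filter_upwards [ae_halfLine_pos] with t ht
  by_cases hxt : x < t
  · rw [indicator_of_mem (show t ∈ Ioi x from hxt), majorant_of_lt hx hxt, norm_mul,
      Complex.norm_real, Real.norm_of_nonneg (by positivity)]
  · rw [indicator_of_notMem (by simpa using hxt), majorant_of_le (not_lt.1 hxt), zero_mul]

lemma integrable_legendreKernelInv_swap_mul_of_support (h : IsLegendre ν P P1 P2) {φ : ℝ → ℂ}
    {x b : ℝ} (hx : 0 < x) (hφ : MemLp φ 2 halfLine) (hs : ∀ t, b ≤ t → φ t = 0) :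
    Integrable (fun t => (legendreKernelInv P1 t x : ℂ) * φ t) halfLine := by
  have h1 := integrableOn_Ioi_mul_of_support hx (h.continuousOn_deriv_comp_div hx)
    (hφ.integrableOn_Ioo hx.le) hs
  refine (integrable_indicator_halfLine measurableSet_Ioi h1).congr ?_
  filter_upwards [ae_halfLine_pos] with t ht
  by_cases hxt : x < t
  · rw [indicator_of_mem (show t ∈ Ioi x from hxt), legendreKernelInv_of_lt _ hx hxt]
  · rw [indicator_of_notMem (by simpa using hxt), legendreKernelInv_of_le _ (not_lt.1 hxt)]; simp

/-- (1-K*)φ vanishes for large t, so integration by parts has no boundary term at infinity and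
₁P₋(1-K*)φ = (1+L*)(1-K*)φ = φ. -/
lemma Pminus_of_isTestFunction (h : IsLegendre ν P P1 P2) (hk : IsCarleman (legendreKernel P1) M)
    {f : HalfLineL2} {φ : ℝ → ℂ} (hφ : IsTestFunction φ) (hf : φ =ᵐ[halfLine] f) :
    Pminus ν (f - kernelOp hk.swap f) f := by
  have hm : MemLp φ 2 halfLine := (Lp.memLp f).ae_eq hf.symm
  obtain ⟨f₁, hac, b, hb0, hb, hf1⟩ := h.exists_isACDeriv_sub_kernelInt hφ
  have e : ∀ x, 0 < x → EqOn (fun t => (legendreP ν (t / x) : ℂ) * -f₁ t)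
      (fun t => -((P (t / x) : ℂ) * f₁ t)) (Ioi x) := fun x hx t ht => by
    dsimp only
    rw [h.legendreP_eq _ (div_pos (hx.trans ht) hx), mul_neg]
  set K := kernelInt (fun x t => legendreKernel P1 t x) φ with hK
  have hKs : ∀ t, b ≤ t → K t = 0 := fun t ht => kernelInt_swap_eq_zero P1 hb ht
  have hKm : MemLp K 2 halfLine := hk.swap.memLp_kernelInt hm
  have hi : ∀ x, 0 < x → IntegrableOn (fun t => (P (t / x) : ℂ) * f₁ t) (Ioi x) := fun x hx => by
    have h1 : IntegrableOn f₁ (Ioo x (max x b)) :=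
      (hac.integrableOn hx (le_max_left _ _)).mono_set Ioo_subset_Ioc_self
    exact integrableOn_Ioi_mul_of_support hx (h.continuousOn_comp_div hx) h1
      fun t ht => hf1 t ((le_max_right _ _).trans ht)
  refine ⟨fun x => φ x - K x, f₁, ?_, hac, fun x hx =>
    (integrableOn_congr_fun (e x hx) measurableSet_Ioi).2 (hi x hx).neg, ?_⟩
  · filter_upwards [coeFn_sub_kernelOp hk.swap f, hf] with x e1 e2
    rw [e1, ← e2, hK, kernelInt_congr _ hf]
  · filter_upwards [hf, ae_halfLine_pos] with x e1 hx
    rw [setIntegral_congr_fun measurableSet_Ioi (e x hx), integral_neg, ← e1]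
    set T := max x b
    have hxT : x ≤ T := le_max_left _ _
    have hT : ∀ t, T ≤ t → b ≤ t := fun t ht => (le_max_right _ _).trans ht
    have hP1 : P (x / x) = 1 := by rw [div_self hx.ne', h.map_one]
    have key := hac.integral_mul hx hxT (p := fun t => P (t / x))
      (p' := fun t => P1 (t / x) / x) (fun t ht => h.hasDerivAt_comp_div hx (hx.trans_le ht.1))
      ((h.continuousOn_deriv_comp_div hx).mono fun t ht => hx.trans_le ht.1)
    have hL : kernelInt (fun x t => legendreKernelInv P1 t x) (fun t => φ t - K t) x
        = ∫ t in Ioc x T, ((P1 (t / x) / x : ℝ) : ℂ) * (φ t - K t) := by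
      rw [kernelInt_legendreKernelInv_swap _ _ hx]
      exact setIntegral_Ioi_of_support fun t ht => by
        rw [hb t (hT t ht), hKs t (hT t ht)]; simp
    have hc := (h.kernelInt_comp_majorant_swap hk hm hx
      (h.integrable_majorant_swap_mul_of_support hx hm hb)).2
    rw [kernelInt_sub (h.integrable_legendreKernelInv_swap_mul_of_support hx hm hb)
      (h.integrable_legendreKernelInv_swap_mul_of_support hx hKm hKs), hK, hc, ← hK] at hL
    rw [setIntegral_Ioi_of_support (T := T) fun t ht => by rw [hf1 t (hT t ht), mul_zero], key, ← hL,
      hb T (hT T le_rfl), hKs T (hT T le_rfl), hP1]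
    push_cast
    ring

end IsLegendre

/-! ### Density of the test functions. -/

lemma isTestFunction_ofReal {g : ℝ → ℝ} (hg : ContDiff ℝ 2 g) (hc : HasCompactSupport g)
    (hs : tsupport g ⊆ Ioi 0) : IsTestFunction fun t => (g t : ℂ) := by
  refine ⟨Complex.ofRealCLM.contDiff.comp hg, ?_⟩
  have h0 : ∀ t, t ∉ tsupport g → (g t : ℂ) = 0 := fun t ht => by
    rw [image_eq_zero_of_notMem_tsupport ht, Complex.ofReal_zero]
  rcases (tsupport g).eq_empty_or_nonempty with he | hne
  · exact ⟨1, 2, one_pos, one_lt_two, fun t _ => h0 t (by simp [he]),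
      fun t _ => h0 t (by simp [he])⟩
  · obtain ⟨a, ha⟩ := hc.isCompact.exists_isLeast hne
    obtain ⟨b, hb⟩ := hc.isCompact.exists_isGreatest hne
    have ha0 : 0 < a := hs ha.1
    have hab : a ≤ b := ha.2 hb.1
    refine ⟨a / 2, b + 1, by linarith, by linarith, fun t ht => h0 t fun hm => ?_,
      fun t ht => h0 t fun hm => ?_⟩
    · linarith [ha.2 hm]
    · linarith [hb.2 hm]

/-- The classes of test functions. -/
def testFunctions : Submodule ℂ HalfLineL2 where
  carrier := {f | ∃ φ, IsTestFunction φ ∧ φ =ᵐ[halfLine] f}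
  add_mem' := by
    rintro f g ⟨φ, hφ, hf⟩ ⟨ψ, hψ, hg⟩
    obtain ⟨a, b, ha, hab, h1, h2⟩ := hφ.exists_support
    obtain ⟨a', b', ha', hab', h1', h2'⟩ := hψ.exists_support
    refine ⟨φ + ψ, ⟨hφ.contDiff.add hψ.contDiff, min a a', max b b', lt_min ha ha',
      (min_le_left _ _).trans_lt (hab.trans_le (le_max_left _ _)), fun t ht => ?_, fun t ht => ?_⟩,
      (hf.add hg).trans (Lp.coeFn_add f g).symm⟩
    · rw [Pi.add_apply, h1 t (ht.trans (min_le_left _ _)), h1' t (ht.trans (min_le_right _ _)),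
        add_zero]
    · rw [Pi.add_apply, h2 t ((le_max_left _ _).trans ht), h2' t ((le_max_right _ _).trans ht),
        add_zero]
  zero_mem' := ⟨0, ⟨contDiff_const, 1, 2, one_pos, one_lt_two, fun _ _ => rfl, fun _ _ => rfl⟩,
    (Lp.coeFn_zero ℂ 2 halfLine).symm⟩
  smul_mem' := by
    rintro c f ⟨φ, hφ, hf⟩
    obtain ⟨a, b, ha, hab, h1, h2⟩ := hφ.exists_support
    exact ⟨c • φ, ⟨contDiff_const.smul hφ.contDiff, a, b, ha, hab,
      fun t ht => by rw [Pi.smul_apply, h1 t ht, smul_zero],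
      fun t ht => by rw [Pi.smul_apply, h2 t ht, smul_zero]⟩,
      (hf.const_smul c).trans (Lp.coeFn_smul c f).symm⟩

/-- A vector orthogonal to all test functions vanishes almost everywhere, by the fundamental lemma
of the calculus of variations on (0, ∞). -/
lemma dense_testFunctions : Dense (testFunctions : Set HalfLineL2) := by
  rw [Submodule.dense_iff_topologicalClosure_eq_top, Submodule.topologicalClosure_eq_top_iff,
    Submodule.eq_bot_iff]
  intro v hv
  have hl : LocallyIntegrable v halfLine := (Lp.memLp v).locallyIntegrable (by norm_num)
  have h0 := isOpen_Ioi.ae_eq_zero_of_integral_contDiff_smul_eq_zero (U := Ioi (0 : ℝ))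
    (μ := halfLine) (hl.locallyIntegrableOn _) fun g hg hc hs => by
      have hφ := isTestFunction_ofReal (hg.of_le (by norm_cast)) hc hs
      obtain ⟨a, b, -, -, -, h2⟩ := hφ.exists_support
      have hm : MemLp (fun t => (g t : ℂ)) 2 halfLine :=
        memLp_of_continuous_of_support hφ.contDiff.continuous h2
      have hmem : hm.toLp _ ∈ testFunctions := ⟨_, hφ, hm.coeFn_toLp.symm⟩
      rw [← (Submodule.mem_orthogonal _ _).1 hv _ hmem, L2.inner_def]
      refine integral_congr_ae ?_
      filter_upwards [hm.coeFn_toLp] with t ht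
      rw [ht, RCLike.inner_apply', Complex.real_smul, Complex.conj_ofReal]
  refine Lp.ext ?_
  filter_upwards [h0, ae_halfLine_pos, Lp.coeFn_zero ℂ 2 halfLine] with x h1 h2 h3
  rw [h1 h2, h3, Pi.zero_apply]

/-! ### Norms of an operator A with A*A = 1 - (s/π)C and of its inverse. -/

/-- The operator `A` satisfies `A* A = 1 - (s / π) C` for the Carleman operator `C`, and its range
is dense. -/
structure IsCarlemanFactor (s : ℝ) (A : HalfLineL2 →L[ℂ] HalfLineL2) : Prop where
  norm_sq : ∀ f, ‖A f‖ ^ 2 = ‖f‖ ^ 2 - s / Real.pi * carlemanForm f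
  denseRange : DenseRange A

/-- If Af = 0, then π‖f‖² is s times the form of C, hence at most that form as s ≤ 1. So Hilbert's
inequality is an equality for f. For s = 1 there is no lower bound for A that could be used instead.
-/
lemma eq_zero_of_norm_sq {s : ℝ} (hs : s ≤ 1) {A : HalfLineL2 →L[ℂ] HalfLineL2}
    (hA : ∀ f, ‖A f‖ ^ 2 = ‖f‖ ^ 2 - s / Real.pi * carlemanForm f) {f : HalfLineL2}
    (hf : A f = 0) : f = 0 := by
  have h1 := hA f
  rw [hf, norm_zero, zero_pow two_ne_zero] at h1
  have hq := carlemanForm_nonneg f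
  have hq' := carlemanForm_le f
  have hpi := Real.pi_pos
  refine eq_zero_of_carlemanForm_eq (le_antisymm hq' ?_)
  have : Real.pi * ‖f‖ ^ 2 = s * carlemanForm f := by
    field_simp at h1
    linarith
  rw [this]
  nlinarith

/-- The orthogonal complement of the range of A is the kernel of its adjoint B, and B is injective.
-/
lemma isCarlemanFactor_of_adjoint {s : ℝ} (hs : s ≤ 1) {A B : HalfLineL2 →L[ℂ] HalfLineL2}
    (hA : ∀ f, ‖A f‖ ^ 2 = ‖f‖ ^ 2 - s / Real.pi * carlemanForm f)
    (hB : ∀ f, ‖B f‖ ^ 2 = ‖f‖ ^ 2 - s / Real.pi * carlemanForm f)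
    (hAB : ContinuousLinearMap.adjoint A = B) : IsCarlemanFactor s A := by
  refine ⟨hA, ?_⟩
  have h1 : Dense ((LinearMap.range (A : HalfLineL2 →ₗ[ℂ] HalfLineL2) :
      Submodule ℂ HalfLineL2) : Set HalfLineL2) := by
    rw [Submodule.dense_iff_topologicalClosure_eq_top, Submodule.topologicalClosure_eq_top_iff,
      Submodule.eq_bot_iff]
    intro v hv
    refine eq_zero_of_norm_sq hs hB ?_
    rw [← hAB, ← inner_self_eq_zero (𝕜 := ℂ), ContinuousLinearMap.adjoint_inner_right]
    exact (Submodule.mem_orthogonal _ _).1 hv _ ⟨_, rfl⟩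
  exact h1

namespace IsCarlemanFactor

variable {s : ℝ} {A : HalfLineL2 →L[ℂ] HalfLineL2}

lemma eq_zero (hA : IsCarlemanFactor s A) (hs : s ≤ 1) {f : HalfLineL2} (hf : A f = 0) : f = 0 :=
  eq_zero_of_norm_sq hs hA.norm_sq hf

/-- With r the form of C divided by π, 0 ≤ r ≤ ‖f‖² and ‖Af‖² = ‖f‖² - s r lies between ‖f‖² and
(1-s)‖f‖²; the sign of s decides which is larger. The lower bound `le_norm` is the same. -/
lemma norm_le (hA : IsCarlemanFactor s A) (hs : s ≤ 1) (f : HalfLineL2) :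
    ‖A f‖ ≤ max 1 √(1 - s) * ‖f‖ := by
  have h1 := hA.norm_sq f
  have hq := carlemanForm_nonneg f
  have hq' := carlemanForm_le f
  have hpi := Real.pi_pos
  have hm1 : 1 ≤ max 1 √(1 - s) := le_max_left _ _
  have hm2 : 1 - s ≤ max 1 √(1 - s) ^ 2 :=
    (Real.sq_sqrt (sub_nonneg.2 hs)).symm.trans_le
      (pow_le_pow_left₀ (Real.sqrt_nonneg _) (le_max_right _ _) 2)
  have hm3 : 1 ≤ max 1 √(1 - s) ^ 2 := one_le_pow₀ hm1
  refine (pow_le_pow_iff_left₀ (norm_nonneg _) (by positivity) two_ne_zero).1 ?_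
  rw [mul_pow, h1]
  have e : s / Real.pi * carlemanForm f = s * (carlemanForm f / Real.pi) := by ring
  have hr : carlemanForm f / Real.pi ≤ ‖f‖ ^ 2 := by rw [div_le_iff₀ hpi]; linarith
  have hr0 : 0 ≤ carlemanForm f / Real.pi := by positivity
  rw [e]
  rcases le_total 0 s with h0 | h0
  · nlinarith [mul_nonneg h0 hr0, sq_nonneg ‖f‖]
  · nlinarith [mul_nonneg (neg_nonneg.2 h0) (sub_nonneg.2 hr), sq_nonneg ‖f‖]

lemma le_norm (hA : IsCarlemanFactor s A) (hs : s ≤ 1) (f : HalfLineL2) :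
    min 1 √(1 - s) * ‖f‖ ≤ ‖A f‖ := by
  have h1 := hA.norm_sq f
  have hq := carlemanForm_nonneg f
  have hq' := carlemanForm_le f
  have hpi := Real.pi_pos
  have hm0 : 0 ≤ min 1 √(1 - s) := le_min zero_le_one (Real.sqrt_nonneg _)
  have hm1 : min 1 √(1 - s) ≤ 1 := min_le_left _ _
  have hm2 : min 1 √(1 - s) ^ 2 ≤ 1 - s :=
    (pow_le_pow_left₀ hm0 (min_le_right _ _) 2).trans_eq (Real.sq_sqrt (sub_nonneg.2 hs))
  have hm3 : min 1 √(1 - s) ^ 2 ≤ 1 := pow_le_one₀ hm0 hm1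
  refine (pow_le_pow_iff_left₀ (by positivity) (norm_nonneg _) two_ne_zero).1 ?_
  rw [mul_pow, h1]
  have e : s / Real.pi * carlemanForm f = s * (carlemanForm f / Real.pi) := by ring
  have hr : carlemanForm f / Real.pi ≤ ‖f‖ ^ 2 := by rw [div_le_iff₀ hpi]; linarith
  have hr0 : 0 ≤ carlemanForm f / Real.pi := by positivity
  rw [e]
  rcases le_total 0 s with h0 | h0
  · nlinarith [mul_nonneg h0 (sub_nonneg.2 hr), sq_nonneg ‖f‖]
  · nlinarith [mul_nonneg (neg_nonneg.2 h0) hr0, sq_nonneg ‖f‖]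

/-- Both endpoints of the spectrum of `A* A` are approximate eigenvalues. -/
lemma exists_abs_sub_le (hA : IsCarlemanFactor s A) (hs : |s| ≤ 1) {v δ : ℝ}
    (hv : v = 1 ∨ v = 1 - s) (hδ : 0 < δ) :
    ∃ f : HalfLineL2, 0 < ‖f‖ ∧ |‖A f‖ ^ 2 - v * ‖f‖ ^ 2| ≤ δ * ‖f‖ ^ 2 := by
  have hpi := Real.pi_pos
  have hpi1 : 1 ≤ Real.pi := by linarith [Real.pi_gt_three]
  rcases hv with rfl | rfl
  · obtain ⟨f, hf, h⟩ := exists_carlemanForm_le hδ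
    refine ⟨f, norm_pos_iff.2 hf, ?_⟩
    have hq := carlemanForm_nonneg f
    have e : ‖A f‖ ^ 2 - 1 * ‖f‖ ^ 2 = -(s * (carlemanForm f / Real.pi)) := by
      rw [hA.norm_sq]; ring
    have : carlemanForm f / Real.pi ≤ carlemanForm f := div_le_self hq hpi1
    rw [e, abs_neg, abs_mul, abs_of_nonneg (div_nonneg hq hpi.le)]
    calc |s| * (carlemanForm f / Real.pi) ≤ 1 * (carlemanForm f / Real.pi) := by gcongr
      _ ≤ _ := by linarith
  · obtain ⟨f, hf, h⟩ := exists_le_carlemanForm hδ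
    refine ⟨f, norm_pos_iff.2 hf, ?_⟩
    have hq := carlemanForm_le f
    have e : ‖A f‖ ^ 2 - (1 - s) * ‖f‖ ^ 2
        = s * ((Real.pi * ‖f‖ ^ 2 - carlemanForm f) / Real.pi) := by
      rw [hA.norm_sq]; field_simp; ring
    have h0 : 0 ≤ Real.pi * ‖f‖ ^ 2 - carlemanForm f := by linarith
    have := div_le_self h0 hpi1
    rw [e, abs_mul, abs_of_nonneg (div_nonneg h0 hpi.le)]
    calc |s| * ((Real.pi * ‖f‖ ^ 2 - carlemanForm f) / Real.pi)
        ≤ 1 * ((Real.pi * ‖f‖ ^ 2 - carlemanForm f) / Real.pi) := by gcongr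
      _ ≤ _ := by linarith

end IsCarlemanFactor

lemma sq_max_one_sqrt {s : ℝ} (hs : s ≤ 1) :
    max 1 √(1 - s) ^ 2 = 1 ∨ max 1 √(1 - s) ^ 2 = 1 - s := by
  rcases max_choice 1 √(1 - s) with h | h
  · left; rw [h, one_pow]
  · right; rw [h, Real.sq_sqrt (sub_nonneg.2 hs)]

lemma sq_min_one_sqrt {s : ℝ} (hs : s ≤ 1) :
    min 1 √(1 - s) ^ 2 = 1 ∨ min 1 √(1 - s) ^ 2 = 1 - s := by
  rcases min_choice 1 √(1 - s) with h | h
  · left; rw [h, one_pow]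
  · right; rw [h, Real.sq_sqrt (sub_nonneg.2 hs)]

/-- The relation `T` is contained in the graph of `A` and contains it on a dense subset. -/
structure IsRestrictionOf (T : HalfLineL2 → HalfLineL2 → Prop) (A : HalfLineL2 →L[ℂ] HalfLineL2) :
    Prop where
  eq_apply : ∀ f g, T f g → g = A f
  dense : Dense {f | T f (A f)}

namespace IsRestrictionOf

variable {T : HalfLineL2 → HalfLineL2 → Prop} {A : HalfLineL2 →L[ℂ] HalfLineL2} {s : ℝ}

lemma isDenselyDefined (h : IsRestrictionOf T A) : IsDenselyDefined T :=
  ⟨fun f g g' h1 h2 => (h.eq_apply f g h1).trans (h.eq_apply f g' h2).symm,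
    h.dense.mono fun f hf => ⟨A f, hf⟩⟩

lemma isBoundedInL2 (h : IsRestrictionOf T A) : IsBoundedInL2 T :=
  ⟨A, fun f g hfg => (h.eq_apply f g hfg).symm⟩

/-- A bound on a dense set passes to all f by continuity of A, where vectors approaching the larger
end of the spectrum test it. -/
lemma l2Norm_eq (h : IsRestrictionOf T A) (hA : IsCarlemanFactor s A) (hs : |s| ≤ 1) :
    l2Norm T = ENNReal.ofReal (max 1 √(1 - s)) := by
  have hs1 := (le_abs_self s).trans hs
  refine le_antisymm (sInf_le fun f g hfg => ?_) (le_sInf fun C hC => ?_)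
  · rw [h.eq_apply f g hfg, ← ofReal_norm, ← ofReal_norm,
      ← ENNReal.ofReal_mul (by positivity)]
    exact ENNReal.ofReal_le_ofReal (hA.norm_le hs1 f)
  · induction C with
    | top => exact le_top
    | coe C =>
      have hall : ∀ f, ‖A f‖ ≤ C * ‖f‖ := by
        have hcl : IsClosed {f : HalfLineL2 | ‖A f‖ ≤ C * ‖f‖} :=
          isClosed_le (by fun_prop) (by fun_prop)
        intro f
        refine hcl.closure_subset_iff.2 (fun f hf => ?_) (h.dense f)
        have := hC f (A f) hf
        rw [enorm_eq_nnnorm, enorm_eq_nnnorm, ← ENNReal.coe_mul, ENNReal.coe_le_coe] at this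
        exact_mod_cast this
      rw [← ENNReal.ofReal_coe_nnreal]
      refine ENNReal.ofReal_le_ofReal ?_
      by_contra! hlt
      have hlt2 : (C : ℝ) ^ 2 < max 1 √(1 - s) ^ 2 :=
        pow_lt_pow_left₀ hlt C.coe_nonneg two_ne_zero
      obtain ⟨f, hf, hfa⟩ := hA.exists_abs_sub_le hs (sq_max_one_sqrt hs1)
        (half_pos (sub_pos.2 hlt2))
      have h1 := pow_le_pow_left₀ (norm_nonneg _) (hall f) 2
      have h2 := (abs_le.1 hfa).1
      have h3 : 0 < ‖f‖ ^ 2 := by positivity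
      rw [mul_pow] at h1
      nlinarith

/-- Single-valuedness is injectivity of A. The domain contains the image under A of a dense set,
which is dense as A has dense range. -/
lemma isDenselyDefined_of_inverse (h : IsRestrictionOf (fun f g => T g f) A)
    (hA : IsCarlemanFactor s A) (hs : |s| ≤ 1) :
    IsDenselyDefined T := by
  refine ⟨fun f g g' h1 h2 => ?_, ?_⟩
  · have e : A g = A g' := (h.eq_apply g f h1).symm.trans (h.eq_apply g' f h2)
    rw [← sub_eq_zero]
    exact hA.eq_zero ((le_abs_self s).trans hs) (by rw [map_sub, e, sub_self])
  · refine (hA.denseRange.dense_image A.continuous h.dense).mono ?_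
    rintro _ ⟨f, hf, rfl⟩
    exact ⟨f, hf⟩

lemma l2Norm_eq_of_inverse (h : IsRestrictionOf (fun f g => T g f) A)
    (hA : IsCarlemanFactor s A) (hs : |s| ≤ 1) :
    l2Norm T = 1 / ENNReal.ofReal (min 1 √(1 - s)) := by
  have hs1 := (le_abs_self s).trans hs
  have hm0 : 0 ≤ min 1 √(1 - s) := le_min zero_le_one (Real.sqrt_nonneg _)
  refine le_antisymm (sInf_le fun f g hfg => ?_) (le_sInf fun C hC => ?_)
  · have h1 := ENNReal.ofReal_le_ofReal (hA.le_norm hs1 g)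
    rw [← h.eq_apply g f hfg, ENNReal.ofReal_mul hm0, ofReal_norm,
      ofReal_norm] at h1
    -- The minimum vanishes when s = 1. The claim is then a bound by ∞ · ‖f‖, which has content only
    -- for f = 0, where injectivity of A gives g = 0.
    rcases eq_or_ne (ENNReal.ofReal (min 1 √(1 - s))) 0 with h0 | h0
    · rw [h0, ENNReal.div_zero one_ne_zero]
      rcases eq_or_ne ‖f‖ₑ 0 with hf | hf
      · have : f = 0 := enorm_eq_zero.1 hf
        have hg : A g = 0 := by rw [← h.eq_apply g f hfg, this]
        rw [hA.eq_zero hs1 hg]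
        simp
      · rw [ENNReal.top_mul hf]
        exact le_top
    · rw [one_div]
      calc ‖g‖ₑ = (ENNReal.ofReal (min 1 √(1 - s)))⁻¹ *
            (ENNReal.ofReal (min 1 √(1 - s)) * ‖g‖ₑ) := by
            rw [← mul_assoc, ENNReal.inv_mul_cancel h0 ENNReal.ofReal_ne_top, one_mul]
        _ ≤ _ := by gcongr
  · induction C with
    | top => exact le_top
    | coe C =>
      have hall : ∀ f, ‖f‖ ≤ C * ‖A f‖ := by
        have hcl : IsClosed {f : HalfLineL2 | ‖f‖ ≤ C * ‖A f‖} :=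
          isClosed_le (by fun_prop) (by fun_prop)
        intro f
        refine hcl.closure_subset_iff.2 (fun f hf => ?_) (h.dense f)
        have := hC (A f) f hf
        rw [enorm_eq_nnnorm, enorm_eq_nnnorm, ← ENNReal.coe_mul, ENNReal.coe_le_coe] at this
        exact_mod_cast this
      have key : 1 ≤ C * min 1 √(1 - s) := by
        by_contra! hlt
        have hlt2 : (C * min 1 √(1 - s)) ^ 2 < 1 :=
          pow_lt_one₀ (by positivity) hlt two_ne_zero
        rw [mul_pow] at hlt2
        set m := min 1 √(1 - s) ^ 2
        -- Chosen so that C²δ ≤ (1 - C²m)/2; then ‖f‖² ≤ C²‖Af‖² ≤ C²(m + δ)‖f‖² < ‖f‖² is a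
        -- contradiction.
        have hδ : 0 < (1 - C ^ 2 * m) / (2 * (C ^ 2 + 1)) := by
          have : 0 < 1 - (C : ℝ) ^ 2 * m := by linarith
          positivity
        obtain ⟨f, hf, hfa⟩ := hA.exists_abs_sub_le hs (sq_min_one_sqrt hs1) hδ
        have h1 := pow_le_pow_left₀ (norm_nonneg _) (hall f) 2
        have h2 := (abs_le.1 hfa).2
        have h3 : 0 < ‖f‖ ^ 2 := by positivity
        rw [mul_pow] at h1
        have h4 : (C : ℝ) ^ 2 * ((1 - C ^ 2 * m) / (2 * (C ^ 2 + 1))) ≤ (1 - C ^ 2 * m) / 2 := by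
          rw [mul_div_assoc', div_le_div_iff₀ (by positivity) two_pos]
          nlinarith
        have h5 : (C : ℝ) ^ 2 * ‖A f‖ ^ 2 ≤ C ^ 2 * (m * ‖f‖ ^ 2
            + (1 - C ^ 2 * m) / (2 * (C ^ 2 + 1)) * ‖f‖ ^ 2) := by
          gcongr
          linarith
        nlinarith
      refine ENNReal.div_le_of_le_mul ?_
      rw [← ENNReal.ofReal_coe_nnreal, ← ENNReal.ofReal_mul C.coe_nonneg, ← ENNReal.ofReal_one]
      exact ENNReal.ofReal_le_ofReal key

/-- For s < 1 the operator A is bounded below, so its range is closed; being dense, it is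
everything, and the bounded inverse of A extends T. -/
lemma isBoundedInL2_of_inverse (h : IsRestrictionOf (fun f g => T g f) A)
    (hA : IsCarlemanFactor s A) (hs : s < 1) : IsBoundedInL2 T := by
  have hm : 0 < min 1 √(1 - s) := lt_min one_pos (Real.sqrt_pos.2 (sub_pos.2 hs))
  have hanti : AntilipschitzWith ⟨(min 1 √(1 - s))⁻¹, (inv_pos.2 hm).le⟩ A :=
    ContinuousLinearMap.antilipschitz_of_bound A fun f => by
      have := hA.le_norm hs.le f
      change ‖f‖ ≤ (min 1 √(1 - s))⁻¹ * ‖A f‖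
      rw [inv_mul_eq_div, le_div_iff₀ hm]
      linarith
  have hker : LinearMap.ker (A : HalfLineL2 →ₗ[ℂ] HalfLineL2) = ⊥ :=
    LinearMap.ker_eq_bot.2 hanti.injective
  have hrange : LinearMap.range (A : HalfLineL2 →ₗ[ℂ] HalfLineL2) = ⊤ := by
    have hc : IsClosed (range A) := hanti.isClosed_range A.uniformContinuous
    have : range A = univ := by rw [← hc.closure_eq]; exact hA.denseRange.closure_range
    exact LinearMap.range_eq_top.2 (range_eq_univ.1 this)
  let e := ContinuousLinearEquiv.ofBijective A hker hrange
  refine ⟨(e.symm : HalfLineL2 →L[ℂ] HalfLineL2), fun f g hfg => ?_⟩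
  rw [h.eq_apply g f hfg]
  exact ContinuousLinearEquiv.ofBijective_symm_apply_apply A hker hrange g

end IsRestrictionOf

lemma IsBoundedInL2.l2Norm_ne_top {T : HalfLineL2 → HalfLineL2 → Prop} (h : IsBoundedInL2 T) :
    l2Norm T ≠ ∞ := by
  obtain ⟨B, hB⟩ := h
  refine ne_top_of_le_ne_top (b := (‖B‖₊ : ℝ≥0∞)) ENNReal.coe_ne_top (sInf_le fun f g hfg => ?_)
  rw [← hB f g hfg]
  exact B.le_opENorm f

lemma IsCarleman.adjoint_one_sub {k : ℝ → ℝ → ℝ} {M : ℝ} (hk : IsCarleman k M) :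
    ContinuousLinearMap.adjoint (1 - kernelOp hk) = 1 - kernelOp hk.swap := by
  rw [map_sub, adjoint_kernelOp]
  congr 1
  exact ContinuousLinearMap.adjoint_id

/-! ### The four operators, and the consequences for their norms. -/

/-- The Buschman–Erdélyi operators of zero order are restrictions of `1 - K` and `1 - K*`, or of
their inverses, for the operator `K` with the Legendre kernel. -/
lemma exists_isCarlemanFactor (ν : ℝ) : ∃ A B : HalfLineL2 →L[ℂ] HalfLineL2,
    IsCarlemanFactor (Real.sin (Real.pi * ν)) A ∧ IsCarlemanFactor (Real.sin (Real.pi * ν)) B ∧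
      IsRestrictionOf (P0plus ν) A ∧ IsRestrictionOf (Sminus ν) B ∧
      IsRestrictionOf (fun f g => S0plus ν g f) A ∧
      IsRestrictionOf (fun f g => Pminus ν g f) B := by
  obtain ⟨P, P1, P2, h⟩ := exists_isLegendre ν
  obtain ⟨M, hk⟩ := h.exists_isCarleman
  have hs := Real.sin_le_one (Real.pi * ν)
  have hB : ∀ f, ‖(1 - kernelOp hk.swap) f‖ ^ 2
      = ‖f‖ ^ 2 - Real.sin (Real.pi * ν) / Real.pi * carlemanForm f :=
    norm_sq_sub_kernelOp hk fun x z hx hz hxz => h.integral_legendreKernel_mul hx hz hxz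
  have hA : ∀ f, ‖(1 - kernelOp hk) f‖ ^ 2
      = ‖f‖ ^ 2 - Real.sin (Real.pi * ν) / Real.pi * carlemanForm f :=
    norm_sq_sub_kernelOp hk.swap fun x z hx hz hxz => h.integral_legendreKernel_mul' hx hz hxz
  refine ⟨1 - kernelOp hk, 1 - kernelOp hk.swap,
    isCarlemanFactor_of_adjoint hs hA hB hk.adjoint_one_sub,
    isCarlemanFactor_of_adjoint hs hB hA hk.swap.adjoint_one_sub, ?_, ?_, ?_, ?_⟩
  · exact ⟨fun f g hfg => h.eq_of_P0plus hk hfg, dense_testFunctions.mono <| by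
      rintro f ⟨φ, hφ, hf⟩
      exact h.P0plus_of_isTestFunction hk hφ hf⟩
  · refine ⟨fun f g hfg => h.eq_of_Sminus hk hfg, dense_testFunctions.mono ?_⟩
    rintro f ⟨φ, hφ, hf⟩
    obtain ⟨a, b, -, -, -, hb⟩ := hφ.exists_support
    exact h.Sminus_of_support hk (b := b) (by
      filter_upwards [hf] with t ht htb using ht.symm.trans (hb t htb))
  · refine ⟨fun f g hfg => h.eq_of_S0plus hk hfg, dense_testFunctions.mono ?_⟩
    rintro f ⟨φ, hφ, hf⟩
    obtain ⟨a, b, ha, -, hb, -⟩ := hφ.exists_support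
    exact h.S0plus_of_support hk ha (by
      filter_upwards [hf] with t ht htb using ht.symm.trans (hb t htb))
  · exact ⟨fun f g hfg => h.eq_of_Pminus hk hfg, dense_testFunctions.mono <| by
      rintro f ⟨φ, hφ, hf⟩
      exact h.Pminus_of_isTestFunction hk hφ hf⟩

lemma isDenselyDefined_buschmanErdelyi (ν : ℝ) : IsDenselyDefined (S0plus ν) ∧ IsDenselyDefined (Pminus ν) ∧
    IsDenselyDefined (P0plus ν) ∧ IsDenselyDefined (Sminus ν) := by
  obtain ⟨A, B, hA, hB, h1, h2, h3, h4⟩ := exists_isCarlemanFactor ν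
  have hs := Real.abs_sin_le_one (Real.pi * ν)
  exact ⟨h3.isDenselyDefined_of_inverse hA hs, h4.isDenselyDefined_of_inverse hB hs,
    h1.isDenselyDefined, h2.isDenselyDefined⟩

lemma l2Norm_buschmanErdelyi (ν : ℝ) :
    l2Norm (S0plus ν) = 1 / ENNReal.ofReal (min 1 √(1 - Real.sin (Real.pi * ν))) ∧
      l2Norm (Pminus ν) = 1 / ENNReal.ofReal (min 1 √(1 - Real.sin (Real.pi * ν))) ∧
      l2Norm (P0plus ν) = ENNReal.ofReal (max 1 √(1 - Real.sin (Real.pi * ν))) ∧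
      l2Norm (Sminus ν) = ENNReal.ofReal (max 1 √(1 - Real.sin (Real.pi * ν))) := by
  obtain ⟨A, B, hA, hB, h1, h2, h3, h4⟩ := exists_isCarlemanFactor ν
  have hs := Real.abs_sin_le_one (Real.pi * ν)
  exact ⟨h3.l2Norm_eq_of_inverse hA hs, h4.l2Norm_eq_of_inverse hB hs,
    h1.l2Norm_eq hA hs, h2.l2Norm_eq hB hs⟩

lemma isBoundedInL2_iff (ν : ℝ) :
    (¬ IsBoundedInL2 (S0plus ν) ↔ Real.sin (Real.pi * ν) = 1) ∧
      (¬ IsBoundedInL2 (Pminus ν) ↔ Real.sin (Real.pi * ν) = 1) := by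
  obtain ⟨A, B, hA, hB, -, -, h3, h4⟩ := exists_isCarlemanFactor ν
  obtain ⟨e1, e2, -, -⟩ := l2Norm_buschmanErdelyi ν
  have hs := Real.sin_le_one (Real.pi * ν)
  refine ⟨⟨fun hn => hs.antisymm (not_lt.1 fun hlt => hn (h3.isBoundedInL2_of_inverse hA hlt)),
    fun h1 hb => hb.l2Norm_ne_top ?_⟩,
    ⟨fun hn => hs.antisymm (not_lt.1 fun hlt => hn (h4.isBoundedInL2_of_inverse hB hlt)),
    fun h1 hb => hb.l2Norm_ne_top ?_⟩⟩
  · rw [e1, h1]; simp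
  · rw [e2, h1]; simp

lemma sin_pi_mul_add_two (ν : ℝ) : Real.sin (Real.pi * (ν + 2)) = Real.sin (Real.pi * ν) := by
  rw [mul_add, mul_comm Real.pi 2, Real.sin_add_two_pi]

lemma exists_sin_norm (C : ℝ≥0) : ∃ ν : ℝ,
    (C : ℝ≥0∞) < 1 / ENNReal.ofReal (min 1 √(1 - Real.sin (Real.pi * ν))) ∧
      1 / ENNReal.ofReal (min 1 √(1 - Real.sin (Real.pi * ν))) < ∞ := by
  have hC : 0 < (C : ℝ) + 2 := by positivity
  have hpi := Real.pi_pos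
  have h1 : (1 : ℝ) / (C + 2) ≤ 1 := (div_le_one hC).2 (by linarith [C.coe_nonneg])
  have h0 : (0 : ℝ) < 1 / (C + 2) := by positivity
  -- With this ν one has √(1 - sin πν) = 1/(C+2), so the value is C + 2, finite and above C.
  refine ⟨Real.arcsin (1 - (1 / (C + 2)) ^ 2) / Real.pi, ?_⟩
  have hsin : Real.sin (Real.pi * (Real.arcsin (1 - (1 / (C + 2)) ^ 2) / Real.pi))
      = 1 - (1 / (C + 2)) ^ 2 := by
    rw [mul_div_cancel₀ _ hpi.ne', Real.sin_arcsin (by nlinarith) (by nlinarith)]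
  rw [hsin, sub_sub_cancel, Real.sqrt_sq h0.le, min_eq_right h1, one_div ((C : ℝ) + 2),
    ENNReal.ofReal_inv_of_pos hC, one_div, inv_inv]
  refine ⟨?_, ENNReal.ofReal_lt_top⟩
  rw [← ENNReal.ofReal_coe_nnreal]
  exact (ENNReal.ofReal_lt_ofReal_iff hC).2 (by linarith)

lemma sin_pi_mul_eq_one_iff (ν : ℝ) :
    Real.sin (Real.pi * ν) = 1 ↔ ∃ k : ℤ, ν = 2 * (k : ℝ) + 1 / 2 := by
  rw [Real.sin_eq_one_iff]
  refine exists_congr fun k => ⟨fun h => ?_, fun h => ?_⟩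
  · have hpi := Real.pi_pos
    refine mul_left_cancel₀ hpi.ne' ?_
    rw [← h]; ring
  · rw [h]; ring

lemma sin_pi_mul_eq_neg_one_iff (ν : ℝ) :
    Real.sin (Real.pi * ν) = -1 ↔ ∃ k : ℤ, ν = -1 / 2 + 2 * (k : ℝ) := by
  rw [Real.sin_eq_neg_one_iff]
  refine exists_congr fun k => ⟨fun h => ?_, fun h => ?_⟩
  · have hpi := Real.pi_pos
    refine mul_left_cancel₀ hpi.ne' ?_
    rw [← h]; ring
  · rw [h]; ring

lemma one_le_one_div_ofReal_min (s : ℝ) : 1 ≤ 1 / ENNReal.ofReal (min 1 √(1 - s)) := by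
  rw [one_div, ENNReal.one_le_inv]
  exact ENNReal.ofReal_le_one.2 (min_le_left _ _)

lemma one_div_ofReal_min_of_nonpos {s : ℝ} (hs : s ≤ 0) :
    1 / ENNReal.ofReal (min 1 √(1 - s)) = 1 := by
  rw [min_eq_left (Real.one_le_sqrt.2 (by linarith)), ENNReal.ofReal_one, div_one]

lemma ofReal_max_le_sqrt_two {s : ℝ} (hs : -1 ≤ s) :
    ENNReal.ofReal (max 1 √(1 - s)) ≤ ENNReal.ofReal √2 :=
  ENNReal.ofReal_le_ofReal (max_le (Real.one_le_sqrt.2 one_le_two)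
    (Real.sqrt_le_sqrt (by linarith)))

lemma ofReal_max_of_nonneg {s : ℝ} (hs : 0 ≤ s) : ENNReal.ofReal (max 1 √(1 - s)) = 1 := by
  rw [max_eq_left (Real.sqrt_le_one.2 (by linarith)), ENNReal.ofReal_one]

lemma ofReal_max_eq_sqrt_two_iff (s : ℝ) :
    ENNReal.ofReal (max 1 √(1 - s)) = ENNReal.ofReal √2 ↔ s = -1 := by
  have h2 : 1 < √(2 : ℝ) := by rw [Real.lt_sqrt zero_le_one]; norm_num
  rw [ENNReal.ofReal_eq_ofReal_iff (by positivity) (by positivity)]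
  constructor
  · intro h
    have h1 : √(1 - s) = √2 := by
      rcases max_choice 1 √(1 - s) with hc | hc
      · rw [hc] at h; exact absurd h h2.ne
      · rwa [hc] at h
    -- The real square root is 0 at negative arguments, which excludes 1 - s < 0.
    have h0 : 0 ≤ 1 - s := by
      by_contra hn
      rw [Real.sqrt_eq_zero_of_nonpos (by linarith)] at h1
      linarith
    linarith [(Real.sqrt_inj h0 two_pos.le).1 h1]
  · rintro rfl
    norm_num [h2.le]

end

theorem theorem18 :
    -- the operators are densely defined
    (∀ ν : ℝ, IsDenselyDefined (S0plus ν) ∧ IsDenselyDefined (Pminus ν) ∧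
      IsDenselyDefined (P0plus ν) ∧ IsDenselyDefined (Sminus ν)) ∧
    -- the norms (`1 / 0 = ∞`)
    (∀ ν : ℝ,
      l2Norm (S0plus ν) = 1 / ENNReal.ofReal (min 1 √(1 - Real.sin (Real.pi * ν))) ∧
      l2Norm (Pminus ν) = 1 / ENNReal.ofReal (min 1 √(1 - Real.sin (Real.pi * ν))) ∧
      l2Norm (P0plus ν) = ENNReal.ofReal (max 1 √(1 - Real.sin (Real.pi * ν))) ∧
      l2Norm (Sminus ν) = ENNReal.ofReal (max 1 √(1 - Real.sin (Real.pi * ν)))) ∧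
    -- the norms are periodic in `ν` with period `2`
    (∀ ν : ℝ, l2Norm (S0plus (ν + 2)) = l2Norm (S0plus ν) ∧
      l2Norm (Pminus (ν + 2)) = l2Norm (Pminus ν) ∧
      l2Norm (P0plus (ν + 2)) = l2Norm (P0plus ν) ∧
      l2Norm (Sminus (ν + 2)) = l2Norm (Sminus ν)) ∧
    -- the first pair: finite norms are not uniformly bounded in `ν`
    (∀ C : ℝ≥0, ∃ ν : ℝ, (C : ℝ≥0∞) < l2Norm (S0plus ν) ∧ l2Norm (S0plus ν) < ∞) ∧
    (∀ C : ℝ≥0, ∃ ν : ℝ, (C : ℝ≥0∞) < l2Norm (Pminus ν) ∧ l2Norm (Pminus ν) < ∞) ∧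
    -- the first pair: lower bound, the case of norm `1`, unboundedness
    (∀ ν : ℝ, 1 ≤ l2Norm (S0plus ν) ∧ 1 ≤ l2Norm (Pminus ν) ∧
      (Real.sin (Real.pi * ν) ≤ 0 → l2Norm (S0plus ν) = 1 ∧ l2Norm (Pminus ν) = 1) ∧
      (¬ IsBoundedInL2 (S0plus ν) ↔ Real.sin (Real.pi * ν) = 1) ∧
      (¬ IsBoundedInL2 (Pminus ν) ↔ Real.sin (Real.pi * ν) = 1) ∧
      (Real.sin (Real.pi * ν) = 1 ↔ ∃ k : ℤ, ν = 2 * (k : ℝ) + 1 / 2)) ∧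
    -- the second pair: boundedness, the case of norm `1`, the maximal norm
    (∀ ν : ℝ, IsBoundedInL2 (P0plus ν) ∧ IsBoundedInL2 (Sminus ν) ∧
      l2Norm (P0plus ν) ≤ ENNReal.ofReal √2 ∧ l2Norm (Sminus ν) ≤ ENNReal.ofReal √2 ∧
      (0 ≤ Real.sin (Real.pi * ν) → l2Norm (P0plus ν) = 1 ∧ l2Norm (Sminus ν) = 1) ∧
      (l2Norm (P0plus ν) = ENNReal.ofReal √2 ↔ Real.sin (Real.pi * ν) = -1) ∧
      (l2Norm (Sminus ν) = ENNReal.ofReal √2 ↔ Real.sin (Real.pi * ν) = -1) ∧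
      (Real.sin (Real.pi * ν) = -1 ↔ ∃ k : ℤ, ν = -1 / 2 + 2 * (k : ℝ))) := by
  refine ⟨isDenselyDefined_buschmanErdelyi, l2Norm_buschmanErdelyi, fun ν => ?_, fun C => ?_, fun C => ?_, fun ν => ?_,
    fun ν => ?_⟩
  · obtain ⟨e1, e2, e3, e4⟩ := l2Norm_buschmanErdelyi ν
    obtain ⟨e1', e2', e3', e4'⟩ := l2Norm_buschmanErdelyi (ν + 2)
    rw [sin_pi_mul_add_two] at e1' e2' e3' e4'
    exact ⟨e1'.trans e1.symm, e2'.trans e2.symm, e3'.trans e3.symm, e4'.trans e4.symm⟩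
  · obtain ⟨ν, h⟩ := exists_sin_norm C
    exact ⟨ν, by rwa [(l2Norm_buschmanErdelyi ν).1]⟩
  · obtain ⟨ν, h⟩ := exists_sin_norm C
    exact ⟨ν, by rwa [(l2Norm_buschmanErdelyi ν).2.1]⟩
  · obtain ⟨e1, e2, -, -⟩ := l2Norm_buschmanErdelyi ν
    rw [e1, e2]
    exact ⟨one_le_one_div_ofReal_min _, one_le_one_div_ofReal_min _, fun hs =>
      ⟨one_div_ofReal_min_of_nonpos hs, one_div_ofReal_min_of_nonpos hs⟩,
      (isBoundedInL2_iff ν).1, (isBoundedInL2_iff ν).2, sin_pi_mul_eq_one_iff ν⟩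
  · obtain ⟨-, -, e3, e4⟩ := l2Norm_buschmanErdelyi ν
    obtain ⟨A, B, -, -, h1, h2, -, -⟩ := exists_isCarlemanFactor ν
    have hs := Real.neg_one_le_sin (Real.pi * ν)
    rw [e3, e4]
    exact ⟨h1.isBoundedInL2, h2.isBoundedInL2, ofReal_max_le_sqrt_two hs, ofReal_max_le_sqrt_two hs,
      fun h0 => ⟨ofReal_max_of_nonneg h0, ofReal_max_of_nonneg h0⟩,
      ofReal_max_eq_sqrt_two_iff _, ofReal_max_eq_sqrt_two_iff _, sin_pi_mul_eq_neg_one_iff ν⟩
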